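/- Let $M$ be a smooth manifold (Hausdorff, second countable, of dimension $n$, without boundary), let $\mathbb{K}=\mathbb{R}$ or $\mathbb{C}$, and let $k\ge 0$. Write $\underline{\mathbb{K}}$ for the sheaf of locally constant $\mathbb{K}$-valued functions on $M$, $\mathcal{A}^\bullet$ for the complex of sheaves of smooth $\mathbb{K}$-valued differential forms on $M$ with the exterior derivative, and $\mathcal{S}^\bullet$ for the complex of sheaves associated to the presheaves $U\mapsto S^q(U,\mathbb{K})$ of singular $\mathbb{K}$-valued cochains. Let $H^k_{\mathrm{dR}}(M,\mathbb{K})=h^k(\mathcal{A}^\bullet(M))$ be de Rham cohomology and $H^k_{\mathrm{sing}}(M,\mathbb{K})=h^k(S^\bullet(M,\mathbb{K}))$ singular cohomology. For a sheaf $\mathcal{F}$ on $M$ let $\mathcal{C}^0\mathcal{F}$ be the sheaf of all (not necessarily continuous) sections of its étalé space and $0\to\mathcal{F}\to\mathcal{C}^0\mathcal{F}\xrightarrow{\delta}\mathcal{C}^1\mathcal{F}\xrightarrow{\delta}\cdots$ its Godement resolution, let $H^k(M,\mathcal{F})=h^k(\mathcal{C}^\bullet\mathcal{F}(M))$ be sheaf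 cohomology, and for a complex $(\mathcal{L}^\bullet,d)$ of sheaves let $\mathbb{H}^k(M,\mathcal{L}^\bullet)$ be hypercohomology, the cohomology of the total complex of the double complex $\mathcal{C}^p\mathcal{L}^q(M)$ with differential $\delta+(-1)^p d$. The inclusions $\mathcal{L}^q\to\mathcal{C}^0\mathcal{L}^q$ (for $\mathcal{L}=\mathcal{A}$ and $\mathcal{L}=\mathcal{S}$), the canonical maps $S^q(M,\mathbb{K})\to\mathcal{S}^q(M)$, and the inclusions $\underline{\mathbb{K}}\to\mathcal{A}^0$ and $\underline{\mathbb{K}}\to\mathcal{S}^0$ of locally constant functions induce $\mathbb{K}$-linear maps $$H^k_{\mathrm{dR}}(M,\mathbb{K})\xrightarrow{\ a\ }\mathbb{H}^k(M,\mathcal{A}^\bullet)\xleftarrow{\ b\ }H^k(M,\underline{\mathbb{K}})\xrightarrow{\ c\ }\mathbb{H}^k(M,\mathcal{S}^\bullet)\xleftarrow{\ s\ }H^k_{\mathrm{sing}}(M,\mathbb{K}).$$ Theorem (de Rham). The four maps $a,b,c,s$ are isomorphisms. Hence there are canonical isomorphisms of $\mathbb{K}$-vector spaces $$e_1\colon H^k_{\mathrm{dR}}(M,\mathbb{K})\cong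 H^k(M,\underline{\mathbb{K}}),\qquad e_2\colon H^k_{\mathrm{sing}}(M,\mathbb{K})\cong H^k(M,\underline{\mathbb{K}}),\qquad e\colon H^k_{\mathrm{dR}}(M,\mathbb{K})\cong H^k_{\mathrm{sing}}(M,\mathbb{K}),$$ determined by $b\circ e_1=a$, $c\circ e_2=s$ and $e_2\circ e=e_1$. -/

import Mathlib

noncomputable section

namespace DeRham

open CategoryTheory TopologicalSpace Opposite Limits

section Forms

open scoped Manifold ContDiff Topology

variable (𝕜 : Type) [RCLike 𝕜] (E : Type) [NormedAddCommGroup E] [NormedSpace ℝ E]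
  {M : Type} [TopologicalSpace M] [ChartedSpace E M]

/-- Alternating `k`-forms on the tangent space at `x`, with values in `𝕜` (real multilinear). -/
abbrev FormAt (k : ℕ) (x : M) : Type :=
  TangentSpace 𝓘(ℝ, E) x [⋀^Fin k]→L[ℝ] 𝕜

variable {𝕜 E}

open scoped Classical in
/-- A family of forms over an open set, extended by zero to all points of the manifold. -/
def extendForm {k : ℕ} {U : Opens M} (α : ∀ x : U, FormAt 𝕜 E k (x : M)) (x : M) :
    FormAt 𝕜 E k x :=
  if h : x ∈ U then α ⟨x, h⟩ else 0

/-- The representative in a chart `e` of a form over `U`: the pullback of the form along the inverse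
of the chart, a function on (the part over `U` of) the target of the chart. -/
def chartRep {k : ℕ} {U : Opens M} (e : OpenPartialHomeomorph M E)
    (α : ∀ x : U, FormAt 𝕜 E k (x : M)) (y : E) : E [⋀^Fin k]→L[ℝ] 𝕜 :=
  (extendForm α (e.symm y)).compContinuousLinearMap
    (mfderiv 𝓘(ℝ, E) 𝓘(ℝ, E) e.symm y : E →L[ℝ] TangentSpace 𝓘(ℝ, E) (e.symm y))

/-- A form over `U` is smooth if its representatives in all charts are smooth. -/
def IsSmoothForm {k : ℕ} {U : Opens M} (α : ∀ x : U, FormAt 𝕜 E k (x : M)) : Prop :=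
  ∀ e ∈ atlas E M, ContDiffOn ℝ ∞ (chartRep e α) (e.target ∩ e.symm ⁻¹' U)

/-- The exterior derivative: at `x`, differentiate the representative in a chart around `x` and pull
the result back along the chart. By `chartRep_extDerivForm` below any chart gives the same result. -/
def extDerivForm {k : ℕ} {U : Opens M} (α : ∀ x : U, FormAt 𝕜 E k (x : M)) (x : U) :
    FormAt 𝕜 E (k + 1) (x : M) :=
  (extDeriv (chartRep (chartAt E (x : M)) α)
      (chartAt E (x : M) (x : M))).compContinuousLinearMap
    (mfderiv 𝓘(ℝ, E) 𝓘(ℝ, E) (chartAt E (x : M)) (x : M) :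
      TangentSpace 𝓘(ℝ, E) (x : M) →L[ℝ] E)

lemma extendForm_of_mem {k : ℕ} {U : Opens M} (α : ∀ x : U, FormAt 𝕜 E k (x : M)) {x : M}
    (h : x ∈ U) : extendForm α x = α ⟨x, h⟩ := dif_pos h

lemma extendForm_add {k : ℕ} {U : Opens M} (α η : ∀ x : U, FormAt 𝕜 E k (x : M)) (x : M) :
    extendForm (α + η) x = extendForm α x + extendForm η x := by
  by_cases h : x ∈ U <;> simp [extendForm, h]

lemma extendForm_smul {k : ℕ} {U : Opens M} (c : 𝕜) (α : ∀ x : U, FormAt 𝕜 E k (x : M))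
    (x : M) : extendForm (c • α) x = c • extendForm α x := by
  by_cases h : x ∈ U
  · simp [extendForm, h]
  · rw [extendForm, extendForm, dif_neg h, dif_neg h]
    exact (smul_zero (A := FormAt 𝕜 E k x) c).symm

lemma extendForm_zero {k : ℕ} {U : Opens M} (x : M) :
    extendForm (0 : ∀ x : U, FormAt 𝕜 E k (x : M)) x = 0 := by
  by_cases h : x ∈ U <;> simp [extendForm, h]

lemma chartRep_add {k : ℕ} {U : Opens M} (e : OpenPartialHomeomorph M E)
    (α η : ∀ x : U, FormAt 𝕜 E k (x : M)) :
    chartRep e (α + η) = chartRep e α + chartRep e η := by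
  funext y; ext v
  simp only [chartRep, extendForm_add]; rfl

lemma chartRep_smul {k : ℕ} {U : Opens M} (e : OpenPartialHomeomorph M E) (c : 𝕜)
    (α : ∀ x : U, FormAt 𝕜 E k (x : M)) :
    chartRep e (c • α) = c • chartRep e α := by
  funext y; ext v
  simp only [chartRep, extendForm_smul]; rfl

lemma chartRep_zero {k : ℕ} {U : Opens M} (e : OpenPartialHomeomorph M E) :
    chartRep e (0 : ∀ x : U, FormAt 𝕜 E k (x : M)) = 0 := by
  funext y; ext v
  simp only [chartRep, extendForm_zero]; rfl

lemma chartRep_congr {k : ℕ} {U V : Opens M} (e : OpenPartialHomeomorph M E)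
    {α : ∀ x : U, FormAt 𝕜 E k (x : M)} {η : ∀ x : V, FormAt 𝕜 E k (x : M)} {y : E}
    (h : extendForm α (e.symm y) = extendForm η (e.symm y)) :
    chartRep e α y = chartRep e η y := by
  rw [chartRep, h, chartRep]

/-- The part of the image of a chart that lies over an open set is open. -/
lemma isOpen_chartDomain {E M : Type} [TopologicalSpace M] [NormedAddCommGroup E]
    (e : OpenPartialHomeomorph M E) (U : Opens M) :
    IsOpen (e.target ∩ e.symm ⁻¹' U) :=
  e.isOpen_inter_preimage_symm U.2

lemma two_le_smooth : minSmoothness ℝ 2 ≤ (∞ : WithTop ℕ∞) := by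
  rw [minSmoothness_of_isRCLikeNormedField]
  exact WithTop.coe_le_coe.2 le_top

lemma pullback_congr {k : ℕ} {U : Opens M} (α : ∀ x : U, FormAt 𝕜 E k (x : M)) {z z' : M}
    (h : z = z') (A : E →L[ℝ] E) :
    ContinuousAlternatingMap.compContinuousLinearMap
      (extendForm α z : E [⋀^Fin k]→L[ℝ] 𝕜) A =
    ContinuousAlternatingMap.compContinuousLinearMap
      (extendForm α z' : E [⋀^Fin k]→L[ℝ] 𝕜) A := by
  subst h; rfl

lemma chartRep_eventuallyEq_of_le {k : ℕ} {U V : Opens M} (hVU : V ≤ U)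
    (e : OpenPartialHomeomorph M E)
    (α : ∀ x : U, FormAt 𝕜 E k (x : M)) {y : E} (hy : y ∈ e.target) (hyV : e.symm y ∈ V) :
    chartRep e (fun x : V => α ⟨x, hVU x.2⟩) =ᶠ[𝓝 y] chartRep e α := by
  filter_upwards [(isOpen_chartDomain e V).mem_nhds ⟨hy, hyV⟩] with z hz
  refine chartRep_congr e ?_
  rw [extendForm_of_mem _ hz.2, extendForm_of_mem _ (hVU hz.2)]

lemma extDerivForm_restrict {k : ℕ} {U V : Opens M} (hVU : V ≤ U)
    (α : ∀ x : U, FormAt 𝕜 E k (x : M)) :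
    extDerivForm (fun x : V => α ⟨x, hVU x.2⟩) =
      fun x : V => extDerivForm α ⟨x, hVU x.2⟩ := by
  funext x
  have hx := mem_chart_source E (x : M)
  have hV : (chartAt E (x : M)).symm (chartAt E (x : M) x) ∈ V := by
    rw [(chartAt E (x : M)).left_inv hx]; exact x.2
  rw [extDerivForm, (chartRep_eventuallyEq_of_le hVU _ α
    ((chartAt E (x : M)).map_source hx) hV).extDeriv_eq, extDerivForm]

lemma IsSmoothForm.contDiffAt {k : ℕ} {U : Opens M} {α : ∀ x : U, FormAt 𝕜 E k (x : M)}
    (h : IsSmoothForm α) {e : OpenPartialHomeomorph M E} (he : e ∈ atlas E M) {y : E}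
    (hy : y ∈ e.target) (hyU : e.symm y ∈ U) : ContDiffAt ℝ ∞ (chartRep e α) y :=
  (h e he).contDiffAt ((isOpen_chartDomain e U).mem_nhds ⟨hy, hyU⟩)

lemma IsSmoothForm.add {k : ℕ} {U : Opens M} {α η : ∀ x : U, FormAt 𝕜 E k (x : M)}
    (h : IsSmoothForm α) (h' : IsSmoothForm η) : IsSmoothForm (α + η) := fun e he => by
  rw [chartRep_add]; exact (h e he).add (h' e he)

lemma IsSmoothForm.smul {k : ℕ} {U : Opens M} (c : 𝕜) {α : ∀ x : U, FormAt 𝕜 E k (x : M)}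
    (h : IsSmoothForm α) : IsSmoothForm (c • α) := fun e he => by
  rw [chartRep_smul]; exact (h e he).const_smul c

lemma isSmoothForm_zero {k : ℕ} {U : Opens M} :
    IsSmoothForm (0 : ∀ x : U, FormAt 𝕜 E k (x : M)) := fun e _ => by
  rw [chartRep_zero]; exact contDiffOn_const

lemma extDerivForm_add {k : ℕ} {U : Opens M} {α η : ∀ x : U, FormAt 𝕜 E k (x : M)}
    (h : IsSmoothForm α) (h' : IsSmoothForm η) :
    extDerivForm (α + η) = extDerivForm α + extDerivForm η := by
  funext x
  have hx := mem_chart_source E (x : M)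
  have hU : (chartAt E (x : M)).symm (chartAt E (x : M) x) ∈ U := by
    rw [(chartAt E (x : M)).left_inv hx]; exact x.2
  have h1 := (h.contDiffAt (chart_mem_atlas E (x : M))
    ((chartAt E (x : M)).map_source hx) hU).differentiableAt (by simp)
  have h2 := (h'.contDiffAt (chart_mem_atlas E (x : M))
    ((chartAt E (x : M)).map_source hx) hU).differentiableAt (by simp)
  simp only [DeRham.extDerivForm, chartRep_add, Pi.add_apply, extDeriv_add h1 h2]
  rfl

lemma extDerivForm_smul {k : ℕ} {U : Opens M} (c : 𝕜) {α : ∀ x : U, FormAt 𝕜 E k (x : M)}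
    (h : IsSmoothForm α) : extDerivForm (c • α) = c • extDerivForm α := by
  funext x
  have hx := mem_chart_source E (x : M)
  have hU : (chartAt E (x : M)).symm (chartAt E (x : M) x) ∈ U := by
    rw [(chartAt E (x : M)).left_inv hx]; exact x.2
  have h1 := (h.contDiffAt (chart_mem_atlas E (x : M))
    ((chartAt E (x : M)).map_source hx) hU).differentiableAt (by simp)
  have h2 : extDeriv (c • chartRep (chartAt E (x : M)) α) (chartAt E (x : M) x) =
      c • extDeriv (chartRep (chartAt E (x : M)) α) (chartAt E (x : M) x) := by
    rw [extDeriv, fderiv_const_smul h1, ContinuousAlternatingMap.alternatizeUncurryFin_smul,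
      extDeriv]
  simp only [DeRham.extDerivForm, chartRep_smul, h2, Pi.smul_apply]
  rfl

variable [IsManifold 𝓘(ℝ, E) ∞ M]

lemma mdifferentiableAt_chart {e : OpenPartialHomeomorph M E} (he : e ∈ atlas E M) {x : M}
    (hx : x ∈ e.source) : MDifferentiableAt 𝓘(ℝ, E) 𝓘(ℝ, E) e x :=
  (contMDiffAt_of_mem_maximalAtlas (n := ∞)
    (IsManifold.subset_maximalAtlas he) hx).mdifferentiableAt (by simp)

lemma mdifferentiableAt_chart_symm {e : OpenPartialHomeomorph M E} (he : e ∈ atlas E M) {y : E}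
    (hy : y ∈ e.target) : MDifferentiableAt 𝓘(ℝ, E) 𝓘(ℝ, E) e.symm y :=
  (contMDiffAt_symm_of_mem_maximalAtlas (n := ∞)
    (IsManifold.subset_maximalAtlas he) hy).mdifferentiableAt (by simp)

lemma contDiffAt_transition {e e' : OpenPartialHomeomorph M E} (he : e ∈ atlas E M)
    (he' : e' ∈ atlas E M) {y : E} (hy : y ∈ e.target) (hy' : e.symm y ∈ e'.source) :
    ContDiffAt ℝ ∞ (e' ∘ e.symm) y := by
  rw [← contMDiffAt_iff_contDiffAt]
  exact (contMDiffAt_of_mem_maximalAtlas (n := ∞) (I := 𝓘(ℝ, E))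
    (IsManifold.subset_maximalAtlas he') hy').comp y
    (contMDiffAt_symm_of_mem_maximalAtlas (IsManifold.subset_maximalAtlas he) hy)

/-- Two local representatives differ by the pullback along the transition map. -/
lemma chartRep_transition {k : ℕ} {U : Opens M} {e e' : OpenPartialHomeomorph M E}
    (he : e ∈ atlas E M) (he' : e' ∈ atlas E M) (α : ∀ x : U, FormAt 𝕜 E k (x : M)) {y : E}
    (hy : y ∈ e.target) (hy' : e.symm y ∈ e'.source) :
    chartRep e α y = (chartRep e' α ((e' ∘ e.symm) y)).compContinuousLinearMap
      (fderiv ℝ (e' ∘ e.symm) y) := by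
  have hev : e.symm =ᶠ[𝓝 y] e'.symm ∘ (e' ∘ e.symm) := by
    have : ∀ᶠ z in 𝓝 y, e.symm z ∈ e'.source :=
      (e.symm.continuousAt hy).eventually (e'.open_source.mem_nhds hy')
    filter_upwards [this] with z hz
    exact (e'.left_inv hz).symm
  have hτ := contDiffAt_transition he he' hy hy'
  have hmem : (e' ∘ e.symm) y ∈ e'.target := e'.map_source hy'
  have hpt : e.symm y = e'.symm ((e' ∘ e.symm) y) := (e'.left_inv hy').symm
  generalize (e' ∘ e.symm : E → E) = τ at hev hτ hmem hpt ⊢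
  have hτ' : MDifferentiableAt 𝓘(ℝ, E) 𝓘(ℝ, E) τ y :=
    (hτ.differentiableAt (by simp)).mdifferentiableAt
  have hd : (mfderiv 𝓘(ℝ, E) 𝓘(ℝ, E) e.symm y : E →L[ℝ] E) =
      (mfderiv 𝓘(ℝ, E) 𝓘(ℝ, E) e'.symm (τ y) : E →L[ℝ] E) ∘L (fderiv ℝ τ y : E →L[ℝ] E) := by
    have h1 : (mfderiv 𝓘(ℝ, E) 𝓘(ℝ, E) e.symm y : E →L[ℝ] E) =
      (mfderiv 𝓘(ℝ, E) 𝓘(ℝ, E) (e'.symm ∘ τ) y : E →L[ℝ] E) := hev.mfderiv_eq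
    have h2 : (mfderiv 𝓘(ℝ, E) 𝓘(ℝ, E) τ y : E →L[ℝ] E) = fderiv ℝ τ y := mfderiv_eq_fderiv
    rw [← h2]
    exact h1.trans (mfderiv_comp y (mdifferentiableAt_chart_symm he' hmem) hτ')
  have key : chartRep e α y = ContinuousAlternatingMap.compContinuousLinearMap
      (extendForm α (e.symm y) : E [⋀^Fin k]→L[ℝ] 𝕜)
      (mfderiv 𝓘(ℝ, E) 𝓘(ℝ, E) e.symm y : E →L[ℝ] E) := rfl
  rw [key, hd]
  exact pullback_congr α hpt _

/-- In every chart, the exterior derivative is the exterior derivative of the representative. -/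
lemma chartRep_extDerivForm {k : ℕ} {U : Opens M} {α : ∀ x : U, FormAt 𝕜 E k (x : M)}
    (h : IsSmoothForm α) {e : OpenPartialHomeomorph M E} (he : e ∈ atlas E M) {y : E}
    (hy : y ∈ e.target) (hyU : e.symm y ∈ U) :
    chartRep e (extDerivForm α) y = extDeriv (chartRep e α) y := by
  set c := chartAt E (e.symm y) with hc
  have hcA : c ∈ atlas E M := chart_mem_atlas E _
  have hsrc : e.symm y ∈ c.source := mem_chart_source E _
  have htgt : (c ∘ e.symm) y ∈ c.target := c.map_source hsrc
  have hleft : c.symm ((c ∘ e.symm) y) = e.symm y := c.left_inv hsrc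
  have hev : chartRep e α =ᶠ[𝓝 y] fun z => (chartRep c α ((c ∘ e.symm) z)).compContinuousLinearMap
      (fderiv ℝ (c ∘ e.symm) z) := by
    have h1 : ∀ᶠ z in 𝓝 y, e.symm z ∈ c.source :=
      (e.symm.continuousAt hy).eventually (c.open_source.mem_nhds hsrc)
    filter_upwards [h1, e.open_target.mem_nhds hy] with z hz hz'
    exact chartRep_transition he hcA α hz' hz
  rw [hev.extDeriv_eq, extDeriv_pullback (r := ∞)
    ((h.contDiffAt hcA htgt (by rw [hleft]; exact hyU)).differentiableAt (by simp))
    (contDiffAt_transition he hcA hy hsrc) two_le_smooth]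
  have hd : fderiv ℝ (c ∘ e.symm) y =
      (mfderiv 𝓘(ℝ, E) 𝓘(ℝ, E) c (e.symm y) : E →L[ℝ] E) ∘L
        (mfderiv 𝓘(ℝ, E) 𝓘(ℝ, E) e.symm y : E →L[ℝ] E) := by
    rw [← mfderiv_eq_fderiv]
    exact mfderiv_comp y (mdifferentiableAt_chart hcA hsrc) (mdifferentiableAt_chart_symm he hy)
  rw [hd, chartRep, extendForm_of_mem _ hyU]
  rfl

lemma IsSmoothForm.extDerivForm {k : ℕ} {U : Opens M} {α : ∀ x : U, FormAt 𝕜 E k (x : M)}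
    (h : IsSmoothForm α) : IsSmoothForm (extDerivForm α) := by
  intro e he
  have h1 : ContDiffOn ℝ ∞ (extDeriv (chartRep e α)) (e.target ∩ e.symm ⁻¹' U) := by
    intro y hy
    have h2 : ContDiffAt ℝ ∞ (fderiv ℝ (chartRep e α)) y :=
      (h.contDiffAt he hy.1 hy.2).fderiv_right (m := ∞) (by simp)
    exact ((ContinuousAlternatingMap.alternatizeUncurryFinCLM ℝ E 𝕜).contDiff.contDiffAt.comp y
      h2).contDiffWithinAt
  exact h1.congr fun y hy => chartRep_extDerivForm h he hy.1 hy.2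

lemma extDerivForm_extDerivForm {k : ℕ} {U : Opens M} {α : ∀ x : U, FormAt 𝕜 E k (x : M)}
    (h : IsSmoothForm α) : extDerivForm (extDerivForm α) = 0 := by
  funext x
  have hx := mem_chart_source E (x : M)
  set c := chartAt E (x : M) with hc
  have hU : c.symm (c x) ∈ U := by
    rw [c.left_inv hx]; exact x.2
  have hev : chartRep c (extDerivForm α) =ᶠ[𝓝 (c x)] extDeriv (chartRep c α) := by
    filter_upwards [(isOpen_chartDomain c U).mem_nhds ⟨c.map_source hx, hU⟩] with y hy
    exact chartRep_extDerivForm h (chart_mem_atlas E _) hy.1 hy.2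
  have h0 : extDeriv (chartRep c (extDerivForm α)) (c x) = 0 := by
    rw [hev.extDeriv_eq]
    exact extDeriv_extDeriv_apply
      (h.contDiffAt (chart_mem_atlas E _) (c.map_source hx) hU) two_le_smooth
  rw [DeRham.extDerivForm, ← hc, h0]
  rfl

end Forms

section SectionSheaf

variable {R : Type} [CommRing R] {X : TopCat.{0}} {T : X → Type} [∀ x, AddCommGroup (T x)]
  [∀ x, Module R (T x)]

variable (R T) in
/-- A family of submodules of the modules of all functions on open sets (with values `f x` in `T x`)
that is defined by a local condition. -/
structure LocalSubmodule where
  carrier : ∀ U : Opens X, Submodule R (∀ x : U, T x)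
  res : ∀ {U V : Opens X} (h : V ≤ U) (f : ∀ x : U, T x), f ∈ carrier U →
    (fun x : V => f ⟨x, h x.2⟩) ∈ carrier V
  locality : ∀ {U : Opens X} (f : ∀ x : U, T x),
    (∀ x : U, ∃ (V : Opens X) (h : V ≤ U), (x : X) ∈ V ∧
      (fun y : V => f ⟨y, h y.2⟩) ∈ carrier V) → f ∈ carrier U

/-- The presheaf of functions satisfying the local condition, with restriction of functions. -/
def LocalSubmodule.presheaf (P : LocalSubmodule R T) : TopCat.Presheaf (ModuleCat.{0} R) X where
  obj U := ModuleCat.of R (P.carrier U.unop)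
  map {U V} i := ModuleCat.ofHom
    { toFun := fun f => ⟨fun x => f.1 ⟨x, i.unop.le x.2⟩, P.res i.unop.le f.1 f.2⟩
      map_add' := fun _ _ => rfl
      map_smul' := fun _ _ => rfl }

def LocalSubmodule.localPredicate (P : LocalSubmodule R T) : TopCat.LocalPredicate T where
  pred {U} f := f ∈ P.carrier U
  res i f h := P.res i.le f h
  locality f w := P.locality f fun x => by
    obtain ⟨V, hx, i, h⟩ := w x
    exact ⟨V, i.le, hx, h⟩

/-- The sheaf of functions satisfying the local condition. -/
def LocalSubmodule.sheaf (P : LocalSubmodule R T) : TopCat.Sheaf (ModuleCat.{0} R) X :=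
  ⟨P.presheaf, (TopCat.Presheaf.isSheaf_iff_isSheaf_comp (forget (ModuleCat.{0} R))
    P.presheaf).2 (TopCat.subpresheafToTypes.isSheaf P.localPredicate)⟩

variable (R) in
/-- The condition of being locally constant. -/
def constantLocalSubmodule (X : TopCat.{0}) : LocalSubmodule R (fun _ : X => R) where
  carrier U :=
    { carrier := {f | IsLocallyConstant f}
      add_mem' := fun hf hg => hf.add hg
      zero_mem' := IsLocallyConstant.const 0
      smul_mem' := fun c _ hf => hf.comp (c • ·) }
  res {U V} h f hf := hf.comp_continuous (continuous_inclusion h)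
  locality {U} f w := by
    refine (IsLocallyConstant.iff_exists_open f).2 fun x => ?_
    obtain ⟨V, h, hxV, hV⟩ := w x
    obtain ⟨W, hW, hxW, hWf⟩ := (IsLocallyConstant.iff_exists_open _).1 hV ⟨x, hxV⟩
    have ho : IsOpenMap (Set.inclusion h) := (Opens.isOpenEmbedding_of_le h).isOpenMap
    refine ⟨Set.inclusion h '' W, ho W hW, ⟨⟨x, hxV⟩, hxW, rfl⟩, ?_⟩
    rintro _ ⟨y, hy, rfl⟩
    exact hWf y hy

variable (R) in
/-- The constant sheaf with values in `R`: the sheaf of locally constant functions. -/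
abbrev locallyConstantSheaf (X : TopCat.{0}) : TopCat.Sheaf (ModuleCat.{0} R) X :=
  (constantLocalSubmodule R X).sheaf

end SectionSheaf

section Godement

variable {R : Type} [CommRing R] {X : TopCat.{0}}

variable (R X) in
/-- Sheaves of `R`-modules on `X`. -/
abbrev Sh := TopCat.Sheaf (ModuleCat.{0} R) X

variable (R) in
/-- The empty condition. -/
def allSections (T : X → Type) [∀ x, AddCommGroup (T x)] [∀ x, Module R (T x)] :
    LocalSubmodule R T where
  carrier _ := ⊤
  res _ _ _ := trivial
  locality _ _ := trivial

/-- The sheaf of all, continuous or not, sections of the étalé space of `F`: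
its sections over `U` are the elements of the product of the stalks of `F` at the points of `U`. -/
def godementZeroObj (F : Sh R X) : Sh R X :=
  (allSections R fun x : X => F.presheaf.stalk x).sheaf

lemma sheaf_hom_ext {F G : Sh R X} {f g : F ⟶ G}
    (h : ∀ (U : (Opens X)ᵒᵖ) (s : F.obj.obj U), (f.hom.app U).hom s = (g.hom.app U).hom s) :
    f = g :=
  ObjectProperty.hom_ext _ (NatTrans.ext (funext fun U => ModuleCat.hom_ext
    (LinearMap.ext fun s => h U s)))

/-- A morphism of sheaves acts on discontinuous sections through the stalk maps. -/
def godementZeroMap {F G : Sh R X} (f : F ⟶ G) : godementZeroObj F ⟶ godementZeroObj G :=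
  ⟨{ app := fun _ => ModuleCat.ofHom
      { toFun := fun s => ⟨fun x => ((TopCat.Presheaf.stalkFunctor (ModuleCat.{0} R) (x : X)).map
          f.hom).hom (s.1 x), trivial⟩
        map_add' := fun s t => Subtype.ext (funext fun x => map_add _ (s.1 x) (t.1 x))
        map_smul' := fun c s => Subtype.ext (funext fun x => map_smul _ c (s.1 x)) }
     naturality := fun _ _ _ => rfl }⟩

/-- The functor of discontinuous sections (the zeroth Godement functor). -/
def godementZero : Sh R X ⥤ Sh R X where
  obj := godementZeroObj
  map := godementZeroMap
  map_id F := sheaf_hom_ext fun U s => Subtype.ext (funext fun x => by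
    change ((TopCat.Presheaf.stalkFunctor (ModuleCat.{0} R) (x : X)).map (𝟙 F.presheaf)).hom _ = _
    rw [CategoryTheory.Functor.map_id]
    rfl)
  map_comp {F G H} f g := sheaf_hom_ext fun U s => Subtype.ext (funext fun x => by
    change ((TopCat.Presheaf.stalkFunctor (ModuleCat.{0} R) (x : X)).map (f.hom ≫ g.hom)).hom _ = _
    rw [CategoryTheory.Functor.map_comp]
    rfl)

instance : (godementZero (R := R) (X := X)).Additive where
  map_add {F G f g} := sheaf_hom_ext fun U s => Subtype.ext (funext fun x => by
    change ((TopCat.Presheaf.stalkFunctor (ModuleCat.{0} R) (x : X)).map (f.hom + g.hom)).hom _ = _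
    rw [Functor.map_add]
    rfl)

/-- The inclusion of `F` into its discontinuous sections, by taking germs. -/
def godementUnit (F : Sh R X) : F ⟶ godementZero.obj F :=
  ⟨{ app := fun U => ModuleCat.ofHom
      { toFun := fun s => ⟨fun x => (F.presheaf.germ U.unop x x.2).hom s, trivial⟩
        map_add' := fun s t => Subtype.ext (funext fun _ => map_add _ s t)
        map_smul' := fun c s => Subtype.ext (funext fun _ => map_smul _ c s) }
     naturality := fun _ _ i => ModuleCat.hom_ext (LinearMap.ext fun s =>
       Subtype.ext (funext fun x =>
         TopCat.Presheaf.germ_res_apply' F.presheaf i x.1 x.2 s)) }⟩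

lemma godementUnit_naturality {F G : Sh R X} (f : F ⟶ G) :
    f ≫ godementUnit G = godementUnit F ≫ godementZero.map f :=
  sheaf_hom_ext fun U s => Subtype.ext (funext fun x =>
    (TopCat.Presheaf.stalkFunctor_map_germ_apply' (F := F.presheaf) (G := G.presheaf)
      U.unop x.1 x.2 f.hom s).symm)

/-- The quotient sheaf of the discontinuous sections of `F` by `F`. -/
def godementQuotient : Sh R X ⥤ Sh R X where
  obj F := cokernel (godementUnit F)
  map {F G} f := cokernel.map _ _ f (godementZero.map f) (godementUnit_naturality f).symm

/-- The projection from discontinuous sections to the quotient sheaf. -/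
def godementProj (F : Sh R X) : godementZero.obj F ⟶ godementQuotient.obj F :=
  cokernel.π (godementUnit F)

lemma godementProj_naturality {F G : Sh R X} (f : F ⟶ G) :
    godementZero.map f ≫ godementProj G = godementProj F ≫ godementQuotient.map f :=
  (cokernel.π_desc _ _ _).symm

lemma godementUnit_proj (F : Sh R X) : godementUnit F ≫ godementProj F = 0 :=
  cokernel.condition _

instance (F : Sh R X) : Epi (godementProj F) :=
  inferInstanceAs (Epi (cokernel.π (godementUnit F)))

instance : (godementQuotient (R := R) (X := X)).Additive where
  map_add {F G f g} := by
    rw [← cancel_epi (godementProj F), ← godementProj_naturality, Functor.map_add,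
      Preadditive.add_comp, Preadditive.comp_add, godementProj_naturality,
      godementProj_naturality]

variable (R X) in
/-- The iterated quotients: first `F` itself, then the quotient of the discontinuous sections of the
previous sheaf by that sheaf. -/
def godementQ : ℕ → (Sh R X ⥤ Sh R X)
  | 0 => 𝟭 _
  | p + 1 => godementQ p ⋙ godementQuotient

instance godementQ_additive : ∀ p, (godementQ R X p).Additive
  | 0 => inferInstanceAs (𝟭 (Sh R X)).Additive
  | p + 1 =>
    haveI := godementQ_additive p
    inferInstanceAs (godementQ R X p ⋙ godementQuotient).Additive

variable (R X) in
/-- The Godement functors: discontinuous sections of the iterated quotients. -/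
def godementC (p : ℕ) : Sh R X ⥤ Sh R X := godementQ R X p ⋙ godementZero

instance (p : ℕ) : (godementC R X p).Additive :=
  inferInstanceAs (godementQ R X p ⋙ godementZero).Additive

/-- Project discontinuous sections to the quotient sheaf, then include the latter into its
discontinuous sections. -/
def godementDelta (F : Sh R X) :
    godementZero.obj F ⟶ godementZero.obj (godementQuotient.obj F) :=
  godementProj F ≫ godementUnit (godementQuotient.obj F)

lemma godementDelta_naturality {F G : Sh R X} (f : F ⟶ G) :
    godementZero.map f ≫ godementDelta G =
      godementDelta F ≫ godementZero.map (godementQuotient.map f) := by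
  rw [godementDelta, godementDelta, ← Category.assoc, godementProj_naturality, Category.assoc,
    godementUnit_naturality, Category.assoc]

lemma godementUnit_delta (F : Sh R X) : godementUnit F ≫ godementDelta F = 0 := by
  rw [godementDelta, ← Category.assoc, godementUnit_proj, zero_comp]

lemma godementDelta_delta (F : Sh R X) :
    godementDelta F ≫ godementDelta (godementQuotient.obj F) = 0 := by
  rw [godementDelta, Category.assoc, godementUnit_delta, comp_zero]

variable (R X) in
/-- The differential of the Godement resolution. -/
def godementD (p : ℕ) : godementC R X p ⟶ godementC R X (p + 1) where
  app F := godementDelta ((godementQ R X p).obj F)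
  naturality _ _ f := godementDelta_naturality ((godementQ R X p).map f)

lemma godementD_comp (p : ℕ) : godementD R X p ≫ godementD R X (p + 1) = 0 :=
  NatTrans.ext (funext fun F => godementDelta_delta ((godementQ R X p).obj F))

/-- The Godement canonical resolution of `F` (without its first term `F`). -/
def godementResolution (F : Sh R X) : CochainComplex (Sh R X) ℕ :=
  CochainComplex.of (fun p => (godementC R X p).obj F) (fun p => (godementD R X p).app F)
    (fun p => congrArg (fun t => t.app F) (godementD_comp p))

variable (R X) in
/-- The global section functor. -/
def globalSections : Sh R X ⥤ ModuleCat.{0} R :=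
  TopCat.Sheaf.forget (ModuleCat.{0} R) X ⋙ (evaluation _ _).obj (op ⊤)

instance : (globalSections R X).Additive where



/-- The sign convention `(-1) ^ p` for total complexes of double complexes indexed by natural numbers. -/
instance : (ComplexShape.up ℕ).TensorSigns where
  ε' := MonoidHom.mk' (fun (i : ℕ) => (-1 : ℤˣ) ^ i) (pow_add (-1 : ℤˣ))
  rel_add p q r (hpq : p + 1 = q) := show p + r + 1 = q + r by omega
  add_rel p q r (hpq : p + 1 = q) := show r + p + 1 = r + q by omega
  ε'_succ := by
    rintro p _ rfl
    change (-1 : ℤˣ) ^ (p + 1) = -(-1 : ℤˣ) ^ p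
    rw [pow_succ, mul_neg, mul_one]

variable (R X) in
/-- Global sections of the Godement functors. -/
def godementSections (p : ℕ) : Sh R X ⥤ ModuleCat.{0} R := godementC R X p ⋙ globalSections R X

instance (p : ℕ) : (godementSections R X p).Additive :=
  inferInstanceAs (godementC R X p ⋙ globalSections R X).Additive

variable (R X) in
/-- The differential of the Godement resolution on global sections. -/
def godementSectionsD (p : ℕ) : godementSections R X p ⟶ godementSections R X (p + 1) :=
  Functor.whiskerRight (godementD R X p) (globalSections R X)

lemma godementSectionsD_comp (p : ℕ) (F : Sh R X) :
    (godementSectionsD R X p).app F ≫ (godementSectionsD R X (p + 1)).app F = 0 := by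
  have h : (godementD R X p).app F ≫ (godementD R X (p + 1)).app F = 0 :=
    congrArg (fun t => t.app F) (godementD_comp p)
  exact ((globalSections R X).map_comp _ _).symm.trans
    ((congrArg (globalSections R X).map h).trans ((globalSections R X).map_zero _ _))

/-- The double complex with the global sections of the `p`-th Godement sheaf of `L.X q` in bidegree
`(p, q)`. -/
def godementDouble (L : CochainComplex (Sh R X) ℕ) :
    HomologicalComplex₂ (ModuleCat.{0} R) (ComplexShape.up ℕ) (ComplexShape.up ℕ) :=
  CochainComplex.of
    (fun p => ((godementSections R X p).mapHomologicalComplex (ComplexShape.up ℕ)).obj L)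
    (fun p => (NatTrans.mapHomologicalComplex (godementSectionsD R X p)
      (ComplexShape.up ℕ)).app L)
    (fun p => HomologicalComplex.hom_ext _ _ fun q => godementSectionsD_comp p (L.X q))

/-- The total complex of the double complex, with differential `δ + (-1) ^ p d` on bidegree `(p, q)`
(see `ιTotal_d`). -/
def hyperComplex (L : CochainComplex (Sh R X) ℕ) : CochainComplex (ModuleCat.{0} R) ℕ :=
  (godementDouble L).total (ComplexShape.up ℕ)

/-- Hypercohomology of a complex of sheaves. -/
abbrev hypercohomology (L : CochainComplex (Sh R X) ℕ) (k : ℕ) : ModuleCat.{0} R :=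
  (hyperComplex L).homology k

/-- The complex of global sections of a complex of sheaves. -/
abbrev sectionComplex (L : CochainComplex (Sh R X) ℕ) : CochainComplex (ModuleCat.{0} R) ℕ :=
  ((globalSections R X).mapHomologicalComplex (ComplexShape.up ℕ)).obj L

/-- The complex of global sections of the Godement resolution. -/
abbrev godementComplex (F : Sh R X) : CochainComplex (ModuleCat.{0} R) ℕ :=
  sectionComplex (godementResolution F)

/-- Sheaf cohomology: the cohomology of the global sections of the Godement resolution. -/
abbrev sheafCohomology (F : Sh R X) (k : ℕ) : ModuleCat.{0} R :=
  (godementComplex F).homology k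

lemma godementDouble_d (L : CochainComplex (Sh R X) ℕ) (p q : ℕ) :
    ((godementDouble L).d p (p + 1)).f q = (godementSectionsD R X p).app (L.X q) :=
  HomologicalComplex.congr_hom (CochainComplex.of_d
    (fun p => ((godementSections R X p).mapHomologicalComplex (ComplexShape.up ℕ)).obj L)
    (fun p => (NatTrans.mapHomologicalComplex (godementSectionsD R X p)
      (ComplexShape.up ℕ)).app L) p) q

lemma godementComplex_d (F : Sh R X) (p : ℕ) :
    (godementComplex F).d p (p + 1) = (godementSectionsD R X p).app F :=
  congrArg (globalSections R X).map (CochainComplex.of_d (fun p => (godementC R X p).obj F)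
    (fun p => (godementD R X p).app F) p)

lemma ιTotal_d (K : HomologicalComplex₂ (ModuleCat.{0} R) (ComplexShape.up ℕ)
    (ComplexShape.up ℕ)) (p q n : ℕ) (h : p + q = n) :
    K.ιTotal (ComplexShape.up ℕ) p q n h ≫ (K.total (ComplexShape.up ℕ)).d n (n + 1) =
      (K.d p (p + 1)).f q ≫ K.ιTotal (ComplexShape.up ℕ) (p + 1) q (n + 1)
        (show p + 1 + q = n + 1 by omega) +
      ((-1 : ℤˣ) ^ p) • (K.X p).d q (q + 1) ≫ K.ιTotal (ComplexShape.up ℕ) p (q + 1) (n + 1)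
        (show p + (q + 1) = n + 1 by omega) := by
  change _ ≫ (K.D₁ _ _ _ + K.D₂ _ _ _) = _
  rw [Preadditive.comp_add, HomologicalComplex₂.ι_D₁, HomologicalComplex₂.ι_D₂,
    HomologicalComplex₂.d₁_eq K (ComplexShape.up ℕ)
      (show (ComplexShape.up ℕ).Rel p (p + 1) from rfl) q (n + 1)
      (show p + 1 + q = n + 1 by omega),
    HomologicalComplex₂.d₂_eq K (ComplexShape.up ℕ) p
      (show (ComplexShape.up ℕ).Rel q (q + 1) from rfl) (n + 1)
      (show p + (q + 1) = n + 1 by omega)]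
  congr 1
  exact one_smul _ _

/-- A morphism from a complex to the column `p = 0` of a double complex, annihilated by the horizontal
differential, gives a morphism to the total complex. -/
def columnEdge (K : HomologicalComplex₂ (ModuleCat.{0} R) (ComplexShape.up ℕ)
    (ComplexShape.up ℕ)) (A : CochainComplex (ModuleCat.{0} R) ℕ)
    (f : ∀ q, A.X q ⟶ (K.X 0).X q)
    (h0 : ∀ q, f q ≫ (K.d 0 1).f q = 0)
    (h1 : ∀ q, f q ≫ (K.X 0).d q (q + 1) = A.d q (q + 1) ≫ f (q + 1)) :
    A ⟶ K.total (ComplexShape.up ℕ) where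
  f q := f q ≫ K.ιTotal (ComplexShape.up ℕ) 0 q q (zero_add q)
  comm' := by
    rintro q _ rfl
    have h2 := ιTotal_d K 0 q q (zero_add q)
    rw [pow_zero, one_smul] at h2
    rw [Category.assoc, h2, Preadditive.comp_add, ← Category.assoc, h0, zero_comp, zero_add,
      ← Category.assoc, h1, Category.assoc]

/-- A morphism from a complex to the row `q = 0` of a double complex, annihilated by the vertical
differential, gives a morphism to the total complex. -/
def rowEdge (K : HomologicalComplex₂ (ModuleCat.{0} R) (ComplexShape.up ℕ)
    (ComplexShape.up ℕ)) (A : CochainComplex (ModuleCat.{0} R) ℕ)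
    (f : ∀ p, A.X p ⟶ (K.X p).X 0)
    (h0 : ∀ p, f p ≫ (K.X p).d 0 1 = 0)
    (h1 : ∀ p, f p ≫ (K.d p (p + 1)).f 0 = A.d p (p + 1) ≫ f (p + 1)) :
    A ⟶ K.total (ComplexShape.up ℕ) where
  f p := f p ≫ K.ιTotal (ComplexShape.up ℕ) p 0 p (add_zero p)
  comm' := by
    rintro p _ rfl
    have h2 := ιTotal_d K p 0 p (add_zero p)
    rw [Category.assoc, h2, Preadditive.comp_add, ← Category.assoc, h1, Linear.comp_units_smul,
      ← Category.assoc (f p), h0, zero_comp, smul_zero, add_zero, Category.assoc]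

/-- The canonical map from the global sections of a complex `L` of sheaves to the complex that computes
its hypercohomology: a section of `L.X q` goes to its germs, in bidegree `(0, q)`. -/
def sectionsToHyper (L : CochainComplex (Sh R X) ℕ) : sectionComplex L ⟶ hyperComplex L :=
  columnEdge (godementDouble L) (sectionComplex L)
    (fun q => (globalSections R X).map (godementUnit (L.X q)))
    (fun q => by
      rw [godementDouble_d]
      exact ((globalSections R X).map_comp _ _).symm.trans
        ((congrArg (globalSections R X).map (godementUnit_delta (L.X q))).trans
          ((globalSections R X).map_zero _ _)))
    (fun q => ((globalSections R X).map_comp _ _).symm.trans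
      ((congrArg (globalSections R X).map (godementUnit_naturality (L.d q (q + 1))).symm).trans
        ((globalSections R X).map_comp _ _)))

/-- The canonical map from the complex that computes the cohomology of `F` to the one that computes the
hypercohomology of `L`, induced by an augmentation `ε` of `L` by `F`; it lands in bidegrees `(p, 0)`. -/
def sheafToHyper {F : Sh R X} {L : CochainComplex (Sh R X) ℕ} (ε : F ⟶ L.X 0)
    (hε : ε ≫ L.d 0 1 = 0) : godementComplex F ⟶ hyperComplex L :=
  rowEdge (godementDouble L) (godementComplex F)
    (fun p => (godementSections R X p).map ε)
    (fun p => ((godementSections R X p).map_comp _ _).symm.trans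
      ((congrArg (godementSections R X p).map hε).trans
        ((godementSections R X p).map_zero _ _)))
    (fun p => by
      rw [godementDouble_d, godementComplex_d]
      exact (godementSectionsD R X p).naturality ε)

end Godement

section Singular

variable (R : Type) [CommRing R]

/-- The module of all `R`-valued functions on a set, a contravariant functor. -/
def functionsFunctor : Typeᵒᵖ ⥤ ModuleCat.{0} R where
  obj T := ModuleCat.of R (T.unop → R)
  map f := ModuleCat.ofHom (LinearMap.funLeft R R f.unop)

/-- The cosimplicial module of `R`-valued functions on singular simplices. -/
def singularCosimplicial : TopCat.{0}ᵒᵖ ⥤ CosimplicialObject (ModuleCat.{0} R) where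
  obj Y := (TopCat.toSSet.obj Y.unop).rightOp ⋙ functionsFunctor R
  map f := Functor.whiskerRight (NatTrans.rightOp (TopCat.toSSet.map f.unop)) (functionsFunctor R)

/-- The complex of singular cochains with values in `R`: functions on the singular `q`-simplices, with
the alternating sum of the restrictions to the faces as differential. -/
def singularCochains : TopCat.{0}ᵒᵖ ⥤ CochainComplex (ModuleCat.{0} R) ℕ :=
  singularCosimplicial R ⋙ AlgebraicTopology.alternatingCofaceMapComplex (ModuleCat.{0} R)

/-- Singular cohomology with coefficients in `R`. -/
abbrev singularCohomology (X : TopCat.{0}) (k : ℕ) : ModuleCat.{0} R :=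
  ((singularCochains R).obj (op X)).homology k

/-- The complex of presheaves of singular cochains on the open subsets of `X`. -/
def cochainPresheaf (X : TopCat.{0}) : CochainComplex (TopCat.Presheaf (ModuleCat.{0} R) X) ℕ where
  X q := (Opens.toTopCat X).op ⋙ singularCochains R ⋙ HomologicalComplex.eval _ _ q
  d q q' :=
    { app := fun U => ((singularCochains R).obj (op ((Opens.toTopCat X).obj U.unop))).d q q'
      naturality := fun _ _ i =>
        ((singularCochains R).map ((Opens.toTopCat X).map i.unop).op).comm q q' }
  shape q q' h := NatTrans.ext (funext fun U =>
    ((singularCochains R).obj (op ((Opens.toTopCat X).obj U.unop))).shape q q' h)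
  d_comp_d' q q' q'' _ _ := NatTrans.ext (funext fun U =>
    ((singularCochains R).obj (op ((Opens.toTopCat X).obj U.unop))).d_comp_d q q' q'')

/-- The sheaf associated to a presheaf. -/
def sheafification (X : TopCat.{0}) : TopCat.Presheaf (ModuleCat.{0} R) X ⥤ Sh R X :=
  presheafToSheaf (Opens.grothendieckTopology X) (ModuleCat.{0} R)

instance (X : TopCat.{0}) : (sheafification R X).Additive :=
  inferInstanceAs (presheafToSheaf (Opens.grothendieckTopology X) (ModuleCat.{0} R)).Additive

/-- The canonical morphism from a presheaf to the associated sheaf. -/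
def sheafificationUnit {X : TopCat.{0}} (P : TopCat.Presheaf (ModuleCat.{0} R) X) :
    P ⟶ ((sheafification R X).obj P).presheaf :=
  toSheafify (Opens.grothendieckTopology X) P

lemma sheafificationUnit_naturality {X : TopCat.{0}} {P Q : TopCat.Presheaf (ModuleCat.{0} R) X}
    (f : P ⟶ Q) :
    f ≫ sheafificationUnit R Q = sheafificationUnit R P ≫ ((sheafification R X).map f).hom :=
  toSheafify_naturality (Opens.grothendieckTopology X) f

/-- The complex of sheaves of singular cochains on `X`. -/
def cochainSheaf (X : TopCat.{0}) : CochainComplex (Sh R X) ℕ :=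
  ((sheafification R X).mapHomologicalComplex (ComplexShape.up ℕ)).obj (cochainPresheaf R X)

/-- The canonical map from singular cochains on `X` to global sections of the sheaves of cochains. -/
def singularToSections (X : TopCat.{0}) :
    (singularCochains R).obj (op X) ⟶ sectionComplex (cochainSheaf R X) where
  f q := ((singularCochains R).map (Opens.inclusion' (⊤ : Opens X)).op).f q ≫
    (sheafificationUnit R ((cochainPresheaf R X).X q)).app (op ⊤)
  comm' q q' _ := by
    have h1 := ((singularCochains R).map (Opens.inclusion' (⊤ : Opens X)).op).comm q q'
    have h2 := congrArg (fun t => t.app (op ⊤))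
      (sheafificationUnit_naturality R ((cochainPresheaf R X).d q q'))
    refine (Category.assoc _ _ _).trans ((congrArg _ h2.symm).trans ?_)
    refine (Category.assoc _ _ _).symm.trans ((congrArg (· ≫ _) h1).trans ?_)
    exact Category.assoc _ _ _

variable {R}

/-- The point of `Y` given by a singular `0`-simplex. -/
def simplexPoint {Y : TopCat.{0}} (σ : (TopCat.toSSet.obj Y).obj (op (SimplexCategory.mk 0))) : Y :=
  TopCat.toSSetObjEquiv Y _ σ (stdSimplex.vertex 0)

variable (R) in
/-- A locally constant function is a `0`-cochain. -/
def constantToCochainPresheaf (X : TopCat.{0}) :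
    (locallyConstantSheaf R X).presheaf ⟶ (cochainPresheaf R X).X 0 where
  app U := ModuleCat.ofHom
    { toFun := fun f σ => f.1 (simplexPoint (Y := (Opens.toTopCat X).obj U.unop) σ)
      map_add' := fun _ _ => rfl
      map_smul' := fun _ _ => rfl }
  naturality _ _ _ := rfl

lemma eval_face {R : Type} {Y : TopCat.{0}} {f : Y → R} (hf : IsLocallyConstant f)
    (τ : (TopCat.toSSet.obj Y).obj (op (SimplexCategory.mk 1))) (i j : Fin 2) :
    f (simplexPoint ((TopCat.toSSet.obj Y).map (SimplexCategory.δ i).op τ)) =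
      f (simplexPoint ((TopCat.toSSet.obj Y).map (SimplexCategory.δ j).op τ)) :=
  (hf.comp_continuous (TopCat.toSSetObjEquiv Y _ τ).continuous).apply_eq_of_preconnectedSpace
    (stdSimplex.map (SimplexCategory.δ i) (stdSimplex.vertex 0))
    (stdSimplex.map (SimplexCategory.δ j) (stdSimplex.vertex 0))

lemma constantToCochainPresheaf_d (X : TopCat.{0}) :
    constantToCochainPresheaf R X ≫ (cochainPresheaf R X).d 0 1 = 0 := by
  refine NatTrans.ext (funext fun U => ModuleCat.hom_ext (LinearMap.ext fun f => ?_))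
  have h : ((singularCochains R).obj (op ((Opens.toTopCat X).obj U.unop))).d 0 1 =
      AlgebraicTopology.AlternatingCofaceMapComplex.objD
        ((singularCosimplicial R).obj (op ((Opens.toTopCat X).obj U.unop))) 0 :=
    CochainComplex.of_d (fun q => ((singularCosimplicial R).obj
      (op ((Opens.toTopCat X).obj U.unop))).obj (SimplexCategory.mk q)) _ 0
  change (((singularCochains R).obj (op ((Opens.toTopCat X).obj U.unop))).d 0 1).hom _ = 0
  rw [h, AlgebraicTopology.AlternatingCofaceMapComplex.objD, Fin.sum_univ_two]
  simp only [Fin.val_zero, Fin.val_one, pow_zero, pow_one, one_smul, neg_smul]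
  refine funext fun τ => ?_
  have := eval_face (R := R) (Y := (Opens.toTopCat X).obj U.unop) f.2 τ 0 1
  exact (add_neg_eq_zero).2 this

variable (R) in
/-- The augmentation of the complex of sheaves of singular cochains by the constant sheaf. -/
def constantToCochainSheaf (X : TopCat.{0}) : locallyConstantSheaf R X ⟶ (cochainSheaf R X).X 0 :=
  ⟨constantToCochainPresheaf R X ≫ sheafificationUnit R ((cochainPresheaf R X).X 0)⟩

lemma constantToCochainSheaf_d (X : TopCat.{0}) :
    constantToCochainSheaf R X ≫ (cochainSheaf R X).d 0 1 = 0 := by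
  refine ObjectProperty.hom_ext _ ?_
  change (constantToCochainPresheaf R X ≫ sheafificationUnit R ((cochainPresheaf R X).X 0)) ≫
    ((sheafification R X).map ((cochainPresheaf R X).d 0 1)).hom = 0
  rw [Category.assoc, ← sheafificationUnit_naturality, ← Category.assoc,
    constantToCochainPresheaf_d, zero_comp]

end Singular

section DeRhamComplex

open scoped Manifold ContDiff Topology

variable (𝕜 : Type) [RCLike 𝕜] (E : Type) [NormedAddCommGroup E] [NormedSpace ℝ E]
  (M : Type) [TopologicalSpace M] [ChartedSpace E M]

/-- The condition of being a smooth `k`-form, for families of forms on the tangent spaces. -/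
def smoothForms (k : ℕ) :
    LocalSubmodule 𝕜 (X := TopCat.of M) (fun x : M => FormAt 𝕜 E k x) where
  carrier U :=
    { carrier := {α | IsSmoothForm (U := U) α}
      add_mem' := fun h h' => h.add h'
      zero_mem' := isSmoothForm_zero
      smul_mem' := fun c _ h => h.smul c }
  res {U V} hVU α hα := by
    intro e he y hy
    exact ((hα.contDiffAt he hy.1 (hVU hy.2)).congr_of_eventuallyEq
      (chartRep_eventuallyEq_of_le hVU e α hy.1 hy.2)).contDiffWithinAt
  locality {U} α w := by
    intro e he y hy
    obtain ⟨V, hVU, hyV, hα⟩ := w ⟨e.symm y, hy.2⟩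
    have hα' : IsSmoothForm (U := V) fun x : V => α ⟨x, hVU x.2⟩ := hα
    exact ((hα'.contDiffAt he hy.1 hyV).congr_of_eventuallyEq
      (chartRep_eventuallyEq_of_le hVU e α hy.1 hyV).symm).contDiffWithinAt

/-- The sheaf of smooth `𝕜`-valued `k`-forms on `M`. -/
abbrev formSheaf (k : ℕ) : Sh 𝕜 (TopCat.of M) := (smoothForms 𝕜 E M k).sheaf

/-- A function, viewed as a `0`-form. -/
def constantForm {U : Opens M} (f : U → 𝕜) (x : U) : FormAt 𝕜 E 0 (x : M) :=
  ContinuousAlternatingMap.constOfIsEmpty ℝ (TangentSpace 𝓘(ℝ, E) (x : M)) (Fin 0) (f x)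

variable {𝕜 E M}

lemma chartRep_constantForm {U : Opens M} {f : U → 𝕜} (hf : IsLocallyConstant f)
    (e : OpenPartialHomeomorph M E) {y : E} (hy : y ∈ e.target) (hyU : e.symm y ∈ U) :
    chartRep e (constantForm 𝕜 E M f) =ᶠ[𝓝 y] fun _ =>
      ContinuousAlternatingMap.constOfIsEmpty ℝ E (Fin 0) (f ⟨e.symm y, hyU⟩) := by
  obtain ⟨W, hW, hyW, hWf⟩ := (IsLocallyConstant.iff_exists_open f).1 hf ⟨e.symm y, hyU⟩
  have hmem : ∀ᶠ z in 𝓝 y, e.symm z ∈ Subtype.val '' W :=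
    (e.symm.continuousAt hy).eventually
      ((U.2.isOpenMap_subtype_val W hW).mem_nhds ⟨_, hyW, rfl⟩)
  filter_upwards [hmem] with z hz
  obtain ⟨w, hw, hwz⟩ := hz
  have hzU : e.symm z ∈ U := hwz ▸ w.2
  have hfz : f ⟨e.symm z, hzU⟩ = f ⟨e.symm y, hyU⟩ := by
    rw [← hWf w hw]
    exact congrArg f (Subtype.ext hwz.symm)
  ext v
  rw [chartRep, extendForm_of_mem _ hzU]
  exact hfz

lemma isSmoothForm_constantForm {U : Opens M} {f : U → 𝕜} (hf : IsLocallyConstant f) :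
    IsSmoothForm (constantForm 𝕜 E M f) := fun e _ _ hy =>
  (contDiffAt_const.congr_of_eventuallyEq
    (chartRep_constantForm hf e hy.1 hy.2)).contDiffWithinAt

lemma extDerivForm_constantForm {U : Opens M} {f : U → 𝕜} (hf : IsLocallyConstant f) :
    extDerivForm (constantForm 𝕜 E M f) = 0 := by
  funext x
  have hx := mem_chart_source E (x : M)
  have hU : (chartAt E (x : M)).symm (chartAt E (x : M) x) ∈ U := by
    rw [(chartAt E (x : M)).left_inv hx]; exact x.2
  have h0 : extDeriv (chartRep (chartAt E (x : M)) (constantForm 𝕜 E M f))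
      (chartAt E (x : M) x) = 0 := by
    rw [(chartRep_constantForm hf _ ((chartAt E (x : M)).map_source hx) hU).extDeriv_eq, extDeriv,
      fderiv_const_apply]
    exact map_zero (ContinuousAlternatingMap.alternatizeUncurryFinCLM ℝ E 𝕜)
  rw [extDerivForm, h0]
  rfl

variable (𝕜 E M)

/-- A locally constant function is a smooth `0`-form: the augmentation of the de Rham complex. -/
def constantToForms : locallyConstantSheaf 𝕜 (TopCat.of M) ⟶ formSheaf 𝕜 E M 0 :=
  ⟨{ app := fun U => ModuleCat.ofHom
      { toFun := fun f => ⟨constantForm 𝕜 E M (U := U.unop) f.1, isSmoothForm_constantForm f.2⟩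
        map_add' := fun _ _ => rfl
        map_smul' := fun _ _ => rfl }
     naturality := fun _ _ _ => rfl }⟩

variable [IsManifold 𝓘(ℝ, E) ∞ M]

/-- The exterior derivative as a morphism of sheaves. -/
def formD (k : ℕ) : formSheaf 𝕜 E M k ⟶ formSheaf 𝕜 E M (k + 1) :=
  ⟨{ app := fun U => ModuleCat.ofHom
      { toFun := fun α => ⟨extDerivForm (U := U.unop) α.1, IsSmoothForm.extDerivForm α.2⟩
        map_add' := fun α β => Subtype.ext (extDerivForm_add α.2 β.2)
        map_smul' := fun c α => Subtype.ext (extDerivForm_smul c α.2) }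
     naturality := fun _ _ i => ModuleCat.hom_ext (LinearMap.ext fun α =>
       Subtype.ext (extDerivForm_restrict i.unop.le α.1)) }⟩

/-- The de Rham complex of sheaves of smooth `𝕜`-valued forms. -/
def deRhamSheaf : CochainComplex (Sh 𝕜 (TopCat.of M)) ℕ :=
  CochainComplex.of (formSheaf 𝕜 E M) (formD 𝕜 E M) fun _ =>
    sheaf_hom_ext fun _ α => Subtype.ext (extDerivForm_extDerivForm α.2)

lemma constantToForms_d :
    constantToForms 𝕜 E M ≫ (deRhamSheaf 𝕜 E M).d 0 1 = 0 := by
  have h : (deRhamSheaf 𝕜 E M).d 0 1 = formD 𝕜 E M 0 :=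
    CochainComplex.of_d (formSheaf 𝕜 E M) (formD 𝕜 E M) 0
  rw [h]
  exact sheaf_hom_ext fun _ f => Subtype.ext (extDerivForm_constantForm f.2)

/-- De Rham cohomology: the cohomology of the complex of smooth forms on all of `M`. -/
abbrev deRhamCohomology (k : ℕ) : ModuleCat.{0} 𝕜 :=
  (sectionComplex (deRhamSheaf 𝕜 E M)).homology k

end DeRhamComplex

section Comparison

open scoped Manifold ContDiff

variable (𝕜 : Type) [RCLike 𝕜] (E : Type) [NormedAddCommGroup E] [NormedSpace ℝ E]
  (M : Type) [TopologicalSpace M] [ChartedSpace E M] [IsManifold 𝓘(ℝ, E) ∞ M] (k : ℕ)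

/-- The canonical map from de Rham cohomology to the hypercohomology of the de Rham complex of sheaves. -/
def deRhamToHyper : deRhamCohomology 𝕜 E M k ⟶ hypercohomology (deRhamSheaf 𝕜 E M) k :=
  HomologicalComplex.homologyMap (sectionsToHyper (deRhamSheaf 𝕜 E M)) k

/-- The canonical map from the cohomology of the constant sheaf to the hypercohomology of the de Rham
complex of sheaves, induced by the inclusion of locally constant functions into `0`-forms. -/
def sheafToDeRhamHyper : sheafCohomology (locallyConstantSheaf 𝕜 (TopCat.of M)) k ⟶
    hypercohomology (deRhamSheaf 𝕜 E M) k :=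
  HomologicalComplex.homologyMap
    (sheafToHyper (constantToForms 𝕜 E M) (constantToForms_d 𝕜 E M)) k

end Comparison

section SingularComparison

variable (R : Type) [CommRing R] (X : TopCat.{0}) (k : ℕ)

/-- The canonical map from singular cohomology to the hypercohomology of the complex of sheaves of
singular cochains. -/
def singularToHyper : singularCohomology R X k ⟶ hypercohomology (cochainSheaf R X) k :=
  HomologicalComplex.homologyMap
    (singularToSections R X ≫ sectionsToHyper (cochainSheaf R X)) k

/-- The canonical map from the cohomology of the constant sheaf to the hypercohomology of the complex of
sheaves of singular cochains, induced by viewing locally constant functions as `0`-cochains. -/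
def sheafToSingularHyper : sheafCohomology (locallyConstantSheaf R X) k ⟶
    hypercohomology (cochainSheaf R X) k :=
  HomologicalComplex.homologyMap
    (sheafToHyper (constantToCochainSheaf R X) (constantToCochainSheaf_d X)) k

end SingularComparison

end DeRham

end

open CategoryTheory DeRham
open scoped ContDiff

/-!
All four comparison maps come from one statement about a double complex: if its columns (or its
rows) are exact except at the edge, the inclusion of the edge into the total complex is a
quasi-isomorphism. It is proved by solving for the components of a cocycle of the total complex one
after the other (`TotalCoordinates`), and it is applied to the double complex `𝒞^p ℒ^q (M)`, where
`ℒ` is the de Rham complex of sheaves or the complex of sheaves of singular cochains.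

* `sheafToDeRhamHyper` and `sheafToSingularHyper`: the functors `𝒞^p` of global Godement sections
  are exact, so the map from `𝒞^• 𝕜 (M)` is an edge of a double complex with exact columns as soon
  as `ℒ` is a resolution of the constant sheaf (`isIso_sheafToHyper`). For forms this is the
  Poincaré lemma, with the radial primitive (`exists_extDeriv_eq`, `locExact_formD`); for cochains
  it holds because every simplex in a ball of a chart can be coned off to the centre of the ball,
  and sheafification preserves local exactness.

* `deRhamToHyper` and half of `singularToHyper`: the map from `ℒ^• (M)` is an edge of a double
  complex with exact rows as soon as every `ℒ^q` has vanishing higher cohomology, which holds for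
  fine sheaves (`isIso_sectionsToHyper`). Forms can be multiplied by the functions of a smooth
  partition of unity. Cochains are cut up according to the first vertex of a simplex: with a
  partition of the space into arbitrary sets subordinate to a covering, restriction of a cochain to
  the simplices whose first vertex lies in one of the sets defines a partition of the identity.

* The other half of `singularToHyper`: singular cochains map onto the global sections of their
  sheafification, as paracompactness allows one to choose local representatives coherently
  (`globalCochain_surjective`). The kernel consists of the cochains which vanish on the simplices
  contained in a small enough neighbourhood of each point. It is acyclic
  (`LocallyZero.exists_coboundary_eq`): let `sd` and `T` be the transposes of barycentric
  subdivision and of the chain homotopy between it and the identity. If `g` is closed and vanishes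
  locally, iterated subdivision makes `sd^i g` vanish on any given simplex for large `i`, so `∑ T
  (sd^i g)` is a finite sum on each simplex, and it is a primitive of `g` which again vanishes
  locally.
-/

noncomputable section

namespace DeRham

open CategoryTheory TopologicalSpace Opposite Limits

/-! ### Quasi-isomorphisms and total complexes -/

section HomologyElements

variable {R : Type} [CommRing R]

/-- An element of a cochain complex is a coboundary. The source degree is left free, since all
differentials between degrees that are not consecutive vanish; in degree `0` only `0` is one. -/
def IsCobd (A : CochainComplex (ModuleCat.{0} R) ℕ) {k : ℕ} (a : A.X k) : Prop :=
  ∃ (j : ℕ) (c : A.X j), (A.d j k).hom c = a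

lemma isCobd_zero (A : CochainComplex (ModuleCat.{0} R) ℕ) {k : ℕ} : IsCobd A (0 : A.X k) :=
  ⟨k, 0, map_zero _⟩

lemma isCobd_iff (A : CochainComplex (ModuleCat.{0} R) ℕ) {k : ℕ} (a : A.X k) :
    IsCobd A a ↔ a ∈ LinearMap.range (A.sc k).f.hom := by
  constructor
  · rintro ⟨j, c, rfl⟩
    by_cases h : (ComplexShape.up ℕ).Rel j k
    · obtain rfl := (ComplexShape.up ℕ).prev_eq' h
      exact ⟨c, rfl⟩
    · rw [A.shape j k h]
      exact Submodule.zero_mem _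
  · rintro ⟨c, rfl⟩
    exact ⟨_, c, rfl⟩

lemma isCobd_succ_iff (A : CochainComplex (ModuleCat.{0} R) ℕ) {k : ℕ} (a : A.X (k + 1)) :
    IsCobd A a ↔ ∃ c : A.X k, (A.d k (k + 1)).hom c = a := by
  constructor
  · rintro ⟨j, c, rfl⟩
    by_cases h : j = k
    · subst h; exact ⟨c, rfl⟩
    · exact ⟨0, by rw [A.shape j (k + 1) (fun h' => h (Nat.succ_injective h'))]; simp⟩
  · rintro ⟨c, rfl⟩
    exact ⟨k, c, rfl⟩

lemma isCobd_zero_iff (A : CochainComplex (ModuleCat.{0} R) ℕ) (a : A.X 0) :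
    IsCobd A a ↔ a = 0 := by
  constructor
  · rintro ⟨j, c, rfl⟩
    rw [A.shape j 0 (fun h => by simp at h)]
    rfl
  · rintro rfl; exact isCobd_zero A

lemma IsCobd.map {A B : CochainComplex (ModuleCat.{0} R) ℕ} (f : A ⟶ B) {k : ℕ} {a : A.X k}
    (h : IsCobd A a) : IsCobd B ((f.f k).hom a) := by
  obtain ⟨j, c, rfl⟩ := h
  exact ⟨j, (f.f j).hom c, congrArg (fun t => t.hom c) (f.comm j k)⟩

lemma d_d_apply (A : CochainComplex (ModuleCat.{0} R) ℕ) {i j k : ℕ} (a : A.X i) :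
    (A.d j k).hom ((A.d i j).hom a) = 0 :=
  congrArg (fun t => t.hom a) (A.d_comp_d i j k)

lemma d_f_apply {A B : CochainComplex (ModuleCat.{0} R) ℕ} (f : A ⟶ B) {j k : ℕ} (a : A.X j) :
    (B.d j k).hom ((f.f j).hom a) = (f.f k).hom ((A.d j k).hom a) :=
  congrArg (fun t => t.hom a) (f.comm j k)

lemma homologyπ_eq_zero_iff (A : CochainComplex (ModuleCat.{0} R) ℕ) {k : ℕ} (c : A.cycles k) :
    (A.homologyπ k).hom c = 0 ↔ IsCobd A ((A.iCycles k).hom c) := by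
  refine Iff.trans ?_ (((A.sc k).moduleCat_pOpcycles_eq_zero_iff ((A.iCycles k).hom c)).trans
    (isCobd_iff A _).symm)
  have h : (A.sc k).pOpcycles ((A.iCycles k).hom c) =
      (A.homologyι k).hom ((A.homologyπ k).hom c) :=
    (congrArg (fun t => t.hom c) (A.homology_π_ι k)).symm
  have hinj : Function.Injective (A.homologyι k).hom :=
    (ModuleCat.mono_iff_injective _).1 inferInstance
  rw [h]
  exact ⟨fun h0 => by rw [h0]; exact map_zero _, fun h0 => hinj (h0.trans (map_zero _).symm)⟩

lemma exists_cycle (A : CochainComplex (ModuleCat.{0} R) ℕ) {k : ℕ} (a : A.X k)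
    (ha : (A.d k (k + 1)).hom a = 0) : ∃ c : A.cycles k, (A.iCycles k).hom c = a := by
  have hg : (A.sc k).g.hom a = 0 := by
    have : (ComplexShape.up ℕ).next k = k + 1 := CochainComplex.next ℕ k
    change (A.d k ((ComplexShape.up ℕ).next k)).hom a = 0
    rw [this]; exact ha
  refine ⟨(A.sc k).moduleCatCyclesIso.inv.hom ⟨a, hg⟩, ?_⟩
  exact congrArg (fun t => t.hom (⟨a, hg⟩ : LinearMap.ker (A.sc k).g.hom))
    (A.sc k).moduleCatCyclesIso_inv_iCycles

/-- The elementwise criterion for a morphism of complexes of modules to induce an isomorphism on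
cohomology: cocycles lift up to coboundaries, and cocycles that become coboundaries are ones. -/
theorem isIso_homologyMap {A B : CochainComplex (ModuleCat.{0} R) ℕ} (f : A ⟶ B) (k : ℕ)
    (hinj : ∀ a : A.X k, (A.d k (k + 1)).hom a = 0 → IsCobd B ((f.f k).hom a) → IsCobd A a)
    (hsurj : ∀ b : B.X k, (B.d k (k + 1)).hom b = 0 →
      ∃ a : A.X k, (A.d k (k + 1)).hom a = 0 ∧ IsCobd B ((f.f k).hom a - b)) :
    IsIso (HomologicalComplex.homologyMap f k) := by
  have hA : Function.Surjective (A.homologyπ k).hom :=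
    (ModuleCat.epi_iff_surjective _).1 inferInstance
  have hB : Function.Surjective (B.homologyπ k).hom :=
    (ModuleCat.epi_iff_surjective _).1 inferInstance
  have hπ : ∀ c : A.cycles k, (HomologicalComplex.homologyMap f k).hom ((A.homologyπ k).hom c) =
      (B.homologyπ k).hom ((HomologicalComplex.cyclesMap f k).hom c) := fun c =>
    congrArg (fun t => t.hom c) (HomologicalComplex.homologyπ_naturality f k)
  have hi : ∀ c : A.cycles k, (B.iCycles k).hom ((HomologicalComplex.cyclesMap f k).hom c) =
      (f.f k).hom ((A.iCycles k).hom c) := fun c =>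
    congrArg (fun t => t.hom c) (HomologicalComplex.cyclesMap_i f k)
  have hd : ∀ (K : CochainComplex (ModuleCat.{0} R) ℕ) (c : K.cycles k),
      (K.d k (k + 1)).hom ((K.iCycles k).hom c) = 0 := fun K c =>
    congrArg (fun t => t.hom c) (K.iCycles_d k (k + 1))
  refine (ConcreteCategory.isIso_iff_bijective _).2 ⟨?_, ?_⟩
  · refine (injective_iff_map_eq_zero (HomologicalComplex.homologyMap f k).hom).2 fun x hx => ?_
    obtain ⟨c, rfl⟩ := hA x
    rw [hπ, homologyπ_eq_zero_iff, hi] at hx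
    rw [homologyπ_eq_zero_iff]
    exact hinj _ (hd A c) hx
  · intro y
    obtain ⟨b, rfl⟩ := hB y
    obtain ⟨a, ha, hab⟩ := hsurj _ (hd B b)
    obtain ⟨c, rfl⟩ := exists_cycle A a ha
    refine ⟨(A.homologyπ k).hom c, ?_⟩
    refine (hπ c).trans (sub_eq_zero.1 ?_)
    rw [← map_sub, homologyπ_eq_zero_iff, map_sub, hi]
    exact hab

/-- A surjective morphism of complexes with acyclic kernel induces isomorphisms on cohomology. -/
theorem isIso_homologyMap_of_surjective {A B : CochainComplex (ModuleCat.{0} R) ℕ} (f : A ⟶ B)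
    (hf : ∀ q, Function.Surjective (f.f q).hom)
    (hker : ∀ q (a : A.X q), (A.d q (q + 1)).hom a = 0 → (f.f q).hom a = 0 →
      ∃ (j : ℕ) (c : A.X j), (f.f j).hom c = 0 ∧ (A.d j q).hom c = a) (k : ℕ) :
    IsIso (HomologicalComplex.homologyMap f k) := by
  refine isIso_homologyMap f k (fun a ha hfa => ?_) fun b hb => ?_
  · obtain ⟨j, c, hc⟩ := hfa
    obtain ⟨e, rfl⟩ := hf j c
    obtain ⟨j', c', -, hc'⟩ := hker k (a - (A.d j k).hom e)
      (by rw [map_sub, ha, d_d_apply, sub_zero])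
      (by rw [map_sub, ← d_f_apply, hc, sub_self])
    -- At most one degree has a nonzero differential into degree `k`.
    by_cases hj : j = j'
    · subst hj
      exact ⟨j, c' + e, by rw [map_add, hc', sub_add_cancel]⟩
    · by_cases h : (ComplexShape.up ℕ).Rel j k
      · rw [A.shape j' k fun h' => hj (Nat.succ_injective (h.trans h'.symm))] at hc'
        exact ⟨j, e, (sub_eq_zero.1 hc'.symm).symm⟩
      · rw [A.shape j k h] at hc'
        exact ⟨j', c', hc'.trans (sub_zero a)⟩
  · obtain ⟨a, rfl⟩ := hf k b
    obtain ⟨j, c, hc, hca⟩ := hker (k + 1) ((A.d k (k + 1)).hom a) (d_d_apply _ _)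
      (by rw [← d_f_apply, hb])
    by_cases hj : j = k
    · subst hj
      refine ⟨a - c, by rw [map_sub, hca, sub_self], ?_⟩
      rw [map_sub, hc, sub_zero, sub_self]
      exact isCobd_zero B
    · rw [A.shape j (k + 1) fun h' => hj (Nat.succ_injective h')] at hca
      refine ⟨a, hca.symm, ?_⟩
      rw [sub_self]
      exact isCobd_zero B

end HomologyElements

section TotalComplex

variable {R : Type} [CommRing R]

/-- Coordinates on a complex `T` which exhibit it as the total complex of a first quadrant double
complex with terms `D p q`. Only the consequences of such a presentation used to compare edges are
recorded, in a form that is symmetric in the two directions; the signs are part of `d₁` and `d₂`. -/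
structure TotalCoordinates (T : CochainComplex (ModuleCat.{0} R) ℕ) (D : ℕ → ℕ → ModuleCat.{0} R)
    where
  ι : ∀ p q n, p + q = n → D p q →ₗ[R] T.X n
  π : ∀ p q n, p + q = n → T.X n →ₗ[R] D p q
  d₁ : ∀ p q, D p q →ₗ[R] D (p + 1) q
  d₂ : ∀ p q, D p q →ₗ[R] D p (q + 1)
  π_ι : ∀ p q n h x, π p q n h (ι p q n h x) = x
  π_ι_ne : ∀ p q p' q' n h h' x, p ≠ p' → π p' q' n h' (ι p q n h x) = 0
  ext : ∀ n (t : T.X n), (∀ p q h, π p q n h t = 0) → t = 0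
  d_ι : ∀ p q n h x, (T.d n (n + 1)).hom (ι p q n h x) =
    ι (p + 1) q (n + 1) (by omega) (d₁ p q x) + ι p (q + 1) (n + 1) (by omega) (d₂ p q x)
  π_d₁ : ∀ p q n h (t : T.X n), (∀ q' h', q' + 1 = q → π (p + 1) q' n h' t = 0) →
    π (p + 1) q (n + 1) (by omega) ((T.d n (n + 1)).hom t) = d₁ p q (π p q n h t)
  π_d₂ : ∀ p q n h (t : T.X n), (∀ p' h', p' + 1 = p → π p' (q + 1) n h' t = 0) →
    π p (q + 1) (n + 1) (by omega) ((T.d n (n + 1)).hom t) = d₂ p q (π p q n h t)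

namespace TotalCoordinates

variable {T : CochainComplex (ModuleCat.{0} R) ℕ} {D : ℕ → ℕ → ModuleCat.{0} R}

/-- Exchange the two directions. -/
def swap (S : TotalCoordinates T D) : TotalCoordinates T (fun p q => D q p) where
  ι p q n h := S.ι q p n (by omega)
  π p q n h := S.π q p n (by omega)
  d₁ p q := S.d₂ q p
  d₂ p q := S.d₁ q p
  π_ι p q n h x := S.π_ι q p n _ x
  π_ι_ne p q p' q' n h h' x hne := S.π_ι_ne q p q' p' n _ _ x (by omega)
  ext n t ht := S.ext n t fun p q h => ht q p (by omega)
  d_ι p q n h x := (S.d_ι q p n (by omega) x).trans (add_comm _ _)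
  π_d₁ p q n h t ht := S.π_d₂ q p n (by omega) t fun p' h' => ht p' (by omega)
  π_d₂ p q n h t ht := S.π_d₁ q p n (by omega) t fun p' h' => ht p' (by omega)

/-- An element is concentrated in the row `q = 0`. -/
def IsRow (S : TotalCoordinates T D) {n : ℕ} (t : T.X n) : Prop :=
  ∀ p q h, S.π p (q + 1) n h t = 0

lemma IsRow.eq_ι {S : TotalCoordinates T D} {n : ℕ} {t : T.X n} (h : S.IsRow t) :
    t = S.ι n 0 n (add_zero n) (S.π n 0 n (add_zero n) t) := by
  refine sub_eq_zero.1 (S.ext n _ fun p q hpq => ?_)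
  rw [map_sub]
  rcases q with _ | q
  · obtain rfl : p = n := hpq
    rw [S.π_ι, sub_self]
  · rw [h p q hpq, S.π_ι_ne _ _ _ _ _ _ _ _ (by omega), sub_zero]

lemma isRow_ι (S : TotalCoordinates T D) {n : ℕ} (x : D n 0) :
    S.IsRow (S.ι n 0 n (add_zero n) x) := fun p q h => S.π_ι_ne _ _ _ _ _ _ _ _ (by omega)

/-- If the columns are exact in positive degrees, an element whose differential lies in the row
`q = 0` can be moved into that row by a coboundary: its component with the largest `q` is a vertical
cocycle, and gets removed by the total differential of a vertical primitive. -/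
lemma exists_isRow (S : TotalCoordinates T D)
    (hex : ∀ p q (x : D p (q + 1)), S.d₂ p (q + 1) x = 0 → ∃ y, S.d₂ p q y = x) {n : ℕ}
    (t : T.X n) (hdt : S.IsRow ((T.d n (n + 1)).hom t)) :
    ∃ t' : T.X n, S.IsRow t' ∧ IsCobd T (t' - t) := by
  suffices H : ∀ m (t : T.X n), S.IsRow ((T.d n (n + 1)).hom t) →
      (∀ p q h, m ≤ q → S.π p (q + 1) n h t = 0) →
      ∃ t' : T.X n, S.IsRow t' ∧ IsCobd T (t' - t) from
    H n t hdt fun p q h hq => by omega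
  intro m
  induction m with
  | zero => exact fun t _ ht => ⟨t, fun p q h => ht p q h (Nat.zero_le _), by
      rw [sub_self]; exact isCobd_zero T⟩
  | succ m ih =>
    intro t hdt ht
    by_cases hm : m + 1 ≤ n
    · obtain ⟨N, rfl⟩ : ∃ N, n = N + 1 := ⟨n - 1, by omega⟩
      obtain ⟨p, hp⟩ : ∃ p, p + m = N := ⟨N - m, by omega⟩
      have hx : S.d₂ p (m + 1) (S.π p (m + 1) _ (by omega) t) = 0 := by
        rw [← S.π_d₂ p (m + 1) _ (by omega) t fun p' h' _ => ht p' (m + 1) h' le_rfl]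
        exact hdt p (m + 1) _
      obtain ⟨y, hy⟩ := hex p m _ hx
      have hz := S.d_ι p m N hp y
      set z : T.X (N + 1) := (T.d N (N + 1)).hom (S.ι p m N hp y) with hzdef
      obtain ⟨t', ht', j, c, hc⟩ := ih (t - z)
        (by rw [map_sub, hzdef]
            rw [d_d_apply, sub_zero]
            exact hdt)
        (fun p' q' h' hq' => by
          rw [map_sub, hz, map_add]
          rcases Nat.eq_or_lt_of_le hq' with rfl | hlt
          · obtain rfl : p' = p := by omega
            rw [S.π_ι_ne _ _ _ _ _ _ _ _ (by omega), zero_add, S.π_ι, hy, sub_self]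
          · rw [ht p' q' h' hlt, S.π_ι_ne _ _ _ _ _ _ _ _ (by omega),
              S.π_ι_ne _ _ _ _ _ _ _ _ (by omega)]
            simp)
      refine ⟨t', ht', (isCobd_succ_iff T _).2 ?_⟩
      obtain ⟨c', hc'⟩ := (isCobd_succ_iff T _).1 ⟨j, c, hc⟩
      refine ⟨c' - S.ι p m N hp y, ?_⟩
      rw [map_sub, hc', hzdef]
      abel
    · exact ih t hdt fun p q h hq => by omega

/-- A morphism to the row `q = 0` which augments exact columns is a quasi-isomorphism to the total
complex. -/
theorem isIso_of_exact_columns (S : TotalCoordinates T D)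
    (hex : ∀ p q (x : D p (q + 1)), S.d₂ p (q + 1) x = 0 → ∃ y, S.d₂ p q y = x)
    {A : CochainComplex (ModuleCat.{0} R) ℕ} (F : A ⟶ T) (f : ∀ p, A.X p →ₗ[R] D p 0)
    (hF : ∀ p (a : A.X p), (F.f p).hom a = S.ι p 0 p (add_zero p) (f p a))
    (hinj : ∀ p, Function.Injective (f p))
    (hrange : ∀ p x, S.d₂ p 0 x = 0 → ∃ a, f p a = x) (k : ℕ) :
    IsIso (HomologicalComplex.homologyMap F k) := by
  have hFinj : ∀ p, Function.Injective (F.f p).hom := fun p a b hab => by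
    rw [hF, hF] at hab
    have := congrArg (S.π p 0 p (add_zero p)) hab
    rw [S.π_ι, S.π_ι] at this
    exact hinj p this
  -- A row element with vertical differential zero comes from the augmentation.
  have hlift : ∀ p (t : T.X p), S.IsRow t → S.IsRow ((T.d p (p + 1)).hom t) →
      ∃ a, (F.f p).hom a = t := fun p t ht hdt => by
    obtain ⟨a, ha⟩ := hrange p (S.π p 0 p (add_zero p) t) (by
      rw [← S.π_d₂ p 0 p (add_zero p) t fun p' h' _ => ht p' 0 h']
      exact hdt p 0 _)
    exact ⟨a, by rw [hF, ha]; exact ht.eq_ι.symm⟩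
  refine isIso_homologyMap F k (fun a ha hfa => ?_) fun b hb => ?_
  · rcases k with _ | k
    · rw [isCobd_zero_iff] at hfa ⊢
      exact hFinj 0 (hfa.trans (map_zero _).symm)
    · obtain ⟨c, hc⟩ := (isCobd_succ_iff T _).1 hfa
      have hrow : S.IsRow ((T.d k (k + 1)).hom c) := by
        rw [hc, hF]; exact S.isRow_ι _
      obtain ⟨c', hc', j, e, he⟩ := S.exists_isRow hex c hrow
      have hd : (T.d k (k + 1)).hom c' = (T.d k (k + 1)).hom c := by
        rw [← sub_eq_zero, ← map_sub, ← he, d_d_apply]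
      obtain ⟨b, rfl⟩ := hlift k c' hc' (hd ▸ hrow)
      refine (isCobd_succ_iff A _).2 ⟨b, hFinj _ ?_⟩
      rw [← d_f_apply, hd, hc]
  · obtain ⟨b', hb', hbb⟩ := S.exists_isRow hex b (by
      rw [hb]; exact fun p q h => map_zero _)
    have hdb : (T.d k (k + 1)).hom b' = 0 := by
      obtain ⟨j, e, he⟩ := hbb
      refine Eq.trans ?_ (d_d_apply T (j := k) e)
      rw [he, map_sub, hb, sub_zero]
    obtain ⟨a, rfl⟩ := hlift k b' hb' (by rw [hdb]; exact fun p q h => map_zero _)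
    refine ⟨a, hFinj _ ?_, hbb⟩
    rw [← d_f_apply, hdb, map_zero]

end TotalCoordinates

/-- The projection of the total complex to a term of the double complex. -/
def totalProj (K : HomologicalComplex₂ (ModuleCat.{0} R) (ComplexShape.up ℕ) (ComplexShape.up ℕ))
    (p q n : ℕ) : (K.total (ComplexShape.up ℕ)).X n ⟶ (K.X p).X q :=
  K.totalDesc fun i j _ =>
    if h : i = p ∧ j = q then eqToHom (by rw [h.1, h.2]) else 0

section

variable (K : HomologicalComplex₂ (ModuleCat.{0} R) (ComplexShape.up ℕ) (ComplexShape.up ℕ))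

lemma ιTotal_totalProj (p q n : ℕ) (h : p + q = n) :
    K.ιTotal (ComplexShape.up ℕ) p q n h ≫ totalProj K p q n = 𝟙 _ := by
  rw [totalProj, HomologicalComplex₂.ι_totalDesc, dif_pos ⟨rfl, rfl⟩, eqToHom_refl]

lemma ιTotal_totalProj_of_ne (p q p' q' n : ℕ) (h : p + q = n) (hne : p ≠ p') :
    K.ιTotal (ComplexShape.up ℕ) p q n h ≫ totalProj K p' q' n = 0 := by
  rw [totalProj, HomologicalComplex₂.ι_totalDesc, dif_neg fun h' => hne h'.1]

lemma sum_totalProj_ιTotal (n : ℕ) :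
    ∑ x : Finset.HasAntidiagonal.antidiagonal n, totalProj K x.1.1 x.1.2 n ≫
       K.ιTotal (ComplexShape.up ℕ) x.1.1 x.1.2 n
        (Finset.HasAntidiagonal.mem_antidiagonal.1 x.2) = 𝟙 _ := by
  refine HomologicalComplex₂.total.hom_ext _ fun p q h => ?_
  rw [Preadditive.comp_sum,
    Finset.sum_eq_single ⟨(p, q), Finset.HasAntidiagonal.mem_antidiagonal.2 h⟩]
  · rw [← Category.assoc, ιTotal_totalProj K p q n h, Category.id_comp, Category.comp_id]
  · rintro ⟨⟨p', q'⟩, hx⟩ - hne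
    have hx' := Finset.HasAntidiagonal.mem_antidiagonal.1 hx
    have h' : p + q = n := h
    have : p ≠ p' := fun hp => hne (Subtype.ext (Prod.ext hp.symm
      (show q' = q by change p' + q' = n at hx'; omega)))
    rw [← Category.assoc, ιTotal_totalProj_of_ne K p q p' q' n h this, zero_comp]
  · exact fun h' => absurd (Finset.mem_univ _) h'

lemma sum_ι_π_apply (n : ℕ) (t : (K.total (ComplexShape.up ℕ)).X n) :
    ∑ x : Finset.HasAntidiagonal.antidiagonal n,
      (K.ιTotal (ComplexShape.up ℕ) x.1.1 x.1.2 n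
        (Finset.HasAntidiagonal.mem_antidiagonal.1 x.2)).hom
          ((totalProj K x.1.1 x.1.2 n).hom t) = t := by
  have h := congrArg (fun f => f.hom t) (sum_totalProj_ιTotal K n)
  rw [ModuleCat.hom_sum, LinearMap.sum_apply] at h
  exact h

lemma proj_ι_apply (p q n : ℕ) (h : p + q = n) (x : (K.X p).X q) :
    (totalProj K p q n).hom ((K.ιTotal (ComplexShape.up ℕ) p q n h).hom x) = x :=
  congrArg (fun t => t.hom x) (ιTotal_totalProj K p q n h)

lemma proj_ι_apply_of_ne (p q p' q' n : ℕ) (h : p + q = n) (hne : p ≠ p') (x : (K.X p).X q) :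
    (totalProj K p' q' n).hom ((K.ιTotal (ComplexShape.up ℕ) p q n h).hom x) = 0 :=
  congrArg (fun t => t.hom x) (ιTotal_totalProj_of_ne K p q p' q' n h hne)

lemma d_ι_apply (p q n : ℕ) (h : p + q = n) (x : (K.X p).X q) :
    ((K.total (ComplexShape.up ℕ)).d n (n + 1)).hom
        ((K.ιTotal (ComplexShape.up ℕ) p q n h).hom x) =
      (K.ιTotal (ComplexShape.up ℕ) (p + 1) q (n + 1)
        (show p + 1 + q = n + 1 by omega)).hom (((K.d p (p + 1)).f q).hom x) +
      (K.ιTotal (ComplexShape.up ℕ) p (q + 1) (n + 1)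
        (show p + (q + 1) = n + 1 by omega)).hom
          ((((-1 : ℤˣ) ^ p) • (K.X p).d q (q + 1)).hom x) := by
  refine (congrArg (fun t => t.hom x) (ιTotal_d K p q n h)).trans ?_
  rw [← Linear.units_smul_comp]
  rfl

/-- The total complex of a double complex, with its standard coordinates. -/
def totalCoordinates :
    TotalCoordinates (K.total (ComplexShape.up ℕ)) (fun p q => (K.X p).X q) where
  ι p q n h := (K.ιTotal (ComplexShape.up ℕ) p q n h).hom
  π p q n _ := (totalProj K p q n).hom
  d₁ p q := ((K.d p (p + 1)).f q).hom
  d₂ p q := (((-1 : ℤˣ) ^ p) • (K.X p).d q (q + 1)).hom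
  π_ι p q n h x := proj_ι_apply K p q n h x
  π_ι_ne p q p' q' n h _ x hne := proj_ι_apply_of_ne K p q p' q' n h hne x
  ext n t ht := by
    rw [← sum_ι_π_apply K n t]
    refine Finset.sum_eq_zero fun x _ => ?_
    have h : (totalProj K x.1.1 x.1.2 n).hom t = 0 :=
      ht x.1.1 x.1.2 (Finset.HasAntidiagonal.mem_antidiagonal.1 x.2)
    rw [h, map_zero]
  d_ι p q n h x := d_ι_apply K p q n h x
  π_d₁ p q n h t ht := by
    change (totalProj K (p + 1) q (n + 1)).hom _ = _
    conv_lhs => rw [← sum_ι_π_apply K n t, map_sum, map_sum]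
    rw [Finset.sum_eq_single ⟨(p, q), Finset.HasAntidiagonal.mem_antidiagonal.2 h⟩]
    · rw [d_ι_apply, map_add, proj_ι_apply, proj_ι_apply_of_ne _ _ _ _ _ _ _ (by simp), add_zero]
    · rintro ⟨⟨p', q'⟩, hx⟩ - hne
      have hx' : p' + q' = n := Finset.HasAntidiagonal.mem_antidiagonal.1 hx
      rw [d_ι_apply, map_add]
      have hp : p' + 1 ≠ p + 1 := fun hp => hne (Subtype.ext (Prod.ext
        (show p' = p by omega) (show q' = q by omega)))
      rw [proj_ι_apply_of_ne _ _ _ _ _ _ _ hp, zero_add]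
      by_cases hp' : p' = p + 1
      · subst hp'
        have h0 : (totalProj K (p + 1) q' n).hom t = 0 := ht q' hx' (by omega)
        dsimp only
        rw [h0]
        simp
      · rw [proj_ι_apply_of_ne _ _ _ _ _ _ _ hp']
    · exact fun h' => absurd (Finset.mem_univ _) h'
  π_d₂ p q n h t ht := by
    change (totalProj K p (q + 1) (n + 1)).hom _ = _
    conv_lhs => rw [← sum_ι_π_apply K n t, map_sum, map_sum]
    rw [Finset.sum_eq_single ⟨(p, q), Finset.HasAntidiagonal.mem_antidiagonal.2 h⟩]
    · rw [d_ι_apply, map_add, proj_ι_apply, proj_ι_apply_of_ne _ _ _ _ _ _ _ (by simp), zero_add]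
    · rintro ⟨⟨p', q'⟩, hx⟩ - hne
      have hx' : p' + q' = n := Finset.HasAntidiagonal.mem_antidiagonal.1 hx
      rw [d_ι_apply, map_add]
      have hp : p' ≠ p := fun hp => hne (Subtype.ext (Prod.ext hp (show q' = q by omega)))
      rw [proj_ι_apply_of_ne _ _ _ _ _ _ _ hp, add_zero]
      by_cases hp' : p' + 1 = p
      · subst hp'
        obtain rfl : q' = q + 1 := by omega
        have h0 : (totalProj K p' (q + 1) n).hom t = 0 := ht p' hx' rfl
        dsimp only
        rw [h0]
        simp
      · rw [proj_ι_apply_of_ne _ _ _ _ _ _ _ hp']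
    · exact fun h' => absurd (Finset.mem_univ _) h'

end

section Edges

variable (K : HomologicalComplex₂ (ModuleCat.{0} R) (ComplexShape.up ℕ) (ComplexShape.up ℕ))
  (A : CochainComplex (ModuleCat.{0} R) ℕ)

/-- The edge morphism along the row `q = 0` is a quasi-isomorphism if all columns, augmented by `A`,
are exact. -/
theorem isIso_homologyMap_rowEdge (f : ∀ p, A.X p ⟶ (K.X p).X 0)
    (h0 : ∀ p, f p ≫ (K.X p).d 0 1 = 0)
    (h1 : ∀ p, f p ≫ (K.d p (p + 1)).f 0 = A.d p (p + 1) ≫ f (p + 1))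
    (hinj : ∀ p, Function.Injective (f p).hom)
    (hex₀ : ∀ p (x : (K.X p).X 0), ((K.X p).d 0 1).hom x = 0 → ∃ a, (f p).hom a = x)
    (hex : ∀ p q (x : (K.X p).X (q + 1)), ((K.X p).d (q + 1) (q + 1 + 1)).hom x = 0 →
      ∃ y, ((K.X p).d q (q + 1)).hom y = x) (k : ℕ) :
    IsIso (HomologicalComplex.homologyMap (rowEdge K A f h0 h1) k) := by
  have hd : ∀ p q (x : (K.X p).X q), (totalCoordinates K).d₂ p q x =
      ((-1 : ℤˣ) ^ p) • ((K.X p).d q (q + 1)).hom x := fun _ _ _ => rfl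
  refine (totalCoordinates K).isIso_of_exact_columns (fun p q x hx => ?_)
    (rowEdge K A f h0 h1) (fun p => (f p).hom) (fun _ _ => rfl) hinj (fun p x hx => ?_) k
  · rw [hd] at hx
    obtain ⟨y, hy⟩ := hex p q x ((smul_eq_zero_iff_eq _).1 hx)
    refine ⟨((-1 : ℤˣ) ^ p)⁻¹ • y, ?_⟩
    rw [hd, Units.smul_def ((-1 : ℤˣ) ^ p)⁻¹, map_zsmul, hy, ← Units.smul_def, smul_inv_smul]
  · rw [hd] at hx
    exact hex₀ p x ((smul_eq_zero_iff_eq _).1 hx)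

/-- The edge morphism along the column `p = 0` is a quasi-isomorphism if all rows, augmented by `A`,
are exact. -/
theorem isIso_homologyMap_columnEdge (f : ∀ q, A.X q ⟶ (K.X 0).X q)
    (h0 : ∀ q, f q ≫ (K.d 0 1).f q = 0)
    (h1 : ∀ q, f q ≫ (K.X 0).d q (q + 1) = A.d q (q + 1) ≫ f (q + 1))
    (hinj : ∀ q, Function.Injective (f q).hom)
    (hex₀ : ∀ q (x : (K.X 0).X q), ((K.d 0 1).f q).hom x = 0 → ∃ a, (f q).hom a = x)
    (hex : ∀ q p (x : (K.X (p + 1)).X q), ((K.d (p + 1) (p + 1 + 1)).f q).hom x = 0 →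
      ∃ y, ((K.d p (p + 1)).f q).hom y = x) (k : ℕ) :
    IsIso (HomologicalComplex.homologyMap (columnEdge K A f h0 h1) k) :=
  (totalCoordinates K).swap.isIso_of_exact_columns hex (columnEdge K A f h0 h1)
    (fun q => (f q).hom) (fun _ _ => rfl) hinj hex₀ k

end Edges

end TotalComplex

/-! ### Sections and the Godement construction -/

section Sections

variable {R : Type} [CommRing R] {X : TopCat.{0}}

/-- Sections of a presheaf over an open set. -/
abbrev Sec (P : TopCat.Presheaf (ModuleCat.{0} R) X) (U : Opens X) : Type := P.obj (op U)

/-- Restriction of sections. -/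
def res (P : TopCat.Presheaf (ModuleCat.{0} R) X) {U V : Opens X} (h : V ≤ U) :
    Sec P U →ₗ[R] Sec P V := (P.map (homOfLE h).op).hom

/-- A morphism of presheaves on sections. -/
def app {P Q : TopCat.Presheaf (ModuleCat.{0} R) X} (f : P ⟶ Q) (U : Opens X) :
    Sec P U →ₗ[R] Sec Q U := (f.app (op U)).hom

/-- The germ of a section at a point. -/
def germ (P : TopCat.Presheaf (ModuleCat.{0} R) X) {U : Opens X} (x : X) (hx : x ∈ U) :
    Sec P U →ₗ[R] P.stalk x := (P.germ U x hx).hom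

/-- The map induced by a morphism of presheaves on the stalks. -/
def stalkMap {P Q : TopCat.Presheaf (ModuleCat.{0} R) X} (f : P ⟶ Q) (x : X) :
    P.stalk x →ₗ[R] Q.stalk x := ((TopCat.Presheaf.stalkFunctor (ModuleCat.{0} R) x).map f).hom

section

variable {P Q S : TopCat.Presheaf (ModuleCat.{0} R) X}

lemma res_res {U V W : Opens X} (h : V ≤ U) (h' : W ≤ V) (s : Sec P U) :
    res P h' (res P h s) = res P (h'.trans h) s :=
  congrArg (fun t => t.hom s) (P.map_comp (homOfLE h).op (homOfLE h').op).symm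

lemma app_res (f : P ⟶ Q) {U V : Opens X} (h : V ≤ U) (s : Sec P U) :
    app f V (res P h s) = res Q h (app f U s) :=
  congrArg (fun t => t.hom s) (f.naturality (homOfLE h).op)

lemma app_comp (f : P ⟶ Q) (g : Q ⟶ S) {U : Opens X} (s : Sec P U) :
    app (f ≫ g) U s = app g U (app f U s) := rfl

lemma germ_res {U V : Opens X} (h : V ≤ U) {x : X} (hx : x ∈ V) (s : Sec P U) :
    germ P x hx (res P h s) = germ P x (h hx) s :=
  TopCat.Presheaf.germ_res_apply' P (homOfLE h).op x hx s

lemma stalkMap_germ (f : P ⟶ Q) {U : Opens X} {x : X} (hx : x ∈ U) (s : Sec P U) :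
    stalkMap f x (germ P x hx s) = germ Q x hx (app f U s) :=
  TopCat.Presheaf.stalkFunctor_map_germ_apply' U x hx f s

lemma exists_germ_eq (x : X) (a : P.stalk x) :
    ∃ (U : Opens X) (hx : x ∈ U) (s : Sec P U), germ P x hx s = a :=
  P.exists_germ_eq a

lemma exists_res_eq_zero {U : Opens X} {x : X} (hx : x ∈ U) (s : Sec P U)
    (h : germ P x hx s = 0) : ∃ (V : Opens X) (hV : V ≤ U), x ∈ V ∧ res P hV s = 0 := by
  obtain ⟨W, hW, i, j, hij⟩ := P.germ_eq x hx hx s (0 : Sec P U) (h.trans (map_zero _).symm)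
  exact ⟨W, i.le, hW, hij.trans (map_zero (res P j.le))⟩

/-- Exactness of `P ⟶ Q ⟶ S` as a sequence of sheaves: sections killed by `g` lie locally in the
image of `f`. -/
def LocExact (f : P ⟶ Q) (g : Q ⟶ S) : Prop :=
  ∀ (U : Opens X) (s : Sec Q U), app g U s = 0 → ∀ x ∈ U,
    ∃ (V : Opens X) (h : V ≤ U), x ∈ V ∧ ∃ t : Sec P V, app f V t = res Q h s

lemma LocExact.stalk {f : P ⟶ Q} {g : Q ⟶ S} (h : LocExact f g) (x : X) (a : Q.stalk x)
    (ha : stalkMap g x a = 0) : ∃ b, stalkMap f x b = a := by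
  obtain ⟨U, hx, s, rfl⟩ := exists_germ_eq x a
  rw [stalkMap_germ] at ha
  obtain ⟨V, hV, hxV, hs⟩ := exists_res_eq_zero hx _ ha
  obtain ⟨W, hW, hxW, t, ht⟩ := h V (res Q hV s) (by rw [app_res, hs]) x hxV
  refine ⟨germ P x hxW t, ?_⟩
  rw [stalkMap_germ, ht, germ_res, germ_res]

end

lemma sec_ext {F : Sh R X} {U : Opens X} {s t : Sec F.presheaf U}
    (h : ∀ x ∈ U, ∃ (V : Opens X) (hV : V ≤ U), x ∈ V ∧
      res F.presheaf hV s = res F.presheaf hV t) : s = t := by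
  refine TopCat.Presheaf.section_ext F U s t fun x hx => ?_
  obtain ⟨V, hV, hxV, hst⟩ := h x hx
  change germ F.presheaf x hx s = germ F.presheaf x hx t
  rw [← germ_res hV hxV, hst, germ_res]

end Sections

section GodementSections

variable {R : Type} [CommRing R] {X : TopCat.{0}}

/-- The value at a point, in the stalk, of a discontinuous section. -/
def gval (F : Sh R X) {U : Opens X} (x : U) :
    Sec (godementZero.obj F).presheaf U →ₗ[R] F.presheaf.stalk (x : X) where
  toFun s := s.1 x
  map_add' _ _ := rfl
  map_smul' _ _ := rfl

/-- The discontinuous section with given values. -/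
def gmk (F : Sh R X) (U : Opens X) (s : ∀ x : U, F.presheaf.stalk (x : X)) :
    Sec (godementZero.obj F).presheaf U := ⟨s, trivial⟩

variable {F G H : Sh R X}

@[simp] lemma gval_gmk {U : Opens X} (s : ∀ x : U, F.presheaf.stalk (x : X)) (x : U) :
    gval F x (gmk F U s) = s x := rfl

lemma gval_ext {U : Opens X} {s t : Sec (godementZero.obj F).presheaf U}
    (h : ∀ x, gval F x s = gval F x t) : s = t := Subtype.ext (funext h)

lemma gval_res {U V : Opens X} (h : V ≤ U) (s : Sec (godementZero.obj F).presheaf U) (x : V) :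
    gval F x (res _ h s) = gval F ⟨x, h x.2⟩ s := rfl

lemma gval_map (f : F ⟶ G) {U : Opens X} (s : Sec (godementZero.obj F).presheaf U) (x : U) :
    gval G x (app (godementZero.map f).hom U s) = stalkMap f.hom x (gval F x s) := rfl

lemma godementUnit_injective (F : Sh R X) (U : Opens X) :
    Function.Injective (app (godementUnit F).hom U) := fun s t hst =>
  TopCat.Presheaf.section_ext F U s t fun x hx => congrArg (gval F ⟨x, hx⟩) hst

instance (F : Sh R X) : Mono (godementUnit F) where
  right_cancellation _ _ h := sheaf_hom_ext fun U s => godementUnit_injective F U.unop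
    (congrArg (fun t => app t.hom U.unop s) h)

lemma app_godementUnit_naturality (f : F ⟶ G) {U : Opens X} (s : Sec F.presheaf U) :
    app (godementUnit G).hom U (app f.hom U s) =
      app (godementZero.map f).hom U (app (godementUnit F).hom U s) :=
  congrArg (fun t => app t.hom U s) (godementUnit_naturality f)

lemma app_godementProj_naturality (f : F ⟶ G) {U : Opens X}
    (s : Sec (godementZero.obj F).presheaf U) :
    app (godementProj G).hom U (app (godementZero.map f).hom U s) =
      app (godementQuotient.map f).hom U (app (godementProj F).hom U s) :=
  congrArg (fun t => app t.hom U s) (godementProj_naturality f)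

lemma godementProj_unit {U : Opens X} (s : Sec F.presheaf U) :
    app (godementProj F).hom U (app (godementUnit F).hom U s) = 0 :=
  congrArg (fun t => app t.hom U s) (godementUnit_proj F)

/-- Sections of the quotient sheaf lift locally to discontinuous sections. -/
lemma exists_godementProj_eq {U : Opens X} (r : Sec (godementQuotient.obj F).presheaf U) {x : X}
    (hx : x ∈ U) : ∃ (V : Opens X) (hV : V ≤ U), x ∈ V ∧
      ∃ t, app (godementProj F).hom V t = res _ hV r := by
  have h : TopCat.Presheaf.IsLocallySurjective (godementProj F).hom :=
    (TopCat.Sheaf.isLocallySurjective_iff_epi _).2 inferInstance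
  obtain ⟨V, hV, hx, ht⟩ := h.imageSieve_mem r x hx
  exact ⟨V, hV.le, ht, hx⟩

/-- Discontinuous sections that vanish in the quotient are sections of `F`. -/
lemma exists_godementUnit_eq {U : Opens X} (s : Sec (godementZero.obj F).presheaf U)
    (hs : app (godementProj F).hom U s = 0) : ∃ t, app (godementUnit F).hom U t = s := by
  let S : ShortComplex (Sh R X) := ShortComplex.mk (godementUnit F) (godementProj F)
    (godementUnit_proj F)
  have hS : S.Exact := ShortComplex.exact_cokernel (godementUnit F)
  let Ψ : TopCat.Presheaf (ModuleCat.{0} R) X ⥤ ModuleCat.{0} R :=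
    (evaluation (Opens X)ᵒᵖ (ModuleCat.{0} R)).obj (op U)
  let Φ : Sh R X ⥤ ModuleCat.{0} R := TopCat.Sheaf.forget (ModuleCat.{0} R) X ⋙ Ψ
  have : Φ.Additive := { }
  have : PreservesLimitsOfShape WalkingParallelPair (TopCat.Sheaf.forget (ModuleCat.{0} R) X) :=
    inferInstanceAs (PreservesLimitsOfShape WalkingParallelPair (sheafToPresheaf _ _))
  have : PreservesLimitsOfShape WalkingParallelPair Ψ :=
    evaluation_preservesLimitsOfShape (K := (Opens X)ᵒᵖ) (C := ModuleCat.{0} R) (op U)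
  have : PreservesLimitsOfShape WalkingParallelPair Φ := comp_preservesLimitsOfShape _ _
  have h := hS.map_of_mono_of_preservesKernel Φ (inferInstanceAs (Mono (godementUnit F)))
    inferInstance
  exact (ShortComplex.moduleCat_exact_iff _).1 h s hs

/-- The functor of discontinuous sections is exact, even on sections. -/
lemma LocExact.godementZero {f : F ⟶ G} {g : G ⟶ H} (h : LocExact f.hom g.hom) {U : Opens X}
    (s : Sec (godementZero.obj G).presheaf U) (hs : app (godementZero.map g).hom U s = 0) :
    ∃ t, app (DeRham.godementZero.map f).hom U t = s := by
  choose t ht using fun x : U => h.stalk x (gval G x s) (by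
    rw [← gval_map, hs, map_zero])
  exact ⟨gmk F U t, gval_ext fun x => by rw [gval_map, gval_gmk, ht]⟩

/-- The quotient functor preserves exactness in the middle of exact sequences with one more term on
the right; this is the diagram chase of the `3 × 3` lemma. -/
lemma LocExact.godementQuotient {I : Sh R X} {f : F ⟶ G} {g : G ⟶ H} {k : H ⟶ I}
    (h : LocExact f.hom g.hom) (h' : LocExact g.hom k.hom) (hgk : g ≫ k = 0) :
    LocExact (DeRham.godementQuotient.map f).hom (DeRham.godementQuotient.map g).hom := by
  intro U r hr x hx
  obtain ⟨V, hV, hxV, s, hs⟩ := exists_godementProj_eq r hx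
  obtain ⟨t, ht⟩ := exists_godementUnit_eq (app (DeRham.godementZero.map g).hom V s) (by
    rw [app_godementProj_naturality, hs, app_res, hr, map_zero])
  obtain ⟨W, hW, hxW, u, hu⟩ := h' V t (godementUnit_injective I V (by
    rw [app_godementUnit_naturality, ht, map_zero]
    have := congrArg (fun m => app (DeRham.godementZero.map m).hom V s) hgk
    rw [Functor.map_comp, Functor.map_zero] at this
    exact this)) x hxV
  obtain ⟨w, hw⟩ := h.godementZero (res _ hW s - app (godementUnit G).hom W u) (by
    rw [map_sub, app_res, ← ht, ← app_godementUnit_naturality, hu, app_res, sub_self])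
  refine ⟨W, hW.trans hV, hxW, app (godementProj F).hom W w, ?_⟩
  rw [← app_godementProj_naturality, hw, map_sub, godementProj_unit, sub_zero, app_res, hs, res_res]

end GodementSections

/-! ### Fine sheaves and the edge maps -/

section Fine

variable {R : Type} [CommRing R] {X : TopCat.{0}}

/-- A morphism of sheaves vanishes on an open set. -/
def ZeroOn {F G : Sh R X} (h : F ⟶ G) (W : Opens X) : Prop :=
  ∀ V ≤ W, ∀ s : Sec F.presheaf V, app h.hom V s = 0

/-- The action of morphisms of sheaves on sections, as an additive map. -/
def appHom (F G : Sh R X) (U : Opens X) :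
    (F ⟶ G) →+ (Sec F.presheaf U →ₗ[R] Sec G.presheaf U) where
  toFun f := app f.hom U
  map_zero' := rfl
  map_add' _ _ := rfl

lemma appHom_apply {F G : Sh R X} {U : Opens X} (f : F ⟶ G) : appHom F G U f = app f.hom U := rfl

lemma ZeroOn.mono {F G : Sh R X} {h : F ⟶ G} {W W' : Opens X} (hW : ZeroOn h W) (h' : W' ≤ W) :
    ZeroOn h W' := fun V hV => hW V (hV.trans h')

lemma ZeroOn.stalkMap {F G : Sh R X} {h : F ⟶ G} {W : Opens X} (hW : ZeroOn h W) {x : X}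
    (hx : x ∈ W) (a : F.presheaf.stalk x) : stalkMap h.hom x a = 0 := by
  obtain ⟨U, hxU, s, rfl⟩ := exists_germ_eq x a
  rw [← germ_res (inf_le_left : U ⊓ W ≤ U) ⟨hxU, hx⟩]
  exact (stalkMap_germ h.hom _ _).trans ((congrArg _ (hW _ inf_le_right _)).trans (map_zero _))

lemma ZeroOn.godementQuotient {F G : Sh R X} {h : F ⟶ G} {W : Opens X} (hW : ZeroOn h W) :
    ZeroOn (godementQuotient.map h) W := by
  intro V hV r
  refine sec_ext fun x hx => ?_
  obtain ⟨V', hV', hxV', s, hs⟩ := exists_godementProj_eq r hx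
  refine ⟨V', hV', hxV', ?_⟩
  have h0 : app (godementZero.map h).hom V' s = 0 := gval_ext fun y => by
    rw [gval_map, hW.stalkMap (hV (hV' y.2)), map_zero]
  rw [← app_res, ← hs, ← app_godementProj_naturality, h0, map_zero, map_zero]

/-- A partition of the identity of a sheaf: endomorphisms `h i`, supported in the members `U i` of a
covering, only finitely many of which are nonzero near any given point, with sum the identity. -/
structure IdPartition (F : Sh R X) {ι : Type} (U : ι → Opens X) where
  h : ι → (F ⟶ F)
  zeroOn : ∀ i x, x ∉ U i → ∃ W : Opens X, x ∈ W ∧ ZeroOn (h i) W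
  finite : ∀ x, ∃ W : Opens X, x ∈ W ∧ ∃ I : Finset ι, (∀ i ∉ I, ZeroOn (h i) W) ∧
    ZeroOn (∑ i ∈ I, h i - 𝟙 F) W

/-- A sheaf is fine if every open covering has a partition of the identity. Coverings are indexed by
the points of the space. -/
def IsFine (F : Sh R X) : Prop :=
  ∀ U : X → Opens X, (∀ x, x ∈ U x) → Nonempty (IdPartition F U)

lemma IsFine.godementQuotient {F : Sh R X} (hF : IsFine F) : IsFine (godementQuotient.obj F) := by
  intro U hU
  obtain ⟨P⟩ := hF U hU
  refine ⟨⟨fun i => DeRham.godementQuotient.map (P.h i), fun i x hx => ?_, fun x => ?_⟩⟩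
  · obtain ⟨W, hxW, hW⟩ := P.zeroOn i x hx
    exact ⟨W, hxW, hW.godementQuotient⟩
  · obtain ⟨W, hxW, I, hI, hsum⟩ := P.finite x
    refine ⟨W, hxW, I, fun i hi => (hI i hi).godementQuotient, ?_⟩
    have := hsum.godementQuotient
    rwa [Functor.map_sub, Functor.map_sum, CategoryTheory.Functor.map_id] at this

lemma IsFine.godementQ {F : Sh R X} (hF : IsFine F) : ∀ p, IsFine ((godementQ R X p).obj F)
  | 0 => hF
  | p + 1 => (hF.godementQ p).godementQuotient

/-- For a fine sheaf, global sections of the quotient lift to global discontinuous sections: extend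
local lifts by zero and glue them with a partition of the identity. -/
lemma IsFine.exists_godementProj_eq {F : Sh R X} (hF : IsFine F)
    (r : Sec (DeRham.godementQuotient.obj F).presheaf ⊤) :
    ∃ t, app (godementProj F).hom ⊤ t = r := by
  classical
  choose V _ hxV t ht using fun x : X => DeRham.exists_godementProj_eq r (x := x) trivial
  obtain ⟨P⟩ := hF V hxV
  let e : ∀ x, Sec (godementZero.obj F).presheaf ⊤ := fun x =>
    gmk F ⊤ fun y => if hy : (y : X) ∈ V x then gval F ⟨y, hy⟩ (t x) else 0
  have he : ∀ x, res _ le_top (e x) = t x := fun x => gval_ext fun y => dif_pos y.2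
  -- On each member of the covering the lift is correct, and elsewhere the endomorphism vanishes.
  have hproj : ∀ x, app (godementProj F).hom ⊤ (app (godementZero.map (P.h x)).hom ⊤ (e x)) =
      app (DeRham.godementQuotient.map (P.h x)).hom ⊤ r := fun x => by
    rw [app_godementProj_naturality]
    refine sec_ext fun z _ => ?_
    by_cases hz : z ∈ V x
    · refine ⟨V x, le_top, hz, ?_⟩
      rw [← app_res, ← app_res, ← app_res, he, ht]
    · obtain ⟨W, hzW, hW⟩ := P.zeroOn x z hz
      refine ⟨W, le_top, hzW, ?_⟩
      rw [← app_res, hW.godementQuotient W le_rfl]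
      exact ((app_res _ _ _).symm.trans (hW.godementQuotient W le_rfl _)).symm
  refine ⟨gmk F ⊤ fun y => ∑ᶠ x, stalkMap (P.h x).hom y (gval F y (e x)), sec_ext fun y _ => ?_⟩
  obtain ⟨W, hyW, I, hI, hsum⟩ := P.finite y
  refine ⟨W, le_top, hyW, ?_⟩
  have hloc : res _ (le_top : W ≤ ⊤)
      (gmk F ⊤ fun y => ∑ᶠ x, stalkMap (P.h x).hom y (gval F y (e x))) =
      res _ le_top (∑ x ∈ I, app (godementZero.map (P.h x)).hom ⊤ (e x)) := gval_ext fun z => by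
    rw [gval_res, gval_res, gval_gmk, map_sum]
    refine finsum_eq_sum_of_support_subset _ fun x hx => ?_
    by_contra hxI
    exact hx ((hI x hxI).stalkMap z.2 _)
  rw [← app_res, hloc, app_res, map_sum, Finset.sum_congr rfl fun x _ => hproj x]
  have h0 := hsum.godementQuotient W le_rfl (res _ le_top r)
  rw [app_res, Functor.map_sub, Functor.map_sum, CategoryTheory.Functor.map_id] at h0
  refine sub_eq_zero.1 ?_
  rw [← map_sub, ← h0]
  refine congrArg _ ((congrArg (· - r) (LinearMap.sum_apply _ _ _).symm).trans ?_)
  rw [← appHom_apply, map_sub, map_sum]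
  rfl

end Fine

section Edges

variable {R : Type} [CommRing R] {X : TopCat.{0}}

/-- Global sections of a complex of fine sheaves compute its hypercohomology. -/
theorem isIso_sectionsToHyper {L : CochainComplex (Sh R X) ℕ} (hL : ∀ q, IsFine (L.X q)) (k : ℕ) :
    IsIso (HomologicalComplex.homologyMap (sectionsToHyper L) k) := by
  have hd : ∀ p q (x : ((godementDouble L).X p).X q),
      (((godementDouble L).d p (p + 1)).f q).hom x =
        app (godementUnit _).hom ⊤ (app (godementProj ((godementQ R X p).obj (L.X q))).hom ⊤ x) :=
    fun p q x => congrArg (fun t => t.hom x) (godementDouble_d L p q)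
  have hproj : ∀ p q (x : ((godementDouble L).X p).X q),
      (((godementDouble L).d p (p + 1)).f q).hom x = 0 →
        app (godementProj ((godementQ R X p).obj (L.X q))).hom ⊤ x = 0 := fun p q x hx =>
    godementUnit_injective _ _ (((hd p q x).symm.trans hx).trans (map_zero _).symm)
  refine isIso_homologyMap_columnEdge _ _ _ _ _ (fun q => godementUnit_injective (L.X q) ⊤)
    (fun q x hx => exists_godementUnit_eq (F := L.X q) x (hproj 0 q x hx)) (fun q p x hx => ?_) k
  obtain ⟨r, hr⟩ := exists_godementUnit_eq (F := (godementQ R X (p + 1)).obj (L.X q)) x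
    (hproj (p + 1) q x hx)
  obtain ⟨t, ht⟩ := ((hL q).godementQ p).exists_godementProj_eq r
  refine ⟨t, (hd p q t).trans ?_⟩
  rw [ht]
  exact hr

/-- The iterated Godement quotients preserve exactness of a complex of sheaves. -/
lemma locExact_godementQ {E : ℕ → Sh R X} (e : ∀ n, E n ⟶ E (n + 1))
    (he : ∀ n, e n ≫ e (n + 1) = 0) (hex : ∀ n, LocExact (e n).hom (e (n + 1)).hom) :
    ∀ p n, LocExact ((godementQ R X p).map (e n)).hom ((godementQ R X p).map (e (n + 1))).hom
  | 0, n => hex n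
  | p + 1, n => (locExact_godementQ e he hex p n).godementQuotient
      (locExact_godementQ e he hex p (n + 1)) (by
        rw [← Functor.map_comp, he, Functor.map_zero])

/-- A complex of sheaves augmented by `F`, as a sequence of morphisms that starts with
`0 : F ⟶ F`. -/
def augmentedObj (F : Sh R X) (L : CochainComplex (Sh R X) ℕ) : ℕ → Sh R X
  | 0 => F
  | 1 => F
  | n + 2 => L.X n

/-- The morphisms of the augmented complex. -/
def augmentedMap {F : Sh R X} {L : CochainComplex (Sh R X) ℕ} (ε : F ⟶ L.X 0) :
    ∀ n, augmentedObj F L n ⟶ augmentedObj F L (n + 1)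
  | 0 => 0
  | 1 => ε
  | n + 2 => L.d n (n + 1)

/-- The cohomology of `F` is the hypercohomology of any resolution of `F`, because global sections of
the Godement functors are exact. -/
theorem isIso_sheafToHyper {F : Sh R X} {L : CochainComplex (Sh R X) ℕ} (ε : F ⟶ L.X 0)
    (hε : ε ≫ L.d 0 1 = 0) (hinj : ∀ U, Function.Injective (app ε.hom U))
    (hex₀ : LocExact ε.hom (L.d 0 1).hom)
    (hex : ∀ n, LocExact (L.d n (n + 1)).hom (L.d (n + 1) (n + 1 + 1)).hom) (k : ℕ) :
    IsIso (HomologicalComplex.homologyMap (sheafToHyper ε hε) k) := by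
  have key := locExact_godementQ (augmentedMap ε)
    (by
      rintro (_ | _ | n)
      · exact zero_comp
      · exact hε
      · exact L.d_comp_d _ _ _)
    (by
      rintro (_ | _ | n)
      · intro U s hs x hx
        refine ⟨U, le_rfl, hx, 0, ?_⟩
        have h0 : s = 0 := hinj U (hs.trans (map_zero (app ε.hom U)).symm)
        rw [h0]
        exact (map_zero (app _ U)).trans (map_zero (res _ _)).symm
      · exact hex₀
      · exact hex n)
  refine isIso_homologyMap_rowEdge _ _ _ _ _ (fun p => ?_) (fun p x hx => ?_)
    (fun p q x hx => ?_) k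
  · refine (injective_iff_map_eq_zero _).2 fun a ha => ?_
    obtain ⟨t, rfl⟩ := (key p 0).godementZero a ha
    have h0 : (godementC R X p).map (0 : F ⟶ F) = 0 := Functor.map_zero _ _ _
    exact congrArg (fun m => app m.hom ⊤ t) h0
  · exact (key p 1).godementZero x hx
  · exact (key p (q + 2)).godementZero x hx

end Edges

/-! ### The Poincaré lemma in Euclidean space -/

section ParametricIntegral

open scoped ContDiff Topology
open MeasureTheory

variable {E : Type} [NormedAddCommGroup E] [NormedSpace ℝ E] [FiniteDimensional ℝ E]

lemma hasFDerivAt_parametric_integral {F : Type} [NormedAddCommGroup F] [NormedSpace ℝ F]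
    {g : ℝ × E → F} (hg : ContDiff ℝ 1 g) (x : E) :
    HasFDerivAt (fun x => ∫ t in (0 : ℝ)..1, g (t, x))
      (∫ t in (0 : ℝ)..1, (fderiv ℝ g (t, x)).comp (ContinuousLinearMap.inr ℝ ℝ E)) x := by
  have : ProperSpace E := FiniteDimensional.proper ℝ E
  have hg' : Continuous fun p : ℝ × E => (fderiv ℝ g p).comp (ContinuousLinearMap.inr ℝ ℝ E) :=
    (hg.continuous_fderiv one_ne_zero).clm_comp continuous_const
  obtain ⟨C, hC⟩ := (isCompact_Icc.prod (isCompact_closedBall x 1)).exists_bound_of_continuousOn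
    (s := Set.Icc (0 : ℝ) 1 ×ˢ Metric.closedBall x 1) hg'.continuousOn
  refine intervalIntegral.hasFDerivAt_integral_of_dominated_of_fderiv_le
    (F' := fun x t => (fderiv ℝ g (t, x)).comp (ContinuousLinearMap.inr ℝ ℝ E))
    (bound := fun _ => C) (Metric.closedBall_mem_nhds x one_pos)
    (Filter.Eventually.of_forall fun y => ?_) ?_ ?_ ?_ ?_ ?_
  · exact (hg.continuous.comp (by fun_prop : Continuous fun t : ℝ => (t, y))).aestronglyMeasurable
  · exact (hg.continuous.comp (by fun_prop : Continuous fun t : ℝ => (t, x))).intervalIntegrable _ _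
  · exact (hg'.comp (by fun_prop : Continuous fun t : ℝ => (t, x))).aestronglyMeasurable
  · refine Filter.Eventually.of_forall fun t ht y hy => hC (t, y) ⟨?_, hy⟩
    rw [Set.uIoc_of_le zero_le_one] at ht
    exact ⟨ht.1.le, ht.2⟩
  · exact continuous_const.intervalIntegrable _ _
  · refine Filter.Eventually.of_forall fun t _ y _ => ?_
    exact ((hg.differentiable one_ne_zero (t, y)).hasFDerivAt).comp y
      ((hasFDerivAt_const t y).prodMk (hasFDerivAt_id y))

lemma contDiff_parametric_integral (n : ℕ) : ∀ {F : Type} [NormedAddCommGroup F] [NormedSpace ℝ F]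
    {g : ℝ × E → F}, ContDiff ℝ n g → ContDiff ℝ n (fun x => ∫ t in (0 : ℝ)..1, g (t, x)) := by
  induction n with
  | zero =>
    intro F _ _ g hg
    rw [CharP.cast_eq_zero, contDiff_zero] at hg ⊢
    exact intervalIntegral.continuous_parametric_intervalIntegral_of_continuous'
      (f := fun x t => g (t, x)) (hg.comp continuous_swap) 0 1
  | succ n ih =>
    intro F _ _ g hg
    have h1 : ContDiff ℝ 1 g := hg.of_le (by simp)
    rw [Nat.cast_succ, contDiff_succ_iff_hasFDerivAt]
    refine ⟨_, ?_, fun x => hasFDerivAt_parametric_integral h1 x⟩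
    exact ih ((hg.fderiv_right (m := n) (by simp)).clm_comp contDiff_const)

end ParametricIntegral

section PoincareLemma

open scoped ContDiff Topology
open ContinuousAlternatingMap

variable {E : Type} [NormedAddCommGroup E] [NormedSpace ℝ E]
  {F : Type} [NormedAddCommGroup F] [NormedSpace ℝ F] {k : ℕ}

/-- Contraction of forms with a vector. -/
def contraction (F : Type) [NormedAddCommGroup F] [NormedSpace ℝ F] (k : ℕ) (x : E) :
    (E [⋀^Fin (k + 1)]→L[ℝ] F) →L[ℝ] (E [⋀^Fin k]→L[ℝ] F) :=
  (ContinuousLinearMap.apply ℝ _ x).comp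
    (curryLeftLI (𝕜 := ℝ) (E := E) (F := F) (n := k)).toContinuousLinearMap

/-- The algebraic part of Cartan's formula. -/
lemma alternatizeUncurryFin_contraction (x : E) (A : E →L[ℝ] E [⋀^Fin (k + 1)]→L[ℝ] F) :
    alternatizeUncurryFin ((contraction F k x).comp A) =
      A x - (alternatizeUncurryFin A).curryLeft x := by
  ext v
  have h : (alternatizeUncurryFin A).curryLeft x v =
      alternatizeUncurryFin A (Matrix.vecCons x v) := rfl
  have hs : ∀ i : Fin (k + 1), i.succ.removeNth (Matrix.vecCons x v) =
      Matrix.vecCons x (i.removeNth v) := fun i => by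
    ext j
    refine Fin.cases ?_ (fun j => ?_) j
    · simp [Fin.removeNth]
    · simp [Fin.removeNth]
  have hA : alternatizeUncurryFin A (Matrix.vecCons x v) =
      A x v - ∑ i : Fin (k + 1), (-1) ^ (i : ℕ) • A (v i) (Matrix.vecCons x (i.removeNth v)) := by
    rw [alternatizeUncurryFin_apply, Fin.sum_univ_succ, sub_eq_add_neg, ← Finset.sum_neg_distrib]
    refine congrArg₂ (· + ·) (one_smul _ _) (Finset.sum_congr rfl fun i _ => ?_)
    rw [hs, Fin.val_succ, pow_succ, mul_neg, mul_one, neg_smul]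
    rfl
  rw [ContinuousAlternatingMap.sub_apply, h, hA, alternatizeUncurryFin_apply, sub_sub_cancel]
  rfl

/-- The integrand of the radial homotopy operator. -/
def radialIntegrand (α : E → E [⋀^Fin (k + 1)]→L[ℝ] F) (p : ℝ × E) : E [⋀^Fin k]→L[ℝ] F :=
  p.1 ^ k • contraction F k p.2 (α (p.1 • p.2))

/-- The radial homotopy operator of the Poincaré lemma. -/
def radialPrimitive (α : E → E [⋀^Fin (k + 1)]→L[ℝ] F) (x : E) : E [⋀^Fin k]→L[ℝ] F :=
  ∫ t in (0 : ℝ)..1, radialIntegrand α (t, x)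

lemma contDiff_radialIntegrand {α : E → E [⋀^Fin (k + 1)]→L[ℝ] F} (hα : ContDiff ℝ ∞ α) :
    ContDiff ℝ ∞ (radialIntegrand α) := by
  refine (contDiff_fst.pow k).smul ?_
  have h : ContDiff ℝ ∞ fun p : ℝ × E => α (p.1 • p.2) := hα.comp (contDiff_fst.smul contDiff_snd)
  exact ((curryLeftLI (𝕜 := ℝ) (E := E) (F := F) (n := k)).toContinuousLinearMap.contDiff.comp
    h).clm_apply contDiff_snd

lemma contDiff_radialPrimitive [FiniteDimensional ℝ E] {α : E → E [⋀^Fin (k + 1)]→L[ℝ] F}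
    (hα : ContDiff ℝ ∞ α) :
    ContDiff ℝ ∞ (radialPrimitive α) :=
  contDiff_infty.2 fun n => contDiff_parametric_integral (E := E) (F := E [⋀^Fin k]→L[ℝ] F) n
    ((contDiff_radialIntegrand hα).of_le (by exact_mod_cast le_top))

/-- The exterior derivative of the integrand is a total derivative in `t` where `α` is closed. -/
lemma alternatize_fderiv_radialIntegrand {α : E → E [⋀^Fin (k + 1)]→L[ℝ] F}
    (hα : ContDiff ℝ ∞ α) (t : ℝ) (x : E) (hd : extDeriv α (t • x) = 0) :
    alternatizeUncurryFin
      ((fderiv ℝ (radialIntegrand α) (t, x)).comp (ContinuousLinearMap.inr ℝ ℝ E)) =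
      ((k + 1 : ℝ) * t ^ k) • α (t • x) + t ^ (k + 1) • fderiv ℝ α (t • x) x := by
  set A := fderiv ℝ α (t • x) with hA
  have hdiff : HasFDerivAt α A (t • x) :=
    (hα.differentiable (by simp) _).hasFDerivAt
  have h1 : HasFDerivAt (fun y : E => radialIntegrand α (t, y))
      ((fderiv ℝ (radialIntegrand α) (t, x)).comp (ContinuousLinearMap.inr ℝ ℝ E)) x :=
    ((contDiff_radialIntegrand hα).differentiable (by simp) (t, x)).hasFDerivAt.comp x
      ((hasFDerivAt_const t x).prodMk (hasFDerivAt_id x))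
  have h2 : HasFDerivAt (fun y : E => radialIntegrand α (t, y))
      (t ^ k • ((α (t • x)).curryLeft + t • (contraction F k x).comp A)) x := by
    let C := (curryLeftLI (𝕜 := ℝ) (E := E) (F := F) (n := k)).toContinuousLinearMap
    have h3 : HasFDerivAt (fun y : E => α (t • y)) (t • A) x := by
      refine (hdiff.comp x ((hasFDerivAt_id (𝕜 := ℝ) x).const_smul t)).congr_fderiv ?_
      ext v; simp
    have h4 : HasFDerivAt (fun y : E => C (α (t • y)) y) _ x :=
      HasFDerivAt.clm_apply (C.hasFDerivAt.comp x h3) (hasFDerivAt_id x)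
    have h5 := h4.const_smul (t ^ k)
    refine h5.congr_fderiv ?_
    ext v w
    simp [contraction, C]
  rw [h1.unique h2, alternatizeUncurryFin_smul, alternatizeUncurryFin_add,
    alternatizeUncurryFin_smul, alternatizeUncurryFin_contraction, alternatizeUncurryFin_curryLeft]
  have h0 : alternatizeUncurryFin A = 0 := hd
  have h00 : (0 : E [⋀^Fin (k + 1 + 1)]→L[ℝ] F).curryLeft x = 0 := rfl
  rw [h0, h00, sub_zero, smul_add,
    smul_smul, ← pow_succ, ← Nat.cast_smul_eq_nsmul ℝ, smul_smul]
  push_cast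
  rw [mul_comm]

/-- The Poincaré lemma for a globally defined form, closed along a segment from the origin. -/
lemma extDeriv_radialPrimitive [FiniteDimensional ℝ E] [CompleteSpace F]
    {α : E → E [⋀^Fin (k + 1)]→L[ℝ] F} (hα : ContDiff ℝ ∞ α) (x : E)
    (hd : ∀ t ∈ Set.Icc (0 : ℝ) 1, extDeriv α (t • x) = 0) :
    extDeriv (radialPrimitive α) x = α x := by
  have h1 : ContDiff ℝ 1 (radialIntegrand α) :=
    (contDiff_radialIntegrand hα).of_le (by exact_mod_cast le_top)
  have hcont : Continuous fun t : ℝ =>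
      (fderiv ℝ (radialIntegrand α) (t, x)).comp (ContinuousLinearMap.inr ℝ ℝ E) :=
    ((h1.continuous_fderiv one_ne_zero).comp
      (by fun_prop : Continuous fun t : ℝ => (t, x))).clm_comp continuous_const
  rw [extDeriv, (show fderiv ℝ (radialPrimitive α) x = _ from
    (hasFDerivAt_parametric_integral h1 x).fderiv)]
  refine (ContinuousLinearMap.intervalIntegral_comp_comm (𝕜 := ℝ) (E := E →L[ℝ] E [⋀^Fin k]→L[ℝ] F)
    (F := E [⋀^Fin (k + 1)]→L[ℝ] F) (μ := MeasureTheory.volume)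
    (alternatizeUncurryFinCLM ℝ E F) (Continuous.intervalIntegrable
    (E := E →L[ℝ] E [⋀^Fin k]→L[ℝ] F) hcont 0 1)).symm.trans ?_
  have hderiv : ∀ t : ℝ, HasDerivAt (fun t : ℝ => t ^ (k + 1) • α (t • x))
      (((k + 1 : ℝ) * t ^ k) • α (t • x) + t ^ (k + 1) • fderiv ℝ α (t • x) x) t := fun t => by
    have h2 : HasDerivAt (fun t : ℝ => α (t • x)) (fderiv ℝ α (t • x) x) t := by
      have h3 : HasDerivAt (fun t : ℝ => t • x) x t := by
        simpa using (hasDerivAt_id t).smul_const x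
      exact (hα.differentiable (by simp) (t • x)).hasFDerivAt.comp_hasDerivAt t h3
    have h4 := (hasDerivAt_pow (k + 1) t).smul h2
    refine h4.congr_deriv ?_
    push_cast
    exact add_comm _ _
  have hα1 : Continuous (fderiv ℝ α) := hα.continuous_fderiv (by simp)
  have hα0 : Continuous α := hα.continuous
  refine (intervalIntegral.integral_congr (g := fun t : ℝ =>
    ((k + 1 : ℝ) * t ^ k) • α (t • x) + t ^ (k + 1) • fderiv ℝ α (t • x) x)
    fun t ht => alternatize_fderiv_radialIntegrand hα t x (hd t
      (by rwa [Set.uIcc_of_le zero_le_one] at ht))).trans ?_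
  rw [intervalIntegral.integral_eq_sub_of_hasDerivAt (fun t _ => hderiv t)
      (Continuous.intervalIntegrable (by fun_prop) _ _)]
  simp

/-- The Poincaré lemma: a smooth form closed near a point is exact near that point. -/
lemma exists_extDeriv_eq [FiniteDimensional ℝ E] [CompleteSpace F]
    {α : E → E [⋀^Fin (k + 1)]→L[ℝ] F} {W : Set E} (hW : IsOpen W) (hα : ContDiffOn ℝ ∞ α W)
    (hd : ∀ y ∈ W, extDeriv α y = 0) {c : E} (hc : c ∈ W) :
    ∃ (r : ℝ) (β : E → E [⋀^Fin k]→L[ℝ] F), 0 < r ∧ Metric.ball c r ⊆ W ∧ ContDiff ℝ ∞ β ∧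
      ∀ y ∈ Metric.ball c r, extDeriv β y = α y := by
  obtain ⟨r, hr, hrW⟩ := Metric.isOpen_iff.1 hW c hc
  -- Cut off, to obtain a form on the whole space, and move the point to the origin.
  let χ : ContDiffBump c := ⟨r / 3, r / 2, by positivity, by linarith⟩
  let α' : E → E [⋀^Fin (k + 1)]→L[ℝ] F := fun y => χ (c + y) • α (c + y)
  have hα' : ContDiff ℝ ∞ α' := by
    have h1 : ContDiff ℝ ∞ fun y => χ y • α y := by
      refine contDiff_iff_contDiffAt.2 fun y => ?_
      by_cases hy : y ∈ Metric.ball c r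
      · exact χ.contDiff.contDiffAt.smul (hα.contDiffAt (hW.mem_nhds (hrW hy)))
      · have hy' : y ∈ (tsupport χ)ᶜ := by
          rw [χ.tsupport_eq]
          intro h
          exact hy (Metric.closedBall_subset_ball (show r / 2 < r by linarith) h)
        refine contDiffAt_const (c := 0) |>.congr_of_eventuallyEq ?_
        filter_upwards [(isClosed_tsupport χ).isOpen_compl.mem_nhds hy'] with z hz
        rw [image_eq_zero_of_notMem_tsupport hz, zero_smul]
    exact h1.comp (contDiff_const.add contDiff_id)
  have hev : ∀ y ∈ Metric.ball (0 : E) (r / 3), α' =ᶠ[𝓝 y] fun y => α (c + y) := fun y hy => by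
    filter_upwards [Metric.isOpen_ball.mem_nhds hy] with z hz
    have h1 : χ (c + z) = 1 := χ.one_of_mem_closedBall (by
      rw [mem_ball_zero_iff] at hz
      rw [mem_closedBall_iff_norm, add_sub_cancel_left]
      exact hz.le)
    change χ (c + z) • α (c + z) = _
    rw [h1, one_smul]
  have htrans : ∀ {m : ℕ} (γ : E → E [⋀^Fin m]→L[ℝ] F) (a y : E),
      extDeriv (fun y => γ (a + y)) y = extDeriv γ (a + y) := fun γ a y => by
    rw [extDeriv, fderiv_comp_add_left, extDeriv]
  refine ⟨r / 3, fun y => radialPrimitive α' (-c + y), by positivity,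
    (Metric.ball_subset_ball (by linarith)).trans hrW,
    (contDiff_radialPrimitive hα').comp (contDiff_const.add contDiff_id), fun y hy => ?_⟩
  have hy' : -c + y ∈ Metric.ball (0 : E) (r / 3) := by
    rw [mem_ball_zero_iff, neg_add_eq_sub]
    exact mem_ball_iff_norm.1 hy
  rw [htrans, extDeriv_radialPrimitive hα' _ fun t ht => ?_]
  · exact (hev _ hy').self_of_nhds.trans (congrArg α (add_neg_cancel_left c y))
  · have hty : t • (-c + y) ∈ Metric.ball (0 : E) (r / 3) := by
      rw [mem_ball_zero_iff] at hy' ⊢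
      rw [norm_smul, Real.norm_of_nonneg ht.1]
      exact (mul_le_of_le_one_left (norm_nonneg _) ht.2).trans_lt hy'
    rw [(hev _ hty).extDeriv_eq, htrans]
    refine hd _ (hrW ?_)
    rw [mem_ball_iff_norm, add_sub_cancel_left]
    exact (mem_ball_zero_iff.1 hty).trans (by linarith)

/-- If `p x` and `g x` depend smoothly on `x`, so does the operator `h ↦ p x ∘ h ∘ g x`, composed with
fixed linear maps on both sides. -/
lemma contDiff_conjugate {A B C D G X H : Type} [NormedAddCommGroup A] [NormedSpace ℝ A]
    [NormedAddCommGroup B] [NormedSpace ℝ B] [NormedAddCommGroup C] [NormedSpace ℝ C]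
    [NormedAddCommGroup D] [NormedSpace ℝ D] [NormedAddCommGroup G] [NormedSpace ℝ G]
    [NormedAddCommGroup X] [NormedSpace ℝ X] [NormedAddCommGroup H] [NormedSpace ℝ H]
    {p : X → B →L[ℝ] C} (hp : ContDiff ℝ ∞ p) {g : X → D →L[ℝ] G} (hg : ContDiff ℝ ∞ g)
    (a : (D →L[ℝ] C) →L[ℝ] H) (c : A →L[ℝ] G →L[ℝ] B) :
    ContDiff ℝ ∞ fun x => a.comp (((ContinuousLinearMap.compL ℝ D B C (p x)).comp
      ((ContinuousLinearMap.compL ℝ D G B).flip (g x))).comp c) := by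
  have h1 : ContDiff ℝ ∞ fun x => ContinuousLinearMap.compL ℝ D B C (p x) := by fun_prop
  have h2 : ContDiff ℝ ∞ fun x => (ContinuousLinearMap.compL ℝ D G B).flip (g x) := by fun_prop
  have h3 := h1.clm_comp h2
  have h4 := h3.clm_comp (contDiff_const (c := c))
  have h5 := (contDiff_const (c := a)).clm_comp h4
  exact h5

/-- Pullback of alternating maps depends smoothly on the linear map along which one pulls back. -/
lemma contDiff_compContinuousLinearMapCLM {E' : Type} [NormedAddCommGroup E'] [NormedSpace ℝ E'] :
    ∀ k : ℕ, ContDiff ℝ ∞ fun g : E' →L[ℝ] E =>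
      (compContinuousLinearMapCLM g : (E [⋀^Fin k]→L[ℝ] F) →L[ℝ] (E' [⋀^Fin k]→L[ℝ] F))
  | 0 => by
    have h : (fun g : E' →L[ℝ] E =>
        (compContinuousLinearMapCLM g : (E [⋀^Fin 0]→L[ℝ] F) →L[ℝ] (E' [⋀^Fin 0]→L[ℝ] F))) =
        fun _ => compContinuousLinearMapCLM 0 := by
      funext g
      ext f v
      exact congrArg f (Subsingleton.elim _ _)
    rw [h]
    exact contDiff_const
  | k + 1 => by
    -- Currying has a left inverse up to a factor, which allows induction on the degree.
    have h : (fun g : E' →L[ℝ] E => (compContinuousLinearMapCLM g :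
          (E [⋀^Fin (k + 1)]→L[ℝ] F) →L[ℝ] (E' [⋀^Fin (k + 1)]→L[ℝ] F))) =
        fun g => (((k + 1 : ℕ) : ℝ)⁻¹ • alternatizeUncurryFinCLM ℝ E' F (n := k)).comp
          (((ContinuousLinearMap.compL ℝ E' (E [⋀^Fin k]→L[ℝ] F) (E' [⋀^Fin k]→L[ℝ] F)
            (compContinuousLinearMapCLM g)).comp
            ((ContinuousLinearMap.compL ℝ E' E (E [⋀^Fin k]→L[ℝ] F)).flip g)).comp
            (curryLeftLI (𝕜 := ℝ) (E := E) (F := F) (n := k)).toContinuousLinearMap) := by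
      funext g
      refine ContinuousLinearMap.ext fun f => ?_
      have hc : ((ContinuousLinearMap.compL ℝ E' (E [⋀^Fin k]→L[ℝ] F) (E' [⋀^Fin k]→L[ℝ] F)
            (compContinuousLinearMapCLM g)).comp
            ((ContinuousLinearMap.compL ℝ E' E (E [⋀^Fin k]→L[ℝ] F)).flip g))
            (curryLeftLI (𝕜 := ℝ) (E := E) (F := F) (n := k) f) =
          (f.compContinuousLinearMap g).curryLeft := by
        ext v w
        refine congrArg f (funext fun i => ?_)
        refine Fin.cases rfl (fun j => rfl) i
      change f.compContinuousLinearMap g = ((k + 1 : ℕ) : ℝ)⁻¹ • alternatizeUncurryFin _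
      refine Eq.trans ?_ (congrArg (fun t => ((k + 1 : ℕ) : ℝ)⁻¹ • alternatizeUncurryFin t) hc.symm)
      rw [alternatizeUncurryFin_curryLeft, ← Nat.cast_smul_eq_nsmul ℝ, smul_smul,
        inv_mul_cancel₀ (Nat.cast_ne_zero.2 (Nat.succ_ne_zero k)), one_smul]
    rw [h]
    exact contDiff_conjugate (contDiff_compContinuousLinearMapCLM k) contDiff_id _ _

end PoincareLemma

/-! ### The de Rham complex of sheaves -/

section FineForms

open scoped Manifold ContDiff Topology

variable {𝕜 : Type} [RCLike 𝕜] {E : Type} [NormedAddCommGroup E] [NormedSpace ℝ E]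
  {M : Type} [TopologicalSpace M] [ChartedSpace E M] {k : ℕ}

lemma chartRep_mul (f : M → ℝ) {U : Opens M} (e : OpenPartialHomeomorph M E)
    (α : ∀ x : U, FormAt 𝕜 E k (x : M)) :
    chartRep e (fun x => f x • α x) = fun y => f (e.symm y) • chartRep e α y := by
  funext y
  by_cases h : e.symm y ∈ U
  · ext v
    rw [chartRep, extendForm_of_mem _ h, chartRep, extendForm_of_mem _ h]
    rfl
  · ext v
    have h1 : extendForm (fun x : U => f x • α x) (e.symm y) = 0 := dif_neg h
    have h2 : extendForm α (e.symm y) = 0 := dif_neg h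
    rw [chartRep, h1, chartRep, h2]
    exact (smul_zero (f (e.symm y))).symm

/-- On the domain of a chart, a form is the pullback of its representative. -/
lemma eq_pullback_chartRep {U : Opens M} {e : OpenPartialHomeomorph M E}
    [IsManifold 𝓘(ℝ, E) ∞ M] (he : e ∈ atlas E M) (α : ∀ x : U, FormAt 𝕜 E k (x : M)) (x : U)
    (hx : (x : M) ∈ e.source) :
    α x = (chartRep e α (e x)).compContinuousLinearMap
      (mfderiv 𝓘(ℝ, E) 𝓘(ℝ, E) e (x : M) : TangentSpace 𝓘(ℝ, E) (x : M) →L[ℝ] E) := by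
  have he' : e.MDifferentiable 𝓘(ℝ, E) 𝓘(ℝ, E) :=
    ⟨fun z hz => (mdifferentiableAt_chart he hz).mdifferentiableWithinAt,
      fun z hz => (mdifferentiableAt_chart_symm he hz).mdifferentiableWithinAt⟩
  have h1 : chartRep e α (e x) = ContinuousAlternatingMap.compContinuousLinearMap
      (extendForm α (x : M) : E [⋀^Fin k]→L[ℝ] 𝕜)
      (mfderiv 𝓘(ℝ, E) 𝓘(ℝ, E) e.symm (e x) : E →L[ℝ] E) := pullback_congr α (e.left_inv hx) _
  have h2 := he'.symm_comp_deriv hx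
  rw [h1, extendForm_of_mem _ x.2]
  ext v
  refine congrArg (α x) (funext fun i => ?_)
  exact (congrArg (fun A : E →L[ℝ] E => A (v i)) h2).symm

section Mul

variable [IsManifold 𝓘(ℝ, E) ∞ M]

variable (𝕜 k) in
/-- Multiplication of forms by a smooth function. -/
def formMul (f : C^∞⟮𝓘(ℝ, E), M; 𝓘(ℝ, ℝ), ℝ⟯) : formSheaf 𝕜 E M k ⟶ formSheaf 𝕜 E M k :=
  ⟨{ app := fun U => ModuleCat.ofHom
      { toFun := fun α => ⟨fun x => f (x : M) • α.1 x, fun e he => by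
          have h1 : ContDiffOn ℝ ∞ (f ∘ e.symm) e.target :=
            contMDiffOn_iff_contDiffOn.1 (f.contMDiff.comp_contMDiffOn
              (contMDiffOn_symm_of_mem_maximalAtlas (IsManifold.subset_maximalAtlas he)))
          have h2 := (h1.mono Set.inter_subset_left).smul (α.2 e he)
          exact (chartRep_mul (U := U.unop) f e α.1).symm ▸ h2⟩
        map_add' := fun α β => Subtype.ext (funext fun x => smul_add (f (x : M)) _ _)
        map_smul' := fun c α => Subtype.ext (funext fun x => smul_comm (f (x : M)) c (α.1 x)) }
     naturality := fun _ _ _ => rfl }⟩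

lemma formMul_eq_zero {f : C^∞⟮𝓘(ℝ, E), M; 𝓘(ℝ, ℝ), ℝ⟯} {U : Opens (TopCat.of M)}
    (h : ∀ x ∈ U, f x = 0) (α : Sec (formSheaf 𝕜 E M k).presheaf U) :
    app (formMul 𝕜 k f).hom U α = 0 := by
  refine Subtype.ext (funext fun x => ContinuousAlternatingMap.ext fun v => ?_)
  exact (congrArg (· • (show FormAt 𝕜 E k (x : M) from α.1 x) v) (h x x.2)).trans
    (zero_smul ℝ ((show FormAt 𝕜 E k (x : M) from α.1 x) v))

/-- Multiplication by the functions of a smooth partition of unity shows that sheaves of forms are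
fine. -/
theorem isFine_formSheaf [FiniteDimensional ℝ E] [T2Space M] [SigmaCompactSpace M] (k : ℕ) :
    IsFine (formSheaf 𝕜 E M k) := by
  classical
  intro U hU
  obtain ⟨f, hf⟩ := SmoothPartitionOfUnity.exists_isSubordinate 𝓘(ℝ, E) (s := (Set.univ : Set M))
    isClosed_univ (fun x : M => (U x : Set M)) (fun x => (U x).2)
    (fun x _ => Set.mem_iUnion.2 ⟨x, hU x⟩)
  refine ⟨⟨fun i => formMul 𝕜 k (f i), fun i x hx => ?_, fun x => ?_⟩⟩
  · refine ⟨⟨(tsupport (f i))ᶜ, (isClosed_tsupport _).isOpen_compl⟩, fun h => hx (hf i h), ?_⟩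
    intro V hV α
    exact formMul_eq_zero (fun y hy => image_eq_zero_of_notMem_tsupport (hV hy)) α
  · obtain ⟨W, hW, hfin⟩ := f.locallyFinite x
    obtain ⟨W', hW'W, hW', hxW'⟩ := mem_nhds_iff.1 hW
    have h0 : ∀ i ∉ hfin.toFinset, ∀ y ∈ W', f i y = 0 := fun i hi y hy => by
      by_contra h
      exact hi (hfin.mem_toFinset.2 ⟨y, h, hW'W hy⟩)
    refine ⟨⟨W', hW'⟩, hxW', hfin.toFinset, fun i hi V hV α => ?_, fun V hV α => ?_⟩
    · exact formMul_eq_zero (fun y hy => h0 i hi y (hV hy)) α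
    · have hsum : ∀ y : V, ∑ i ∈ hfin.toFinset, f i (y : M) = 1 := fun y => by
        rw [← finsum_eq_sum_of_support_subset _ (fun i hi => ?_)]
        · exact f.sum_eq_one (Set.mem_univ _)
        · by_contra h
          exact hi (h0 i h _ (hV y.2))
      rw [← appHom_apply, map_sub, map_sum]
      refine sub_eq_zero.2 (Subtype.ext (funext fun y => ?_))
      let ev : Sec (formSheaf 𝕜 E M k).presheaf V →+ FormAt 𝕜 E k (y : M) :=
        { toFun := fun β => β.1 y, map_zero' := rfl, map_add' := fun _ _ => rfl }
      change ev _ = α.1 y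
      rw [LinearMap.sum_apply, map_sum]
      change ∑ i ∈ hfin.toFinset, f i (y : M) • α.1 y = α.1 y
      rw [← Finset.sum_smul, hsum, one_smul]

end Mul

end FineForms

section FormsExact

open scoped Manifold ContDiff Topology

variable {𝕜 : Type} [RCLike 𝕜] {E : Type} [NormedAddCommGroup E] [NormedSpace ℝ E]
  {M : Type} [TopologicalSpace M] [ChartedSpace E M] {k : ℕ}

/-- The pullback to the manifold, along a chart, of a form on the model space. -/
def chartPullback (e : OpenPartialHomeomorph M E) (V : Opens M) (β : E → E [⋀^Fin k]→L[ℝ] 𝕜)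
    (x : V) : FormAt 𝕜 E k (x : M) :=
  (β (e x)).compContinuousLinearMap
    (mfderiv 𝓘(ℝ, E) 𝓘(ℝ, E) e (x : M) : TangentSpace 𝓘(ℝ, E) (x : M) →L[ℝ] E)

lemma constantToForms_injective (U : Opens (TopCat.of M)) :
    Function.Injective (app (constantToForms 𝕜 E M).hom U) := fun _ _ h =>
  Subtype.ext (funext fun x =>
    congrArg (fun t : FormAt 𝕜 E 0 (x : M) => t 0) (congrFun (congrArg Subtype.val h) x))

variable [IsManifold 𝓘(ℝ, E) ∞ M]

lemma chartRep_chartPullback {e : OpenPartialHomeomorph M E} (he : e ∈ atlas E M) {V : Opens M}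
    (β : E → E [⋀^Fin k]→L[ℝ] 𝕜) {y : E} (hy : y ∈ e.target) (hyV : e.symm y ∈ V) :
    chartRep e (chartPullback e V β) y = β y := by
  have he' : e.MDifferentiable 𝓘(ℝ, E) 𝓘(ℝ, E) :=
    ⟨fun z hz => (mdifferentiableAt_chart he hz).mdifferentiableWithinAt,
      fun z hz => (mdifferentiableAt_chart_symm he hz).mdifferentiableWithinAt⟩
  have h2 := he'.comp_symm_deriv hy
  rw [chartRep, extendForm_of_mem _ hyV]
  ext v
  change β (e (e.symm y)) _ = _
  rw [e.right_inv hy]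
  refine congrArg (β y) (funext fun i => ?_)
  exact congrArg (fun A : E →L[ℝ] E => A (v i)) h2

lemma isSmoothForm_chartPullback {e : OpenPartialHomeomorph M E} (he : e ∈ atlas E M) {V : Opens M}
    (hV : (V : Set M) ⊆ e.source) {β : E → E [⋀^Fin k]→L[ℝ] 𝕜} (hβ : ContDiff ℝ ∞ β) :
    IsSmoothForm (chartPullback e V β) := by
  intro e' he' y hy
  have hev : chartRep e' (chartPullback e V β) =ᶠ[𝓝 y] fun z =>
      ContinuousAlternatingMap.compContinuousLinearMapCLM (fderiv ℝ (e ∘ e'.symm) z)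
        (β ((e ∘ e'.symm) z)) := by
    filter_upwards [(isOpen_chartDomain e' V).mem_nhds hy] with z hz
    have hz' : e'.symm z ∈ e.source := hV hz.2
    have h : chartRep e (chartPullback e V β) ((e ∘ e'.symm) z) = β ((e ∘ e'.symm) z) :=
      chartRep_chartPullback he _ (e.map_source hz')
        (by rw [Function.comp_apply, e.left_inv hz']; exact hz.2)
    rw [chartRep_transition he' he _ hz.1 hz', h]
    rfl
  have hτ := contDiffAt_transition he' he hy.1 (hV hy.2)
  have h1 : ContDiffAt ℝ ∞ (fun z => (ContinuousAlternatingMap.compContinuousLinearMapCLM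
      (fderiv ℝ (e ∘ e'.symm) z) : (E [⋀^Fin k]→L[ℝ] 𝕜) →L[ℝ] (E [⋀^Fin k]→L[ℝ] 𝕜))) y :=
    (contDiff_compContinuousLinearMapCLM k).contDiffAt.comp y
      (hτ.fderiv_right (m := ∞) (by simp))
  exact ((h1.clm_apply (hβ.contDiffAt.comp y hτ)).congr_of_eventuallyEq hev).contDiffWithinAt

/-- The domain in the manifold of a ball in a chart. -/
def chartBall (e : OpenPartialHomeomorph M E) (c : E) (r : ℝ) : Opens M :=
  ⟨e.source ∩ e ⁻¹' Metric.ball c r, e.isOpen_inter_preimage Metric.isOpen_ball⟩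

lemma extDeriv_chartRep_eq_zero {U : Opens M} {α : ∀ x : U, FormAt 𝕜 E k (x : M)}
    (hα : IsSmoothForm α) (h0 : extDerivForm α = 0) {e : OpenPartialHomeomorph M E}
    (he : e ∈ atlas E M) {y : E} (hy : y ∈ e.target ∩ e.symm ⁻¹' U) :
    extDeriv (chartRep e α) y = 0 := by
  rw [← chartRep_extDerivForm hα he hy.1 hy.2, h0, chartRep_zero]
  rfl

/-- The Poincaré lemma: the complex of sheaves of forms is exact in positive degrees. -/
theorem locExact_formD [FiniteDimensional ℝ E] (k : ℕ) :
    LocExact (formD 𝕜 E M k).hom (formD 𝕜 E M (k + 1)).hom := by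
  intro U α hα x hx
  let e := chartAt E (x : M)
  have he : e ∈ atlas E M := chart_mem_atlas E (x : M)
  have hxe : (x : M) ∈ e.source := mem_chart_source E (x : M)
  have hsm : IsSmoothForm (U := U) α.1 := α.2
  have hcl : extDerivForm (U := U) α.1 = 0 := congrArg Subtype.val hα
  obtain ⟨r, β, hr, hrW, hβ, hβα⟩ := exists_extDeriv_eq (isOpen_chartDomain e U) (hsm e he)
    (fun y hy => extDeriv_chartRep_eq_zero hsm hcl he hy) (c := e x)
    ⟨e.map_source hxe, by rw [Set.mem_preimage, e.left_inv hxe]; exact hx⟩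
  have hVU : chartBall e (e x) r ≤ U := fun y hy => by
    have := (hrW hy.2).2
    rwa [Set.mem_preimage, e.left_inv hy.1] at this
  have hVe : (chartBall e (e x) r : Set M) ⊆ e.source := fun y hy => hy.1
  have hsm' := isSmoothForm_chartPullback he hVe hβ
  refine ⟨chartBall e (e x) r, hVU, ⟨hxe, Metric.mem_ball_self hr⟩,
    ⟨chartPullback e (chartBall e (e x) r) β, hsm'⟩, Subtype.ext (funext fun y => ?_)⟩
  change extDerivForm (chartPullback e (chartBall e (e x) r) β) y = α.1 ⟨y, hVU y.2⟩
  have hy : e y ∈ e.target := e.map_source y.2.1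
  have hyV : e.symm (e y) ∈ chartBall e (e x) r := by rw [e.left_inv y.2.1]; exact y.2
  have hev : chartRep e (chartPullback e (chartBall e (e x) r) β) =ᶠ[𝓝 (e y)] β := by
    filter_upwards [(isOpen_chartDomain e (chartBall e (e x) r)).mem_nhds ⟨hy, hyV⟩] with z hz
    exact chartRep_chartPullback he β hz.1 hz.2
  rw [eq_pullback_chartRep he (extDerivForm _) y y.2.1,
    chartRep_extDerivForm hsm' he hy hyV, hev.extDeriv_eq, hβα _ y.2.2]
  exact (eq_pullback_chartRep he (U := U) α.1 ⟨y, hVU y.2⟩ y.2.1).symm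

lemma fderiv_eq_zero_of_extDeriv_eq_zero {F : Type} [NormedAddCommGroup F] [NormedSpace ℝ F]
    {α : E → E [⋀^Fin 0]→L[ℝ] F} {y : E} (h : extDeriv α y = 0) : fderiv ℝ α y = 0 := by
  ext u v
  have h1 := congrArg (fun t => t (fun _ => u)) h
  change ContinuousAlternatingMap.alternatizeUncurryFin (fderiv ℝ α y) (fun _ => u) = 0 at h1
  rw [ContinuousAlternatingMap.alternatizeUncurryFin_apply, Fin.sum_univ_one] at h1
  rw [Subsingleton.elim v ((0 : Fin 1).removeNth fun _ => u)]
  simpa using h1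

/-- Functions with vanishing differential are locally constant. -/
theorem locExact_constantToForms :
    LocExact (constantToForms 𝕜 E M).hom (formD 𝕜 E M 0).hom := by
  intro U α hα x hx
  let e := chartAt E (x : M)
  have he : e ∈ atlas E M := chart_mem_atlas E (x : M)
  have hxe : (x : M) ∈ e.source := mem_chart_source E (x : M)
  have hsm : IsSmoothForm (U := U) α.1 := α.2
  have hcl : extDerivForm (U := U) α.1 = 0 := congrArg Subtype.val hα
  obtain ⟨r, hr, hrW⟩ := Metric.isOpen_iff.1 (isOpen_chartDomain e U) (e x)
    ⟨e.map_source hxe, by rw [Set.mem_preimage, e.left_inv hxe]; exact hx⟩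
  have hVU : chartBall e (e x) r ≤ U := fun y hy => by
    have := (hrW hy.2).2
    rwa [Set.mem_preimage, e.left_inv hy.1] at this
  have hconst : ∀ y ∈ Metric.ball (e x) r,
      chartRep e (U := U) α.1 y = chartRep e (U := U) α.1 (e x) := fun y hy =>
    Metric.isOpen_ball.is_const_of_fderiv_eq_zero (𝕜 := ℝ) (convex_ball _ _).isPreconnected
      (((hsm e he).mono hrW).differentiableOn (by simp))
      (fun z hz => fderiv_eq_zero_of_extDeriv_eq_zero
        (extDeriv_chartRep_eq_zero hsm hcl he (hrW hz))) hy (Metric.mem_ball_self hr)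
  let c : 𝕜 := chartRep e (U := U) α.1 (e x) 0
  refine ⟨chartBall e (e x) r, hVU, ⟨hxe, Metric.mem_ball_self hr⟩,
    ⟨fun _ => c, IsLocallyConstant.const c⟩, Subtype.ext (funext fun y => ?_)⟩
  change constantForm 𝕜 E M (U := chartBall e (e x) r) (fun _ => c) y = α.1 ⟨y, hVU y.2⟩
  refine Eq.trans ?_ (eq_pullback_chartRep he (U := U) α.1 ⟨y, hVU y.2⟩ y.2.1).symm
  rw [hconst _ y.2.2]
  ext v
  exact congrArg (chartRep e (U := U) α.1 (e x)) (Subsingleton.elim _ _)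

lemma deRhamSheaf_d (k : ℕ) : (deRhamSheaf 𝕜 E M).d k (k + 1) = formD 𝕜 E M k :=
  CochainComplex.of_d (formSheaf 𝕜 E M) (formD 𝕜 E M) k

theorem isIso_sheafToDeRhamHyper [FiniteDimensional ℝ E] (k : ℕ) :
    IsIso (sheafToDeRhamHyper 𝕜 E M k) := by
  refine isIso_sheafToHyper _ _ constantToForms_injective ?_ (fun n => ?_) k
  · rw [deRhamSheaf_d]
    exact locExact_constantToForms
  · rw [deRhamSheaf_d, deRhamSheaf_d]
    exact locExact_formD n

theorem isIso_deRhamToHyper [FiniteDimensional ℝ E] [T2Space M] [SigmaCompactSpace M] (k : ℕ) :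
    IsIso (deRhamToHyper 𝕜 E M k) :=
  isIso_sectionsToHyper (fun q => isFine_formSheaf q) k

end FormsExact

/-! ### Sheafification and singular cochains -/

section Sheafification

variable {R : Type} [CommRing R] {X : TopCat.{0}} {P Q S : TopCat.Presheaf (ModuleCat.{0} R) X}

lemma exists_sheafificationUnit_eq {U : Opens X}
    (s : Sec ((sheafification R X).obj P).presheaf U) {x : X} (hx : x ∈ U) :
    ∃ (V : Opens X) (hV : V ≤ U), x ∈ V ∧ ∃ t, app (sheafificationUnit R P) V t = res _ hV s := by
  have h : TopCat.Presheaf.IsLocallySurjective (sheafificationUnit R P) :=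
    inferInstanceAs (Presheaf.IsLocallySurjective (Opens.grothendieckTopology X)
      (toSheafify (Opens.grothendieckTopology X) P))
  obtain ⟨V, hV, hx, ht⟩ := h.imageSieve_mem s x hx
  exact ⟨V, hV.le, ht, hx⟩

lemma exists_res_eq_zero_of_sheafificationUnit {U : Opens X} (t : Sec P U)
    (h : app (sheafificationUnit R P) U t = 0) {x : X} (hx : x ∈ U) :
    ∃ (V : Opens X) (hV : V ≤ U), x ∈ V ∧ res P hV t = 0 := by
  have h' : Presheaf.IsLocallyInjective (Opens.grothendieckTopology X) (sheafificationUnit R P) :=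
    inferInstanceAs (Presheaf.IsLocallyInjective (Opens.grothendieckTopology X)
      (toSheafify (Opens.grothendieckTopology X) P))
  obtain ⟨V, hV, ht, hx⟩ := h'.equalizerSieve_mem (X := op U) t (0 : Sec P U)
    (h.trans (map_zero (app (sheafificationUnit R P) U)).symm) x hx
  exact ⟨V, hV.le, hx, ht.trans (map_zero (res P hV.le))⟩

lemma app_sheafification_map (f : P ⟶ Q) {U : Opens X} (t : Sec P U) :
    app ((sheafification R X).map f).hom U (app (sheafificationUnit R P) U t) =
      app (sheafificationUnit R Q) U (app f U t) :=
  congrArg (fun m => app m U t) (sheafificationUnit_naturality R f).symm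

/-- Sheafification preserves local exactness. The first term is left unsheafified: the local primitives
already come from it. -/
lemma LocExact.sheafificationUnit {f : P ⟶ Q} {g : Q ⟶ S} (h : LocExact f g) :
    LocExact (f ≫ DeRham.sheafificationUnit R Q) ((sheafification R X).map g).hom := by
  intro U s hs x hx
  obtain ⟨V, hV, hxV, t, ht⟩ := exists_sheafificationUnit_eq s hx
  obtain ⟨V', hV', hxV', ht'⟩ := exists_res_eq_zero_of_sheafificationUnit (app g V t) (by
    rw [← app_sheafification_map, ht, app_res, hs, map_zero]) hxV
  obtain ⟨W, hW, hxW, u, hu⟩ := h V' (res Q hV' t) (by rw [app_res, ht']) x hxV'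
  refine ⟨W, hW.trans (hV'.trans hV), hxW, u, ?_⟩
  rw [app_comp, hu, app_res, app_res, ht, res_res, res_res]

lemma LocExact.sheafification {f : P ⟶ Q} {g : Q ⟶ S} (h : LocExact f g) :
    LocExact ((DeRham.sheafification R X).map f).hom ((DeRham.sheafification R X).map g).hom := by
  intro U s hs x hx
  obtain ⟨V, hV, hxV, t, ht⟩ := h.sheafificationUnit U s hs x hx
  exact ⟨V, hV, hxV, app (DeRham.sheafificationUnit R P) V t,
    (app_sheafification_map f t).trans ht⟩

lemma zeroOn_sheafification {f : P ⟶ Q} {W : Opens X}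
    (h : ∀ V ≤ W, ∀ t : Sec P V, app f V t = 0) : ZeroOn ((sheafification R X).map f) W := by
  intro V hV s
  refine sec_ext fun x hx => ?_
  obtain ⟨V', hV', hxV', t, ht⟩ := exists_sheafificationUnit_eq s hx
  refine ⟨V', hV', hxV', ?_⟩
  rw [← app_res, ← ht, app_sheafification_map, h V' (hV'.trans hV), map_zero, map_zero]

end Sheafification

section Cochains

variable (R : Type) [CommRing R] (X : TopCat.{0})

/-- Singular simplices as continuous maps. -/
abbrev Simplex (X : TopCat.{0}) (q : ℕ) : Type := C(stdSimplex ℝ (Fin (q + 1)), X)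

/-- Singular cochains as functions on continuous maps. -/
abbrev Cochain (q : ℕ) : Type := Simplex X q → R

/-- The inclusion of a face of the standard simplex. -/
def faceMap {q : ℕ} (i : Fin (q + 2)) :
    C(stdSimplex ℝ (Fin (q + 1)), stdSimplex ℝ (Fin (q + 2))) :=
  ⟨stdSimplex.map i.succAbove, stdSimplex.continuous_map _⟩

variable {R X}

/-- The coboundary of a singular cochain. -/
def coboundary {q : ℕ} (g : Cochain R X q) : Cochain R X (q + 1) := fun σ =>
  ∑ i : Fin (q + 2), (-1 : ℤ) ^ (i : ℕ) • g (σ.comp (faceMap i))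

/-- A simplex has image in an open set. -/
def SmallIn {q : ℕ} (σ : Simplex X q) (U : Opens X) : Prop := ∀ p, σ p ∈ U

lemma SmallIn.comp {q r : ℕ} {σ : Simplex X q} {U : Opens X} (h : SmallIn σ U)
    (f : C(stdSimplex ℝ (Fin (r + 1)), stdSimplex ℝ (Fin (q + 1)))) : SmallIn (σ.comp f) U :=
  fun p => h (f p)

lemma SmallIn.mono {q : ℕ} {σ : Simplex X q} {U V : Opens X} (h : SmallIn σ U) (hUV : U ≤ V) :
    SmallIn σ V := fun p => hUV (h p)

/-- The continuous map underlying a simplex of an open subset. -/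
def toSimplex {U : Opens X} {q : ℕ}
    (τ : (TopCat.toSSet.obj ((Opens.toTopCat X).obj U)).obj (op (SimplexCategory.mk q))) :
    Simplex X q :=
  ContinuousMap.comp ⟨Subtype.val, continuous_subtype_val⟩
    (TopCat.toSSetObjEquiv ((Opens.toTopCat X).obj U) _ τ)

lemma smallIn_toSimplex {U : Opens X} {q : ℕ}
    (τ : (TopCat.toSSet.obj ((Opens.toTopCat X).obj U)).obj (op (SimplexCategory.mk q))) :
    SmallIn (toSimplex τ) U := fun p =>
  (show (U : Set X) from TopCat.toSSetObjEquiv ((Opens.toTopCat X).obj U) _ τ p).2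

/-- A simplex of an open subset from a simplex with image in this subset. -/
def ofSimplex {U : Opens X} {q : ℕ} (σ : Simplex X q) (h : SmallIn σ U) :
    (TopCat.toSSet.obj ((Opens.toTopCat X).obj U)).obj (op (SimplexCategory.mk q)) :=
  (TopCat.toSSetObjEquiv ((Opens.toTopCat X).obj U) (op (SimplexCategory.mk q))).symm
    (⟨fun p => (⟨σ p, h p⟩ : (U : Set X)), by fun_prop⟩ :
      C(stdSimplex ℝ (Fin (q + 1)), (U : Set X)))

lemma ofSimplex_toSimplex {U : Opens X} {q : ℕ}
    (τ : (TopCat.toSSet.obj ((Opens.toTopCat X).obj U)).obj (op (SimplexCategory.mk q))) :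
    ofSimplex (toSimplex τ) (smallIn_toSimplex τ) = τ := rfl

/-- The restriction of a cochain on `X` to the simplices of an open subset. -/
def cochainMk (U : Opens X) (q : ℕ) : Cochain R X q →ₗ[R] Sec ((cochainPresheaf R X).X q) U where
  toFun g := fun τ => g (toSimplex τ)
  map_add' _ _ := rfl
  map_smul' _ _ := rfl

lemma cochainMk_surjective (U : Opens X) (q : ℕ) :
    Function.Surjective (cochainMk (R := R) U q) := by
  classical
  intro t
  refine ⟨fun σ => if h : SmallIn σ U then t (ofSimplex σ h) else 0, funext fun τ => ?_⟩
  exact (dif_pos (smallIn_toSimplex τ)).trans (congrArg t (ofSimplex_toSimplex τ))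

lemma res_cochainMk {U V : Opens X} (h : V ≤ U) {q : ℕ} (g : Cochain R X q) :
    res _ h (cochainMk U q g) = cochainMk V q g := rfl

lemma cochainMk_eq_zero_iff {U : Opens X} {q : ℕ} {g : Cochain R X q} :
    cochainMk U q g = 0 ↔ ∀ σ, SmallIn σ U → g σ = 0 :=
  ⟨fun h σ hσ => congrFun h (ofSimplex σ hσ), fun h => funext fun τ => h _ (smallIn_toSimplex τ)⟩

lemma singularCochains_d_apply (Y : TopCat.{0}) (q : ℕ)
    (g : ((singularCochains R).obj (op Y)).X q)
    (τ : (TopCat.toSSet.obj Y).obj (op (SimplexCategory.mk (q + 1)))) :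
    (((singularCochains R).obj (op Y)).d q (q + 1)).hom g τ = ∑ i : Fin (q + 2),
      (-1 : ℤ) ^ (i : ℕ) • (show _ → R from g)
        ((TopCat.toSSet.obj Y).map (SimplexCategory.δ i).op τ) := by
  have h : ((singularCochains R).obj (op Y)).d q (q + 1) =
      AlgebraicTopology.AlternatingCofaceMapComplex.objD ((singularCosimplicial R).obj (op Y)) q :=
    CochainComplex.of_d (fun q => ((singularCosimplicial R).obj (op Y)).obj (SimplexCategory.mk q))
      _ q
  let A : SimplexCategory ⥤ ModuleCat.{0} R := (singularCosimplicial R).obj (op Y)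
  let ev : (A.obj (SimplexCategory.mk q) ⟶ A.obj (SimplexCategory.mk (q + 1))) →+ R :=
    { toFun := fun f => (show _ → R from f.hom g) τ
      map_zero' := rfl
      map_add' := fun _ _ => rfl }
  refine (congrArg ev h).trans ((map_sum ev _ _).trans (Finset.sum_congr rfl fun i _ => ?_))
  exact map_zsmul ev _ _

lemma cochainPresheaf_d_cochainMk (U : Opens X) {q : ℕ} (g : Cochain R X q) :
    app ((cochainPresheaf R X).d q (q + 1)) U (cochainMk U q g) =
      cochainMk U (q + 1) (coboundary g) :=
  funext fun τ => singularCochains_d_apply ((Opens.toTopCat X).obj U) q (cochainMk U q g) τ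

/-- Local exactness of the presheaves of cochains, in terms of cochains on the whole space. -/
lemma locExact_cochainPresheaf {q : ℕ}
    (h : ∀ (U : Opens X) (x : X), x ∈ U → ∃ V ≤ U, x ∈ V ∧ ∀ g : Cochain R X (q + 1),
      (∀ σ, SmallIn σ V → coboundary g σ = 0) →
        ∃ g' : Cochain R X q, ∀ σ, SmallIn σ V → coboundary g' σ = g σ) :
    LocExact ((cochainPresheaf R X).d q (q + 1))
      ((cochainPresheaf R X).d (q + 1) (q + 1 + 1)) := by
  intro U s hs x hx
  obtain ⟨g, rfl⟩ := cochainMk_surjective U (q + 1) s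
  rw [cochainPresheaf_d_cochainMk, cochainMk_eq_zero_iff] at hs
  obtain ⟨V, hV, hxV, hex⟩ := h U x hx
  obtain ⟨g', hg'⟩ := hex g fun σ hσ => hs σ (hσ.mono hV)
  refine ⟨V, hV, hxV, cochainMk V q g', ?_⟩
  rw [cochainPresheaf_d_cochainMk, res_cochainMk]
  refine sub_eq_zero.1 ?_
  rw [← map_sub, cochainMk_eq_zero_iff]
  exact fun σ hσ => sub_eq_zero.2 (hg' σ hσ)

end Cochains

/-! ### Cones in charts -/

section Cone

variable {E : Type} [NormedAddCommGroup E] {q : ℕ}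

lemma faceMap_apply_self (i : Fin (q + 2)) (p : stdSimplex ℝ (Fin (q + 1))) :
    faceMap i p i = 0 := by
  change stdSimplex.map i.succAbove p i = 0
  rw [stdSimplex.map_coe, FunOnFinite.linearMap_apply_apply]
  exact Finset.sum_eq_zero fun j hj =>
    absurd (Finset.mem_filter.1 hj).2 (Fin.succAbove_ne i j)

lemma faceMap_apply_succAbove (i : Fin (q + 2)) (p : stdSimplex ℝ (Fin (q + 1)))
    (j : Fin (q + 1)) : faceMap i p (i.succAbove j) = p j := by
  change stdSimplex.map i.succAbove p (i.succAbove j) = p j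
  rw [stdSimplex.map_coe, FunOnFinite.linearMap_apply_apply]
  refine (Finset.sum_eq_single_of_mem j (by simp) fun k hk hkj => ?_)
  exact absurd (Fin.succAbove_right_injective (Finset.mem_filter.1 hk).2) hkj

/-- The extension by zero of a function on the standard simplex. -/
def simplexExtend (f : stdSimplex ℝ (Fin (q + 1)) → E) (v : Fin (q + 1) → ℝ) : E :=
  open scoped Classical in if h : v ∈ stdSimplex ℝ (Fin (q + 1)) then f ⟨v, h⟩ else 0

lemma simplexExtend_coe (f : stdSimplex ℝ (Fin (q + 1)) → E) (p : stdSimplex ℝ (Fin (q + 1))) :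
    simplexExtend f p = f p := dif_pos p.2

lemma continuousOn_simplexExtend {f : stdSimplex ℝ (Fin (q + 1)) → E} (hf : Continuous f) :
    ContinuousOn (simplexExtend f) (stdSimplex ℝ (Fin (q + 1))) := by
  rw [continuousOn_iff_continuous_domRestrict]
  exact hf.congr fun p => (simplexExtend_coe f p).symm

lemma normalize_tail_mem (p : stdSimplex ℝ (Fin (q + 2))) (hp : p 0 ≠ 1) :
    (1 - p 0)⁻¹ • Fin.tail (p : Fin (q + 2) → ℝ) ∈ stdSimplex ℝ (Fin (q + 1)) := by
  have h1 : 0 < 1 - p 0 := sub_pos.2 (lt_of_le_of_ne (stdSimplex.le_one p 0) hp)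
  refine ⟨fun i => mul_nonneg (inv_nonneg.2 h1.le) (stdSimplex.zero_le p i.succ), ?_⟩
  have h2 := stdSimplex.sum_eq_one p
  rw [Fin.sum_univ_succ] at h2
  have h3 : ∑ i : Fin (q + 1), Fin.tail (p : Fin (q + 2) → ℝ) i = 1 - p 0 := by
    rw [← h2, add_sub_cancel_left]
    rfl
  simp only [Pi.smul_apply, smul_eq_mul]
  rw [← Finset.mul_sum, h3, inv_mul_cancel₀ h1.ne']

variable [NormedSpace ℝ E]

/-- The cone with apex `c` over a map from a standard simplex to a vector space: the point with
coordinates `t, (1 - t) s` goes to `t c + (1 - t) f s`. -/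
def coneFun (c : E) (f : stdSimplex ℝ (Fin (q + 1)) → E) (p : stdSimplex ℝ (Fin (q + 2))) : E :=
  c + (1 - p 0) • simplexExtend (fun s => f s - c) ((1 - p 0)⁻¹ • Fin.tail (p : Fin (q + 2) → ℝ))

lemma coneFun_of_eq_one (c : E) (f : stdSimplex ℝ (Fin (q + 1)) → E)
    {p : stdSimplex ℝ (Fin (q + 2))} (hp : p 0 = 1) : coneFun c f p = c := by
  rw [coneFun, hp, sub_self, zero_smul, add_zero]

lemma coneFun_of_ne_one (c : E) (f : stdSimplex ℝ (Fin (q + 1)) → E)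
    {p : stdSimplex ℝ (Fin (q + 2))} (hp : p 0 ≠ 1) :
    coneFun c f p = c + (1 - p 0) • (f ⟨_, normalize_tail_mem p hp⟩ - c) := by
  rw [coneFun, simplexExtend, dif_pos (normalize_tail_mem p hp)]

lemma continuous_coneFun (c : E) {f : stdSimplex ℝ (Fin (q + 1)) → E} (hf : Continuous f) :
    Continuous (coneFun c f) := by
  have h0 : Continuous fun p : stdSimplex ℝ (Fin (q + 2)) => p 0 :=
    (continuous_apply 0).comp continuous_subtype_val
  refine continuous_iff_continuousAt.2 fun p => ?_
  by_cases hp : p 0 = 1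
  · obtain ⟨C, hC⟩ := (isCompact_range (hf.sub (continuous_const (y := c)))).isBounded.exists_norm_le
    have hC' : ∀ v, ‖simplexExtend (fun s => f s - c) v‖ ≤ max C 0 := fun v => by
      rw [simplexExtend]
      split_ifs with h
      · exact (hC _ ⟨_, rfl⟩).trans (le_max_left _ _)
      · rw [norm_zero]
        exact le_max_right _ _
    have h1 : Filter.Tendsto (fun p : stdSimplex ℝ (Fin (q + 2)) => ‖1 - p 0‖ * max C 0)
        (nhds p) (nhds 0) := by
      have h2 : Continuous fun p : stdSimplex ℝ (Fin (q + 2)) => ‖1 - p 0‖ * max C 0 :=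
        (continuous_const.sub h0).norm.mul continuous_const
      have h3 := h2.tendsto p
      rwa [hp, sub_self, norm_zero, zero_mul] at h3
    have h4 := squeeze_zero_norm (fun p => ?_) h1
      (f := fun p : stdSimplex ℝ (Fin (q + 2)) => (1 - p 0) •
        simplexExtend (fun s => f s - c) ((1 - p 0)⁻¹ • Fin.tail (p : Fin (q + 2) → ℝ)))
    · have h5 := (tendsto_const_nhds (x := c)).add h4
      rw [add_zero] at h5
      rw [ContinuousAt, coneFun_of_eq_one c f hp]
      exact h5
    · rw [norm_smul]
      exact mul_le_mul_of_nonneg_left (hC' _) (norm_nonneg _)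
  · have hN : IsOpen {p : stdSimplex ℝ (Fin (q + 2)) | p 0 ≠ 1} := isOpen_ne.preimage h0
    refine ContinuousOn.continuousAt (s := {p : stdSimplex ℝ (Fin (q + 2)) | p 0 ≠ 1}) ?_
      (hN.mem_nhds hp)
    refine continuousOn_const.add ((continuous_const.sub h0).continuousOn.smul ?_)
    refine (continuousOn_simplexExtend (hf.sub continuous_const)).comp ?_
      (fun p hp => normalize_tail_mem p hp)
    refine ContinuousOn.smul ((continuous_const.sub h0).continuousOn.inv₀
      fun p (hp : p 0 ≠ 1) h => hp (sub_eq_zero.1 h).symm) (Continuous.continuousOn ?_)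
    exact continuous_pi fun i => (continuous_apply i.succ).comp continuous_subtype_val

lemma coneFun_mem {c : E} {f : stdSimplex ℝ (Fin (q + 1)) → E} {K : Set E} (hK : Convex ℝ K)
    (hc : c ∈ K) (hf : ∀ p, f p ∈ K) (p : stdSimplex ℝ (Fin (q + 2))) : coneFun c f p ∈ K := by
  by_cases hp : p 0 = 1
  · rwa [coneFun_of_eq_one c f hp]
  · rw [coneFun_of_ne_one c f hp]
    exact hK.add_smul_sub_mem hc (hf _)
      ⟨sub_nonneg.2 (stdSimplex.le_one p 0), sub_le_self _ (stdSimplex.zero_le p 0)⟩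

lemma coneFun_faceMap_zero (c : E) (f : stdSimplex ℝ (Fin (q + 1)) → E)
    (p : stdSimplex ℝ (Fin (q + 1))) : coneFun c f (faceMap 0 p) = f p := by
  have h0 : faceMap 0 p 0 = 0 := faceMap_apply_self 0 p
  have ht : Fin.tail (faceMap 0 p : Fin (q + 2) → ℝ) = p :=
    funext fun i => faceMap_apply_succAbove 0 p i
  rw [coneFun, h0, ht, sub_zero, inv_one, one_smul, one_smul, simplexExtend_coe,
    add_sub_cancel]

lemma coneFun_faceMap_succ (c : E) (f : stdSimplex ℝ (Fin (q + 2)) → E) (i : Fin (q + 2))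
    (p : stdSimplex ℝ (Fin (q + 2))) :
    coneFun c f (faceMap i.succ p) = coneFun c (f ∘ faceMap i) p := by
  have h0 : faceMap i.succ p 0 = p 0 := by
    have := faceMap_apply_succAbove i.succ p 0
    rwa [Fin.succ_succAbove_zero] at this
  by_cases hp : p 0 = 1
  · rw [coneFun_of_eq_one c _ hp, coneFun_of_eq_one c _ (h0.trans hp)]
  · have hp' : faceMap i.succ p 0 ≠ 1 := by rwa [h0]
    rw [coneFun_of_ne_one c _ hp, coneFun_of_ne_one c _ hp', Function.comp_apply]
    refine congrArg₂ (fun t s => c + (1 - t) • (f s - c)) h0 (stdSimplex.ext (funext fun j => ?_))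
    change (1 - faceMap i.succ p 0)⁻¹ * faceMap i.succ p j.succ = faceMap i ⟨_, _⟩ j
    rw [h0]
    obtain rfl | ⟨k, rfl⟩ := Fin.eq_self_or_eq_succAbove i j
    · rw [faceMap_apply_self, faceMap_apply_self, mul_zero]
    · rw [faceMap_apply_succAbove, ← Fin.succ_succAbove_succ, faceMap_apply_succAbove]
      rfl

lemma coneFun_faceMap_one (c : E) (f : stdSimplex ℝ (Fin 1) → E) (p : stdSimplex ℝ (Fin 1)) :
    coneFun c f (faceMap 1 p) = c := by
  refine coneFun_of_eq_one c f ?_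
  have := faceMap_apply_succAbove 1 p 0
  rw [Fin.one_succAbove_zero] at this
  have h1 := stdSimplex.sum_eq_one p
  rw [Fin.sum_univ_one] at h1
  exact this.trans h1

end Cone

section ChartCone

variable {R : Type} [CommRing R] {E : Type} [NormedAddCommGroup E] [NormedSpace ℝ E]
  {M : Type} [TopologicalSpace M] {q : ℕ}

open scoped Classical in
/-- The cone over a simplex in a ball of a chart (of no significance for other simplices). -/
def coneSimplex (e : OpenPartialHomeomorph M E) (c : E) (r : ℝ) (hr : 0 < r)
    (he : Metric.ball c r ⊆ e.target) (σ : Simplex (TopCat.of M) q) :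
    Simplex (TopCat.of M) (q + 1) :=
  if h : SmallIn σ (chartBall e c r) then
    ⟨fun p => e.symm (coneFun c (e ∘ σ) p), e.continuousOn_symm.comp_continuous
      (continuous_coneFun c (e.continuousOn.comp_continuous σ.continuous fun p => (h p).1))
      (fun p => he (coneFun_mem (convex_ball c r) (Metric.mem_ball_self hr) (fun p => (h p).2) p))⟩
  else ContinuousMap.const _ (σ (stdSimplex.vertex 0))

variable {e : OpenPartialHomeomorph M E} {c : E} {r : ℝ} {hr : 0 < r}
  {he : Metric.ball c r ⊆ e.target}

lemma coneSimplex_apply {σ : Simplex (TopCat.of M) q} (h : SmallIn σ (chartBall e c r))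
    (p : stdSimplex ℝ (Fin (q + 2))) :
    coneSimplex e c r hr he σ p = e.symm (coneFun c (e ∘ σ) p) := by
  rw [coneSimplex, dif_pos h]
  rfl

lemma smallIn_coneSimplex {σ : Simplex (TopCat.of M) q} (h : SmallIn σ (chartBall e c r)) :
    SmallIn (coneSimplex e c r hr he σ) (chartBall e c r) := fun p => by
  have h1 : coneFun c (e ∘ σ) p ∈ Metric.ball c r :=
    coneFun_mem (convex_ball c r) (Metric.mem_ball_self hr) (fun p => (h p).2) p
  rw [coneSimplex_apply h]
  refine ⟨e.map_target (he h1), ?_⟩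
  rw [Set.mem_preimage, e.right_inv (he h1)]
  exact h1

lemma coneSimplex_faceMap_zero {σ : Simplex (TopCat.of M) q}
    (h : SmallIn σ (chartBall e c r)) : (coneSimplex e c r hr he σ).comp (faceMap 0) = σ :=
  ContinuousMap.ext fun p => by
    rw [ContinuousMap.comp_apply, coneSimplex_apply h, coneFun_faceMap_zero]
    exact e.left_inv (h p).1

lemma coneSimplex_faceMap_succ {σ : Simplex (TopCat.of M) (q + 1)}
    (h : SmallIn σ (chartBall e c r)) (i : Fin (q + 2)) :
    (coneSimplex e c r hr he σ).comp (faceMap i.succ) =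
      coneSimplex e c r hr he (σ.comp (faceMap i)) :=
  ContinuousMap.ext fun p => by
    rw [ContinuousMap.comp_apply, coneSimplex_apply h, coneFun_faceMap_succ,
      coneSimplex_apply (h.comp _)]
    rfl

/-- Coning off shows that closed cochains of positive degree on a ball of a chart are
coboundaries. -/
lemma exists_coboundary_eq_on_chartBall (hr : 0 < r) (he : Metric.ball c r ⊆ e.target)
    (g : Cochain R (TopCat.of M) (q + 1))
    (hg : ∀ σ, SmallIn σ (chartBall e c r) → coboundary g σ = 0) :
    ∃ g' : Cochain R (TopCat.of M) q,
      ∀ σ, SmallIn σ (chartBall e c r) → coboundary g' σ = g σ := by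
  refine ⟨fun σ => g (coneSimplex e c r hr he σ), fun σ h => ?_⟩
  have h1 := hg _ (smallIn_coneSimplex (hr := hr) (he := he) h)
  rw [coboundary, Fin.sum_univ_succ, coneSimplex_faceMap_zero h, Fin.val_zero, pow_zero,
    one_smul] at h1
  rw [← sub_eq_zero, ← neg_eq_zero, neg_sub, ← h1, sub_eq_add_neg, coboundary,
    ← Finset.sum_neg_distrib]
  refine congrArg (g σ + ·) (Finset.sum_congr rfl fun i _ => ?_)
  rw [coneSimplex_faceMap_succ h, Fin.val_succ, pow_succ, mul_neg, mul_one, neg_smul]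

/-- A closed `0`-cochain on a ball of a chart is constant. -/
lemma eq_const_on_chartBall (hr : 0 < r) (he : Metric.ball c r ⊆ e.target)
    (g : Cochain R (TopCat.of M) 0)
    (hg : ∀ σ, SmallIn σ (chartBall e c r) → coboundary g σ = 0) (σ : Simplex (TopCat.of M) 0)
    (h : SmallIn σ (chartBall e c r)) : g σ = g (ContinuousMap.const _ (e.symm c)) := by
  have h1 := hg _ (smallIn_coneSimplex (hr := hr) (he := he) h)
  have h2 : (coneSimplex e c r hr he σ).comp (faceMap 1) = ContinuousMap.const _ (e.symm c) :=
    ContinuousMap.ext fun p => by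
      rw [ContinuousMap.comp_apply, coneSimplex_apply h, coneFun_faceMap_one]
      rfl
  rw [coboundary, Fin.sum_univ_two, coneSimplex_faceMap_zero h, h2] at h1
  simpa [sub_eq_zero, ← sub_eq_add_neg] using h1

end ChartCone

lemma exists_chartBall_le {E M : Type} [NormedAddCommGroup E] [TopologicalSpace M]
    [ChartedSpace E M] (U : Opens M) {x : M} (hx : x ∈ U) :
    ∃ r, 0 < r ∧ Metric.ball (chartAt E x x) r ⊆ (chartAt E x).target ∧
      chartBall (chartAt E x) (chartAt E x x) r ≤ U := by
  have hxe := mem_chart_source E x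
  obtain ⟨r, hr, hrW⟩ := Metric.isOpen_iff.1 (isOpen_chartDomain (chartAt E x) U) (chartAt E x x)
    ⟨(chartAt E x).map_source hxe, by rwa [Set.mem_preimage, (chartAt E x).left_inv hxe]⟩
  refine ⟨r, hr, fun y hy => (hrW hy).1, fun y hy => ?_⟩
  have := (hrW hy.2).2
  rwa [Set.mem_preimage, (chartAt E x).left_inv hy.1] at this

/-- The complex of sheaves of singular cochains is a resolution of the constant sheaf. -/
theorem isIso_sheafToSingularHyper (R : Type) [CommRing R] (E : Type) [NormedAddCommGroup E]
    [NormedSpace ℝ E] (M : Type) [TopologicalSpace M] [ChartedSpace E M] (k : ℕ) :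
    IsIso (sheafToSingularHyper R (TopCat.of M) k) := by
  have h0 : ∀ U : Opens (TopCat.of M), ∀ f,
      app (constantToCochainPresheaf R (TopCat.of M)) U f = 0 → f = 0 := fun U f hf => by
    refine Subtype.ext (funext fun x => ?_)
    exact congrFun hf (ofSimplex (ContinuousMap.const _ (x : M)) fun _ => x.2)
  refine isIso_sheafToHyper _ _ (fun U => ?_) ?_ (fun n => ?_) k
  · refine (injective_iff_map_eq_zero _).2 fun f hf => sec_ext fun x hx => ?_
    obtain ⟨V, hV, hxV, hf'⟩ := exists_res_eq_zero_of_sheafificationUnit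
      (app (constantToCochainPresheaf R (TopCat.of M)) U f) hf hx
    refine ⟨V, hV, hxV, ?_⟩
    rw [map_zero]
    exact h0 V _ ((app_res _ _ _).trans hf')
  · refine LocExact.sheafificationUnit (f := constantToCochainPresheaf R (TopCat.of M))
      (g := (cochainPresheaf R (TopCat.of M)).d 0 1) fun U s hs x hx => ?_
    obtain ⟨g, rfl⟩ := cochainMk_surjective U 0 s
    rw [cochainPresheaf_d_cochainMk, cochainMk_eq_zero_iff] at hs
    obtain ⟨r, hr, he, hle⟩ := exists_chartBall_le (E := E) U hx
    refine ⟨chartBall (chartAt E x) (chartAt E x x) r, hle,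
      ⟨mem_chart_source E x, Metric.mem_ball_self hr⟩,
      ⟨fun _ => g (ContinuousMap.const _ ((chartAt E x).symm (chartAt E x x))),
        IsLocallyConstant.const _⟩, funext fun τ => ?_⟩
    exact (eq_const_on_chartBall hr he g (fun σ hσ => hs σ (hσ.mono hle)) _
      (smallIn_toSimplex τ)).symm
  · refine (locExact_cochainPresheaf fun U x hx => ?_).sheafification
    obtain ⟨r, hr, he, hle⟩ := exists_chartBall_le (E := E) U hx
    exact ⟨_, hle, ⟨mem_chart_source E x, Metric.mem_ball_self hr⟩,
      exists_coboundary_eq_on_chartBall hr he⟩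

/-! ### Fineness of the sheaves of cochains -/

section FineCochains

variable {R : Type} [CommRing R] {X : TopCat.{0}} {q : ℕ}

/-- A covering of a paracompact space has a locally finite shrinking; `i y` chooses a member which
contains `y`. -/
lemma exists_shrinking [T2Space X] [ParacompactSpace X] (U : X → Opens X) (hU : ∀ x, x ∈ U x) :
    ∃ (w : X → Set X) (i : X → X), LocallyFinite w ∧ (∀ c, closure (w c) ⊆ U c) ∧
      ∀ y, y ∈ w (i y) := by
  obtain ⟨v, hv, hcov, hfin, hvU⟩ := precise_refinement (fun x => (U x : Set X))
    (fun x => (U x).2) (Set.eq_univ_of_forall fun x => Set.mem_iUnion.2 ⟨x, hU x⟩)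
  obtain ⟨w, hw, -, hwv⟩ := exists_iUnion_eq_closure_subset hv (fun x => hfin.point_finite x) hcov
  choose i hi using fun y => Set.mem_iUnion.1 (hw.ge (Set.mem_univ y))
  exact ⟨w, i, hfin.subset fun c => subset_closure.trans (hwv c),
    fun c => (hwv c).trans (hvU c), hi⟩

open scoped Classical in
variable (R) in
/-- Restriction of functions to a subset, followed by extension by zero. -/
def restrictLinear {ι : Type} (A : Set ι) : (ι → R) →ₗ[R] (ι → R) where
  toFun t τ := if τ ∈ A then t τ else 0
  map_add' s t := by ext τ; by_cases h : τ ∈ A <;> simp [h]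
  map_smul' c t := by ext τ; by_cases h : τ ∈ A <;> simp [h]

variable (R X q) in
/-- The endomorphism of the presheaf of cochains which keeps the values on simplices with first vertex
in `A` and replaces the other values by zero. -/
def selectMap (A : Set X) : (cochainPresheaf R X).X q ⟶ (cochainPresheaf R X).X q where
  app U := ModuleCat.ofHom
    (restrictLinear R {τ | toSimplex (U := U.unop) τ (stdSimplex.vertex 0) ∈ A})
  naturality _ _ _ := rfl

open scoped Classical in
lemma app_selectMap (A : Set X) (U : Opens X) (g : Cochain R X q) :
    app (selectMap R X q A) U (cochainMk U q g) =
      cochainMk U q fun σ => if σ (stdSimplex.vertex 0) ∈ A then g σ else 0 := rfl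

/-- Selection of simplices by their first vertices shows that the sheaves of cochains are fine. -/
theorem isFine_cochainSheaf [T2Space X] [ParacompactSpace X] (q : ℕ) :
    IsFine ((cochainSheaf R X).X q) := by
  classical
  intro U hU
  obtain ⟨w, i, hfin, hwU, hi⟩ := exists_shrinking U hU
  let h : X → ((cochainPresheaf R X).X q ⟶ (cochainPresheaf R X).X q) :=
    fun c => selectMap R X q {y | i y = c}
  have hzero : ∀ (c : X) (W : Opens X), (∀ y ∈ W, i y ≠ c) →
      ∀ V ≤ W, ∀ t : Sec ((cochainPresheaf R X).X q) V, app (h c) V t = 0 := by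
    intro c W hW V hV t
    obtain ⟨g, rfl⟩ := cochainMk_surjective V q t
    rw [app_selectMap, cochainMk_eq_zero_iff]
    exact fun σ hσ => if_neg (hW _ (hV (hσ _)))
  refine ⟨⟨fun c => (sheafification R X).map (h c), fun c x hx => ?_, fun x => ?_⟩⟩
  · refine ⟨⟨(closure (w c))ᶜ, isClosed_closure.isOpen_compl⟩, fun hx' => hx (hwU c hx'), ?_⟩
    refine zeroOn_sheafification (hzero c _ fun y hy hyc => hy (subset_closure ?_))
    rw [← hyc]
    exact hi y
  · obtain ⟨N, hN, hNfin⟩ := hfin x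
    obtain ⟨W, hWN, hW, hxW⟩ := mem_nhds_iff.1 hN
    have hI : ∀ y ∈ W, i y ∈ hNfin.toFinset := fun y hy =>
      hNfin.mem_toFinset.2 ⟨y, hi y, hWN hy⟩
    refine ⟨⟨W, hW⟩, hxW, hNfin.toFinset, fun c hc => ?_, ?_⟩
    · exact zeroOn_sheafification (hzero c _ fun y hy hyc => hc (hyc ▸ hI y hy))
    · have hmap : ∑ c ∈ hNfin.toFinset, (sheafification R X).map (h c) - 𝟙 _ =
          (sheafification R X).map (∑ c ∈ hNfin.toFinset, h c - 𝟙 _) := by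
        rw [Functor.map_sub, Functor.map_sum, CategoryTheory.Functor.map_id]
      refine (congrArg (fun m => ZeroOn m _) hmap).mpr (zeroOn_sheafification fun V hV t => ?_)
      obtain ⟨g, rfl⟩ := cochainMk_surjective V q t
      let ev : ((cochainPresheaf R X).X q ⟶ (cochainPresheaf R X).X q) →+
          (Sec ((cochainPresheaf R X).X q) V →ₗ[R] Sec ((cochainPresheaf R X).X q) V) :=
        { toFun := fun f => app f V, map_zero' := rfl, map_add' := fun _ _ => rfl }
      have hev : ev (∑ c ∈ hNfin.toFinset, h c - 𝟙 _) (cochainMk V q g) =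
          cochainMk V q (∑ c ∈ hNfin.toFinset, (fun σ =>
            if σ (stdSimplex.vertex 0) ∈ {y | i y = c} then g σ else 0) - g) := by
        rw [map_sub, map_sum, map_sub, map_sum, LinearMap.sub_apply, LinearMap.sum_apply]
        rfl
      refine hev.trans (cochainMk_eq_zero_iff.2 fun σ hσ => ?_)
      rw [Pi.sub_apply, Finset.sum_apply, sub_eq_zero]
      refine (Finset.sum_ite_eq _ _ _).trans (if_pos (hI _ (hV (hσ _))))

end FineCochains

section GlobalCochains

variable {R : Type} [CommRing R] {X : TopCat.{0}} {q : ℕ}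

variable (R X) in
/-- A cochain vanishes locally: every point has a neighbourhood such that the cochain vanishes on the
simplices inside this neighbourhood. -/
def LocallyZero (g : Cochain R X q) : Prop :=
  ∀ x : X, ∃ V : Opens X, x ∈ V ∧ ∀ σ, SmallIn σ V → g σ = 0

/-- The section over an open set of the sheaf of cochains that is given by a cochain. -/
def cochainSection (U : Opens X) (q : ℕ) :
    Cochain R X q →ₗ[R] Sec ((cochainSheaf R X).X q).presheaf U :=
  (app (sheafificationUnit R ((cochainPresheaf R X).X q)) U).comp (cochainMk U q)

lemma res_cochainSection {U V : Opens X} (h : V ≤ U) (g : Cochain R X q) :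
    res _ h (cochainSection U q g) = cochainSection V q g :=
  (app_res (sheafificationUnit R ((cochainPresheaf R X).X q)) h (cochainMk U q g)).symm

lemma exists_of_cochainSection_eq_zero {U : Opens X} {g : Cochain R X q}
    (h : cochainSection U q g = 0) {x : X} (hx : x ∈ U) :
    ∃ V ≤ U, x ∈ V ∧ ∀ σ, SmallIn σ V → g σ = 0 := by
  obtain ⟨V, hV, hxV, h0⟩ := exists_res_eq_zero_of_sheafificationUnit (cochainMk U q g) h hx
  exact ⟨V, hV, hxV, cochainMk_eq_zero_iff.1 h0⟩

lemma cochainSection_eq {U : Opens X} {g g' : Cochain R X q}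
    (h : ∀ σ, SmallIn σ U → g σ = g' σ) : cochainSection U q g = cochainSection U q g' := by
  refine congrArg (app (sheafificationUnit R ((cochainPresheaf R X).X q)) U) (sub_eq_zero.1 ?_)
  rw [← map_sub, cochainMk_eq_zero_iff]
  exact fun σ hσ => sub_eq_zero.2 (h σ hσ)

lemma exists_cochainSection_eq {U : Opens X} (s : Sec ((cochainSheaf R X).X q).presheaf U) {x : X}
    (hx : x ∈ U) : ∃ V, ∃ hV : V ≤ U, x ∈ V ∧ ∃ g, cochainSection V q g = res _ hV s := by
  obtain ⟨V, hV, hxV, t, ht⟩ := exists_sheafificationUnit_eq s hx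
  obtain ⟨g, rfl⟩ := cochainMk_surjective V q t
  exact ⟨V, hV, hxV, g, ht⟩

/-- On a paracompact space, global sections of the sheaf of cochains are represented by cochains:
choose
a local representative according to the first vertex of a simplex. -/
lemma cochainSection_surjective [T2Space X] [ParacompactSpace X] (q : ℕ) :
    Function.Surjective (cochainSection (R := R) (⊤ : Opens X) q) := by
  intro s
  choose V hV hxV g hg using fun x : X => exists_cochainSection_eq s (x := x) trivial
  obtain ⟨w, i, hfin, hwV, hi⟩ := exists_shrinking V hxV
  refine ⟨fun σ => g (i (σ (stdSimplex.vertex 0))) σ, sec_ext fun x _ => ?_⟩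
  obtain ⟨N, hN, hNfin⟩ := hfin x
  -- Near `x` the representatives with index `c` and `i x` agree, or `w c` is avoided.
  have hc : ∀ c, ∃ W : Opens X, x ∈ W ∧ W ≤ V (i x) ∧
      ∀ σ : Simplex X q, SmallIn σ W → σ (stdSimplex.vertex 0) ∈ w c → g c σ = g (i x) σ := by
    intro c
    have hx : x ∈ V (i x) := hwV _ (subset_closure (hi x))
    by_cases hxc : x ∈ closure (w c)
    · obtain ⟨W, hW, hxW, h0⟩ := exists_of_cochainSection_eq_zero
        (U := V c ⊓ V (i x)) (g := g c - g (i x)) (by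
          rw [map_sub, ← res_cochainSection inf_le_left, ← res_cochainSection inf_le_right, hg, hg,
            res_res, res_res, sub_self]) (x := x) ⟨hwV c hxc, hx⟩
      exact ⟨W, hxW, hW.trans inf_le_right, fun σ hσ _ => sub_eq_zero.1 (h0 σ hσ)⟩
    · exact ⟨V (i x) ⊓ ⟨(closure (w c))ᶜ, isClosed_closure.isOpen_compl⟩, ⟨hx, hxc⟩, inf_le_left,
        fun σ hσ hσc => absurd (subset_closure hσc) (hσ (stdSimplex.vertex 0)).2⟩
  choose W hxW hWV hW using hc
  obtain ⟨N', hN'N, hN', hxN'⟩ := mem_nhds_iff.1 hN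
  let W₀ : Opens X := ⟨(N' ∩ ⋂ c ∈ hNfin.toFinset, (W c : Set X)) ∩ W x,
    (hN'.inter (isOpen_biInter_finset fun c _ => (W c).2)).inter (W x).2⟩
  refine ⟨W₀, le_top, ⟨⟨hxN', Set.mem_iInter₂.2 fun c _ => hxW c⟩, hxW x⟩, ?_⟩
  have hW₀ : W₀ ≤ V (i x) := fun y hy => hWV x hy.2
  rw [res_cochainSection, ← res_res (hV (i x)) hW₀, ← hg, res_cochainSection]
  refine cochainSection_eq fun σ hσ => ?_
  have hmem : i (σ (stdSimplex.vertex 0)) ∈ hNfin.toFinset :=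
    hNfin.mem_toFinset.2 ⟨_, hi _, hN'N (hσ _).1.1⟩
  exact hW _ σ (fun p => Set.mem_iInter₂.1 (hσ p).1.2 _ hmem) (hi _)

/-- A cochain of `X`, as an element of the complex of singular cochains. -/
def globalCochain (q : ℕ) (g : Cochain R X q) : ((singularCochains R).obj (op X)).X q :=
  fun τ => g (TopCat.toSSetObjEquiv X _ τ)

lemma globalCochain_surjective (q : ℕ) : Function.Surjective (globalCochain (R := R) (X := X) q) :=
  fun a => ⟨fun σ => (show _ → R from a) ((TopCat.toSSetObjEquiv X _).symm σ),
    funext fun τ => congrArg a ((TopCat.toSSetObjEquiv X _).symm_apply_apply τ)⟩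

lemma globalCochain_injective (q : ℕ) : Function.Injective (globalCochain (R := R) (X := X) q) :=
  fun g g' h => funext fun σ => by
    have := congrFun h
      ((TopCat.toSSetObjEquiv X (op (SimplexCategory.mk q))).symm σ)
    exact this

lemma d_globalCochain (q : ℕ) (g : Cochain R X q) :
    (((singularCochains R).obj (op X)).d q (q + 1)).hom (globalCochain q g) =
      globalCochain (q + 1) (coboundary g) :=
  funext fun τ => singularCochains_d_apply X q (globalCochain q g) τ

/-- Reduction of the comparison of singular cohomology with hypercohomology to the acyclicity of the
complex of locally vanishing cochains. -/
theorem isIso_singularToHyper_of_acyclic [T2Space X] [ParacompactSpace X]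
    (h : ∀ (q : ℕ) (g : Cochain R X (q + 1)), LocallyZero R X g → coboundary g = 0 →
      ∃ g' : Cochain R X q, LocallyZero R X g' ∧ coboundary g' = g) (k : ℕ) :
    IsIso (singularToHyper R X k) := by
  have hzero : ∀ (q : ℕ) (g : Cochain R X q),
      cochainSection (⊤ : Opens X) q g = 0 ↔ LocallyZero R X g := fun q g => by
    refine ⟨fun h0 x => ?_, fun h0 => sec_ext fun x _ => ?_⟩
    · obtain ⟨V, -, hxV, hV⟩ := exists_of_cochainSection_eq_zero h0 (x := x) trivial
      exact ⟨V, hxV, hV⟩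
    · obtain ⟨V, hxV, hV⟩ := h0 x
      refine ⟨V, le_top, hxV, ?_⟩
      rw [res_cochainSection, map_zero, ← map_zero (cochainSection V q)]
      exact cochainSection_eq hV
  have h1 : IsIso (HomologicalComplex.homologyMap (singularToSections R X) k) := by
    refine isIso_homologyMap_of_surjective _ (fun q s => ?_) (fun q a hda hfa => ?_) k
    · obtain ⟨g, hg⟩ := cochainSection_surjective q s
      exact ⟨globalCochain q g, hg⟩
    · obtain ⟨g, rfl⟩ := globalCochain_surjective q a
      have hg : LocallyZero R X g := (hzero q g).1 hfa
      obtain _ | q := q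
      · have hg0 : g = 0 := funext fun σ => by
          obtain ⟨V, hxV, hV⟩ := hg (σ (stdSimplex.vertex 0))
          exact hV σ fun p => by rwa [Subsingleton.elim p (stdSimplex.vertex 0)]
        refine ⟨0, 0, map_zero _, ?_⟩
        rw [map_zero, hg0]
        rfl
      · have hd : coboundary g = 0 :=
          globalCochain_injective _ ((d_globalCochain _ g).symm.trans hda)
        obtain ⟨g', hg', rfl⟩ := h q g hg hd
        exact ⟨q, globalCochain q g', (hzero q g').2 hg', d_globalCochain q g'⟩
  have h2 : IsIso (HomologicalComplex.homologyMap (sectionsToHyper (cochainSheaf R X)) k) :=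
    isIso_sectionsToHyper (fun q => isFine_cochainSheaf q) k
  have h3 : singularToHyper R X k = HomologicalComplex.homologyMap (singularToSections R X) k ≫
      HomologicalComplex.homologyMap (sectionsToHyper (cochainSheaf R X)) k :=
    HomologicalComplex.homologyMap_comp _ _ _
  rw [h3]
  infer_instance

end GlobalCochains

/-! ### Barycentric subdivision -/

section TupleCochains

variable {P P' A : Type} [AddCommGroup A] {q : ℕ}

/-- The coboundary of a function on tuples of points, viewed as a cochain on affine simplices. -/
def tupleCoboundary (Φ : (Fin (q + 1) → P) → A) (v : Fin (q + 2) → P) : A :=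
  ∑ i : Fin (q + 2), (-1 : ℤ) ^ (i : ℕ) • Φ fun j => v (i.succAbove j)

/-- The composition of a cochain with the operation of coning off from the point `x`. -/
def coneCochain (x : P) (Φ : (Fin (q + 2) → P) → A) (w : Fin (q + 1) → P) : A :=
  Φ (Fin.cons x w : Fin (q + 2) → P)

lemma tupleCoboundary_sub (Φ Ψ : (Fin (q + 1) → P) → A) :
    tupleCoboundary (Φ - Ψ) = tupleCoboundary Φ - tupleCoboundary Ψ := by
  funext v
  simp only [tupleCoboundary, Pi.sub_apply, smul_sub, Finset.sum_sub_distrib]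

lemma coneCochain_tupleCoboundary (x : P) (Φ : (Fin (q + 2) → P) → A) :
    coneCochain x (tupleCoboundary Φ) = Φ - tupleCoboundary (coneCochain x Φ) := by
  funext w
  rw [Pi.sub_apply, coneCochain, tupleCoboundary, Fin.sum_univ_succ, sub_eq_add_neg,
    tupleCoboundary, ← Finset.sum_neg_distrib]
  refine congrArg₂ (· + ·) (one_smul _ _) (Finset.sum_congr rfl fun i _ => ?_)
  rw [Fin.val_succ, pow_succ, mul_neg, mul_one, neg_smul, coneCochain]
  refine congrArg (fun u => -((-1 : ℤ) ^ (i : ℕ) • Φ u)) (funext fun j => ?_)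
  refine Fin.cases ?_ (fun j => ?_) j
  · rw [Fin.succ_succAbove_zero, Fin.cons_zero, Fin.cons_zero]
  · rw [Fin.succ_succAbove_succ, Fin.cons_succ, Fin.cons_succ]

lemma coneCochain_tupleCoboundary_zero (x : P) (Φ : (Fin 1 → P) → A) :
    coneCochain x (tupleCoboundary Φ) = Φ - fun _ => Φ fun _ => x := by
  funext w
  rw [Pi.sub_apply, coneCochain, tupleCoboundary, Fin.sum_univ_two, sub_eq_add_neg]
  refine congrArg₂ (· + ·) (one_smul _ _) ?_
  rw [Fin.val_one, pow_one, neg_smul, one_smul]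
  refine congrArg (fun u => -Φ u) (funext fun j => ?_)
  rw [Subsingleton.elim (α := Fin 1) j 0]
  rfl

lemma tupleCoboundary_tupleCoboundary : ∀ (q : ℕ) (Φ : (Fin (q + 1) → P) → A),
    tupleCoboundary (tupleCoboundary Φ) = 0
  | 0, Φ => by
    funext v
    rw [← Fin.cons_self_tail v]
    change coneCochain (v 0) (tupleCoboundary (tupleCoboundary Φ)) (Fin.tail v) = 0
    rw [coneCochain_tupleCoboundary, coneCochain_tupleCoboundary_zero, tupleCoboundary_sub,
      sub_sub_cancel]
    simp [tupleCoboundary, Fin.sum_univ_two]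
  | q + 1, Φ => by
    funext v
    rw [← Fin.cons_self_tail v]
    change coneCochain (v 0) (tupleCoboundary (tupleCoboundary Φ)) (Fin.tail v) = 0
    rw [coneCochain_tupleCoboundary, coneCochain_tupleCoboundary, tupleCoboundary_sub,
      sub_sub_cancel, tupleCoboundary_tupleCoboundary q]
    rfl

variable (b : ∀ q, (Fin (q + 1) → P) → P) (b' : ∀ q, (Fin (q + 1) → P') → P')

/-- The transpose of barycentric subdivision `sd v = b_v · sd (∂ v)` of tuples of points, where `b`
gives the barycenters. -/
def tupleSubdiv : ∀ q, ((Fin (q + 1) → P) → A) → (Fin (q + 1) → P) → A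
  | 0, Φ, v => Φ v
  | q + 1, Φ, v => tupleCoboundary (tupleSubdiv q (coneCochain (b (q + 1) v) Φ)) v

/-- The transpose of the chain homotopy `T v = b_v · (v - T (∂ v))` between barycentric subdivision
and the identity. -/
def tupleHomotopy : ∀ q, ((Fin (q + 2) → P) → A) → (Fin (q + 1) → P) → A
  | 0, Φ, v => coneCochain (b 0 v) Φ v
  | q + 1, Φ, v => coneCochain (b (q + 1) v) Φ v -
      tupleCoboundary (tupleHomotopy q (coneCochain (b (q + 1) v) Φ)) v

lemma tupleHomotopy_sub : ∀ (q : ℕ) (Φ Ψ : (Fin (q + 2) → P) → A),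
    tupleHomotopy b q (Φ - Ψ) = tupleHomotopy b q Φ - tupleHomotopy b q Ψ
  | 0, _, _ => rfl
  | q + 1, Φ, Ψ => by
    funext v
    have h : coneCochain (b (q + 1) v) (Φ - Ψ) =
      coneCochain (b (q + 1) v) Φ - coneCochain (b (q + 1) v) Ψ := rfl
    rw [Pi.sub_apply, tupleHomotopy, tupleHomotopy, tupleHomotopy, h, tupleHomotopy_sub q,
      tupleCoboundary_sub, Pi.sub_apply, Pi.sub_apply]
    abel

lemma tupleHomotopy_zero (q : ℕ) : tupleHomotopy b q (0 : (Fin (q + 2) → P) → A) = 0 := by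
  rw [← sub_self 0, tupleHomotopy_sub, sub_self]

lemma tupleSubdiv_zero : ∀ q, tupleSubdiv b q (0 : (Fin (q + 1) → P) → A) = 0
  | 0 => rfl
  | q + 1 => by
    funext v
    have h : coneCochain (b (q + 1) v) (0 : (Fin (q + 2) → P) → A) = 0 := rfl
    rw [tupleSubdiv, h, tupleSubdiv_zero q]
    simp [tupleCoboundary]

variable {b} in
lemma tupleHomotopy_tupleCoboundary_of {q : ℕ}
    (ih : ∀ Ψ : (Fin (q + 1) → P) → A, tupleCoboundary (tupleHomotopy b q (tupleCoboundary Ψ)) =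
      tupleCoboundary Ψ - tupleCoboundary (tupleSubdiv b q Ψ)) (Φ : (Fin (q + 2) → P) → A) :
    tupleHomotopy b (q + 1) (tupleCoboundary Φ) =
      Φ - tupleSubdiv b (q + 1) Φ - tupleCoboundary (tupleHomotopy b q Φ) := by
  funext v
  rw [tupleHomotopy, coneCochain_tupleCoboundary, tupleHomotopy_sub, tupleCoboundary_sub, ih,
    Pi.sub_apply, Pi.sub_apply, Pi.sub_apply, Pi.sub_apply, Pi.sub_apply, tupleSubdiv]
  abel

variable {b} in
lemma tupleCoboundary_tupleHomotopy_tupleCoboundary (hb : ∀ v, b 0 v = v 0) :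
    ∀ (q : ℕ) (Ψ : (Fin (q + 1) → P) → A),
      tupleCoboundary (tupleHomotopy b q (tupleCoboundary Ψ)) =
        tupleCoboundary Ψ - tupleCoboundary (tupleSubdiv b q Ψ)
  | 0, Ψ => by
    have h1 : tupleHomotopy b 0 (tupleCoboundary Ψ) = 0 := by
      funext v
      rw [tupleHomotopy, coneCochain_tupleCoboundary_zero, hb, Pi.sub_apply]
      refine sub_eq_zero.2 (congrArg Ψ (funext fun j => ?_))
      rw [Subsingleton.elim (α := Fin 1) j 0]
    have h2 : tupleSubdiv b 0 Ψ = Ψ := rfl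
    rw [h1, h2, sub_self]
    funext v
    simp [tupleCoboundary]
  | q + 1, Ψ => by
    rw [tupleHomotopy_tupleCoboundary_of (tupleCoboundary_tupleHomotopy_tupleCoboundary hb q),
      tupleCoboundary_sub, tupleCoboundary_sub, tupleCoboundary_tupleCoboundary, sub_zero]

variable {b} in
/-- The chain homotopy formula for barycentric subdivision. -/
lemma tupleHomotopy_tupleCoboundary (hb : ∀ v, b 0 v = v 0) (q : ℕ)
    (Φ : (Fin (q + 2) → P) → A) :
    tupleHomotopy b (q + 1) (tupleCoboundary Φ) =
      Φ - tupleSubdiv b (q + 1) Φ - tupleCoboundary (tupleHomotopy b q Φ) :=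
  tupleHomotopy_tupleCoboundary_of (tupleCoboundary_tupleHomotopy_tupleCoboundary hb q) Φ

variable {b b'} {f : P → P'}

lemma tupleSubdiv_comp (hf : ∀ q v, f (b q v) = b' q (f ∘ v)) :
    ∀ (q : ℕ) (Φ : (Fin (q + 1) → P') → A) (v : Fin (q + 1) → P),
      tupleSubdiv b q (fun w => Φ (f ∘ w)) v = tupleSubdiv b' q Φ (f ∘ v)
  | 0, _, _ => rfl
  | q + 1, Φ, v => by
    have h : coneCochain (b (q + 1) v) (fun w => Φ (f ∘ w)) =
        fun w => coneCochain (b' (q + 1) (f ∘ v)) Φ (f ∘ w) := funext fun w => by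
      rw [coneCochain, coneCochain, Fin.comp_cons, hf]
    rw [tupleSubdiv, tupleSubdiv, h, tupleCoboundary, tupleCoboundary]
    exact Finset.sum_congr rfl fun i _ => congrArg _ (tupleSubdiv_comp hf q _ _)

lemma tupleHomotopy_comp (hf : ∀ q v, f (b q v) = b' q (f ∘ v)) :
    ∀ (q : ℕ) (Φ : (Fin (q + 2) → P') → A) (v : Fin (q + 1) → P),
      tupleHomotopy b q (fun w => Φ (f ∘ w)) v = tupleHomotopy b' q Φ (f ∘ v)
  | 0, Φ, v => by
    rw [tupleHomotopy, tupleHomotopy, coneCochain, coneCochain, Fin.comp_cons, hf]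
  | q + 1, Φ, v => by
    have h : coneCochain (b (q + 1) v) (fun w => Φ (f ∘ w)) =
        fun w => coneCochain (b' (q + 1) (f ∘ v)) Φ (f ∘ w) := funext fun w => by
      rw [coneCochain, coneCochain, Fin.comp_cons, hf]
    rw [tupleHomotopy, tupleHomotopy, h, tupleCoboundary, tupleCoboundary]
    exact congrArg _ (Finset.sum_congr rfl fun i _ => congrArg _ (tupleHomotopy_comp hf q _ _))

end TupleCochains

section AffineSimplices

variable {p q r : ℕ}

/-- The affine map between standard simplices with given values at the vertices. -/
def affineMap (v : Fin (q + 1) → stdSimplex ℝ (Fin (p + 1))) :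
    C(stdSimplex ℝ (Fin (q + 1)), stdSimplex ℝ (Fin (p + 1))) where
  toFun t := ⟨∑ i, t i • (v i : Fin (p + 1) → ℝ), (convex_stdSimplex ℝ _).sum_mem
    (fun i _ => stdSimplex.zero_le t i) (stdSimplex.sum_eq_one t) fun i _ => (v i).2⟩
  continuous_toFun := by
    refine Continuous.subtype_mk (continuous_finsetSum _ fun i _ => ?_) _
    exact ((continuous_apply i).comp continuous_subtype_val).smul continuous_const

lemma affineMap_coe (v : Fin (q + 1) → stdSimplex ℝ (Fin (p + 1)))
    (t : stdSimplex ℝ (Fin (q + 1))) :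
    (affineMap v t : Fin (p + 1) → ℝ) = ∑ i, t i • (v i : Fin (p + 1) → ℝ) := rfl

lemma affineMap_apply (v : Fin (q + 1) → stdSimplex ℝ (Fin (p + 1)))
    (t : stdSimplex ℝ (Fin (q + 1))) (j : Fin (p + 1)) :
    affineMap v t j = ∑ i, t i * v i j := by
  rw [affineMap_coe, Finset.sum_apply]
  rfl

lemma affineMap_vertex (v : Fin (q + 1) → stdSimplex ℝ (Fin (p + 1))) (i : Fin (q + 1)) :
    affineMap v (stdSimplex.vertex i) = v i := by
  refine stdSimplex.ext ?_
  rw [affineMap_coe]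
  simp [Pi.single_apply]

lemma affineMap_comp_affineMap (v : Fin (q + 1) → stdSimplex ℝ (Fin (p + 1)))
    (w : Fin (r + 1) → stdSimplex ℝ (Fin (q + 1))) :
    (affineMap v).comp (affineMap w) = affineMap (affineMap v ∘ w) := by
  refine ContinuousMap.ext fun t => stdSimplex.ext (funext fun j => ?_)
  simp only [ContinuousMap.comp_apply, affineMap_apply, Function.comp_apply, Finset.sum_mul,
    Finset.mul_sum]
  rw [Finset.sum_comm]
  exact Finset.sum_congr rfl fun k _ => Finset.sum_congr rfl fun i _ => mul_assoc _ _ _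

lemma affineMap_comp_faceMap (v : Fin (q + 2) → stdSimplex ℝ (Fin (p + 1))) (i : Fin (q + 2)) :
    (affineMap v).comp (faceMap i) = affineMap fun j => v (i.succAbove j) := by
  refine ContinuousMap.ext fun t => stdSimplex.ext (funext fun j => ?_)
  rw [ContinuousMap.comp_apply, affineMap_apply, affineMap_apply, Fin.sum_univ_succAbove _ i,
    faceMap_apply_self, zero_mul, zero_add]
  exact Finset.sum_congr rfl fun j _ => by rw [faceMap_apply_succAbove]

variable (q) in
/-- The tuple of the vertices of the standard simplex. -/
def vertices : Fin (q + 1) → stdSimplex ℝ (Fin (q + 1)) := fun i => stdSimplex.vertex i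

lemma affineMap_vertices : affineMap (vertices q) = ContinuousMap.id _ := by
  refine ContinuousMap.ext fun t => stdSimplex.ext (funext fun j => ?_)
  rw [affineMap_apply, ContinuousMap.id_apply]
  simp [vertices, Pi.single_apply]

/-- The barycenter of a tuple of points of a standard simplex. -/
def tupleBarycenter (q : ℕ) (v : Fin (q + 1) → stdSimplex ℝ (Fin (p + 1))) :
    stdSimplex ℝ (Fin (p + 1)) := affineMap v stdSimplex.barycenter

lemma tupleBarycenter_zero (v : Fin 1 → stdSimplex ℝ (Fin (p + 1))) :
    tupleBarycenter 0 v = v 0 := by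
  rw [← affineMap_vertex v 0, tupleBarycenter]
  exact congrArg _ (Subsingleton.elim (α := stdSimplex ℝ (Fin 1)) _ _)

lemma affineMap_tupleBarycenter (v : Fin (q + 1) → stdSimplex ℝ (Fin (p + 1))) (r : ℕ)
    (w : Fin (r + 1) → stdSimplex ℝ (Fin (q + 1))) :
    affineMap v (tupleBarycenter r w) = tupleBarycenter r (affineMap v ∘ w) :=
  congrArg (fun f => f stdSimplex.barycenter) (affineMap_comp_affineMap v w)

lemma affineMap_mem_convexHull (v : Fin (q + 1) → stdSimplex ℝ (Fin (p + 1)))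
    (t : stdSimplex ℝ (Fin (q + 1))) : (affineMap v t : Fin (p + 1) → ℝ) ∈
      convexHull ℝ (Set.range fun i => (v i : Fin (p + 1) → ℝ)) :=
  (convex_convexHull ℝ _).sum_mem (fun i _ => stdSimplex.zero_le t i) (stdSimplex.sum_eq_one t)
    fun i _ => subset_convexHull ℝ _ ⟨i, rfl⟩

lemma dist_tupleBarycenter_le {D : ℝ} (v : Fin (q + 2) → stdSimplex ℝ (Fin (p + 1)))
    (hv : ∀ j k, dist (v j) (v k) ≤ D) (k : Fin (q + 2)) :
    dist (v k) (tupleBarycenter (q + 1) v) ≤ ((q + 1 : ℕ) : ℝ) / ((q + 1 : ℕ) + 1) * D := by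
  have hc : ((q + 1 : ℕ) : ℝ) + 1 ≠ 0 := by positivity
  have h1 : (tupleBarycenter (q + 1) v : Fin (p + 1) → ℝ) =
      ∑ i, ((q + 1 : ℕ) + 1 : ℝ)⁻¹ • (v i : Fin (p + 1) → ℝ) := by
    rw [tupleBarycenter, affineMap_coe]
    refine Finset.sum_congr rfl fun i _ => congrArg (· • (v i : Fin (p + 1) → ℝ)) ?_
    refine (stdSimplex.barycenter_apply i).trans ?_
    rw [Fintype.card_fin]
    push_cast
    rfl
  have h2 : (tupleBarycenter (q + 1) v : Fin (p + 1) → ℝ) - v k =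
      ((q + 1 : ℕ) + 1 : ℝ)⁻¹ • ∑ j : Fin (q + 1), ((v (k.succAbove j) : Fin (p + 1) → ℝ) - v k) := by
    rw [h1, ← Finset.smul_sum, Fin.sum_univ_succAbove _ k, Finset.sum_sub_distrib,
      Finset.sum_const, Finset.card_univ, Fintype.card_fin, ← Nat.cast_smul_eq_nsmul ℝ, smul_add,
      smul_sub, smul_smul]
    have h3 : ((q + 1 : ℕ) + 1 : ℝ)⁻¹ • (v k : Fin (p + 1) → ℝ) +
        (((q + 1 : ℕ) + 1 : ℝ)⁻¹ * (q + 1 : ℕ)) • (v k : Fin (p + 1) → ℝ) = v k := by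
      rw [← add_smul, ← mul_one_add, add_comm (1 : ℝ), inv_mul_cancel₀ hc, one_smul]
    nth_rewrite 2 [← h3]
    abel
  rw [dist_comm, Subtype.dist_eq, dist_eq_norm]
  change ‖(tupleBarycenter (q + 1) v : Fin (p + 1) → ℝ) - v k‖ ≤ _
  rw [h2, norm_smul, Real.norm_of_nonneg (by positivity),
    div_eq_inv_mul, mul_assoc]
  refine mul_le_mul_of_nonneg_left ((norm_sum_le _ _).trans ?_) (by positivity)
  refine (Finset.sum_le_card_nsmul _ _ D fun j _ => ?_).trans ?_
  · rw [← dist_eq_norm]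
    exact hv _ _
  · rw [Finset.card_univ, Fintype.card_fin, nsmul_eq_mul]

lemma dist_le_of_mem_convexHull {D : ℝ} {v : Fin (q + 1) → stdSimplex ℝ (Fin (p + 1))}
    {x y : stdSimplex ℝ (Fin (p + 1))} (h : ∀ k, dist (v k) y ≤ D)
    (hx : (x : Fin (p + 1) → ℝ) ∈ convexHull ℝ (Set.range fun i => (v i : Fin (p + 1) → ℝ))) :
    dist x y ≤ D := by
  have h1 : convexHull ℝ (Set.range fun i => (v i : Fin (p + 1) → ℝ)) ⊆
      Metric.closedBall (y : Fin (p + 1) → ℝ) D :=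
    convexHull_min (Set.range_subset_iff.2 fun k => h k) (convex_closedBall _ _)
  exact h1 hx

variable {A : Type} [AddCommGroup A]

/-- The subdivision of a `q`-simplex consists of simplices in its convex hull whose diameter is smaller
by the factor `q / (q + 1)`. -/
lemma tupleSubdiv_eq_zero : ∀ (q : ℕ) (Φ : (Fin (q + 1) → stdSimplex ℝ (Fin (p + 1))) → A)
    (v : Fin (q + 1) → stdSimplex ℝ (Fin (p + 1))) (D : ℝ) (_ : ∀ j k, dist (v j) (v k) ≤ D)
    (_ : ∀ w : Fin (q + 1) → stdSimplex ℝ (Fin (p + 1)), (∀ j, (w j : Fin (p + 1) → ℝ) ∈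
        convexHull ℝ (Set.range fun i => (v i : Fin (p + 1) → ℝ))) →
      (∀ j k, dist (w j) (w k) ≤ (q : ℝ) / (q + 1) * D) → Φ w = 0),
    tupleSubdiv tupleBarycenter q Φ v = 0
  | 0, Φ, v, D, _, h => by
    refine h v (fun j => subset_convexHull ℝ _ ⟨j, rfl⟩) fun j k => ?_
    rw [Subsingleton.elim (α := Fin 1) j k, dist_self, Nat.cast_zero, zero_div, zero_mul]
  | q + 1, Φ, v, D, hD, h => by
    have hD0 : 0 ≤ D := dist_nonneg.trans (hD 0 0)
    rw [tupleSubdiv, tupleCoboundary]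
    refine Finset.sum_eq_zero fun i _ => ?_
    rw [tupleSubdiv_eq_zero q _ _ D (fun j k => hD _ _) fun w hw hwD => ?_, smul_zero]
    have hsub : (Set.range fun k => (v (i.succAbove k) : Fin (p + 1) → ℝ)) ⊆
        Set.range fun k => (v k : Fin (p + 1) → ℝ) :=
      Set.range_subset_iff.2 fun k => ⟨i.succAbove k, rfl⟩
    have hwv : ∀ j, (w j : Fin (p + 1) → ℝ) ∈
        convexHull ℝ (Set.range fun i => (v i : Fin (p + 1) → ℝ)) := fun j =>
      convexHull_mono hsub (hw j)
    have hbar : ∀ j, dist (w j) (tupleBarycenter (q + 1) v) ≤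
        ((q + 1 : ℕ) : ℝ) / ((q + 1 : ℕ) + 1) * D := fun j =>
      dist_le_of_mem_convexHull (dist_tupleBarycenter_le v hD) (hwv j)
    have hmono : (q : ℝ) / (q + 1) * D ≤ ((q + 1 : ℕ) : ℝ) / ((q + 1 : ℕ) + 1) * D := by
      refine mul_le_mul_of_nonneg_right ?_ hD0
      rw [div_le_div_iff₀ (by positivity) (by positivity)]
      push_cast
      nlinarith
    refine h _ (fun j => ?_) fun j k => ?_
    · refine Fin.cases ?_ (fun j => ?_) j
      · exact affineMap_mem_convexHull v _
      · exact hwv j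
    · refine Fin.cases ?_ (fun j => ?_) j <;> refine Fin.cases ?_ (fun k => ?_) k
      · rw [dist_self]
        positivity
      · rw [dist_comm]
        exact hbar k
      · exact hbar j
      · exact (hwD j k).trans hmono

lemma iterate_tupleSubdiv_eq_zero (q : ℕ) (D : ℝ) : ∀ (n : ℕ)
    (Φ : (Fin (q + 1) → stdSimplex ℝ (Fin (p + 1))) → A)
    (_ : ∀ w : Fin (q + 1) → stdSimplex ℝ (Fin (p + 1)),
      (∀ j k, dist (w j) (w k) ≤ ((q : ℝ) / (q + 1)) ^ n * D) → Φ w = 0)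
    (v : Fin (q + 1) → stdSimplex ℝ (Fin (p + 1))) (_ : ∀ j k, dist (v j) (v k) ≤ D),
    (tupleSubdiv tupleBarycenter q)^[n] Φ v = 0
  | 0, Φ, h, v, hv => h v (by simpa using hv)
  | n + 1, Φ, h, v, hv => by
    rw [Function.iterate_succ_apply]
    refine iterate_tupleSubdiv_eq_zero q D n _ (fun w hw => ?_) v hv
    refine tupleSubdiv_eq_zero q Φ w _ hw fun u _ hu => h u fun j k => (hu j k).trans_eq ?_
    rw [pow_succ', mul_assoc]

lemma dist_stdSimplex_le_one (x y : stdSimplex ℝ (Fin (p + 1))) : dist x y ≤ 1 :=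
  (Metric.dist_le_diam_of_mem (bounded_stdSimplex _) x.2 y.2).trans diam_stdSimplex_le

/-- Iterated subdivision kills any cochain that vanishes on small simplices. -/
lemma exists_iterate_tupleSubdiv_eq_zero {q : ℕ}
    (Φ : (Fin (q + 1) → stdSimplex ℝ (Fin (p + 1))) → A) {ε : ℝ} (hε : 0 < ε)
    (h : ∀ w : Fin (q + 1) → stdSimplex ℝ (Fin (p + 1)), (∀ j k, dist (w j) (w k) ≤ ε) → Φ w = 0) :
    ∃ N, ∀ n ≥ N, (tupleSubdiv tupleBarycenter q)^[n] Φ = 0 := by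
  have h1 : (q : ℝ) / (q + 1) < 1 := (div_lt_one (by positivity)).2 (lt_add_one _)
  obtain ⟨N, hN⟩ := exists_pow_lt_of_lt_one hε h1
  refine ⟨N, fun n hn => funext fun v => ?_⟩
  refine iterate_tupleSubdiv_eq_zero q 1 n Φ (fun w hw => h w fun j k => (hw j k).trans ?_) v
    fun j k => dist_stdSimplex_le_one _ _
  rw [mul_one]
  exact (pow_le_pow_of_le_one (by positivity) h1.le hn).trans hN.le

end AffineSimplices

section SmallSimplices

variable {R : Type} {X : TopCat.{0}} {p q : ℕ}

/-- The values of a singular cochain on the affine simplices in a singular simplex. -/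
def affineCochain (g : Cochain R X q) (σ : Simplex X p)
    (w : Fin (q + 1) → stdSimplex ℝ (Fin (p + 1))) : R := g (σ.comp (affineMap w))

lemma affineCochain_vertices (g : Cochain R X q) (σ : Simplex X q) :
    affineCochain g σ (vertices q) = g σ := by
  rw [affineCochain, affineMap_vertices, ContinuousMap.comp_id]

lemma affineMap_comp_vertices (w : Fin (q + 1) → stdSimplex ℝ (Fin (p + 1))) :
    affineMap w ∘ vertices q = w := funext fun i => affineMap_vertex w i

lemma affineCochain_comp_affineMap (g : Cochain R X q) (σ : Simplex X p) {r : ℕ}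
    (w : Fin (r + 1) → stdSimplex ℝ (Fin (p + 1))) :
    affineCochain g (σ.comp (affineMap w)) = fun u => affineCochain g σ (affineMap w ∘ u) := by
  funext u
  rw [affineCochain, affineCochain, ContinuousMap.comp_assoc, affineMap_comp_affineMap]

variable [CommRing R]

/-- The transpose of barycentric subdivision of singular simplices. -/
def subdivide (g : Cochain R X q) : Cochain R X q := fun σ =>
  tupleSubdiv tupleBarycenter q (affineCochain g σ) (vertices q)

/-- The transpose of the chain homotopy between barycentric subdivision and the identity. -/
def subdivHomotopy (g : Cochain R X (q + 1)) : Cochain R X q := fun σ =>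
  tupleHomotopy tupleBarycenter q (affineCochain g σ) (vertices q)

lemma affineCochain_coboundary (g : Cochain R X q) (σ : Simplex X p) :
    affineCochain (coboundary g) σ = tupleCoboundary (affineCochain g σ) := by
  funext w
  rw [affineCochain, coboundary, tupleCoboundary]
  refine Finset.sum_congr rfl fun i _ => ?_
  rw [affineCochain, ContinuousMap.comp_assoc, affineMap_comp_faceMap]

lemma affineCochain_subdivide (g : Cochain R X q) (σ : Simplex X p) :
    affineCochain (subdivide g) σ = tupleSubdiv tupleBarycenter q (affineCochain g σ) := by
  funext w
  rw [affineCochain, subdivide, affineCochain_comp_affineMap,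
    tupleSubdiv_comp (affineMap_tupleBarycenter w), affineMap_comp_vertices]

lemma affineCochain_subdivHomotopy (g : Cochain R X (q + 1)) (σ : Simplex X p) :
    affineCochain (subdivHomotopy g) σ = tupleHomotopy tupleBarycenter q (affineCochain g σ) := by
  funext w
  rw [affineCochain, subdivHomotopy, affineCochain_comp_affineMap,
    tupleHomotopy_comp (affineMap_tupleBarycenter w), affineMap_comp_vertices]

lemma coboundary_coboundary (g : Cochain R X q) : coboundary (coboundary g) = 0 := by
  funext σ
  rw [← affineCochain_vertices (coboundary (coboundary g)), affineCochain_coboundary,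
    affineCochain_coboundary, tupleCoboundary_tupleCoboundary]
  rfl

/-- Subdivision does not change the class of a closed cochain. -/
lemma coboundary_subdivHomotopy {g : Cochain R X (q + 1)} (hg : coboundary g = 0) :
    coboundary (subdivHomotopy g) = g - subdivide g := by
  funext σ
  have h := congrFun (tupleHomotopy_tupleCoboundary (b := tupleBarycenter)
    tupleBarycenter_zero q (affineCochain g σ)) (vertices (q + 1))
  have h0 : affineCochain (0 : Cochain R X (q + 1 + 1)) σ = 0 := rfl
  rw [← affineCochain_coboundary, hg, h0, tupleHomotopy_zero, ← affineCochain_subdivHomotopy,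
    ← affineCochain_subdivide, ← affineCochain_coboundary, Pi.sub_apply, Pi.sub_apply,
    affineCochain_vertices, affineCochain_vertices, affineCochain_vertices, Pi.zero_apply] at h
  rw [Pi.sub_apply]
  exact (sub_eq_zero.1 h.symm).symm

lemma coboundary_sub (g g' : Cochain R X q) :
    coboundary (g - g') = coboundary g - coboundary g' := by
  funext σ
  simp only [coboundary, Pi.sub_apply, smul_sub, Finset.sum_sub_distrib]

lemma coboundary_add (g g' : Cochain R X q) :
    coboundary (g + g') = coboundary g + coboundary g' := by
  funext σ
  simp only [coboundary, Pi.add_apply, smul_add, Finset.sum_add_distrib]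

lemma coboundary_iterate_subdivide {g : Cochain R X (q + 1)} (hg : coboundary g = 0) :
    ∀ n, coboundary (subdivide^[n] g) = 0
  | 0 => hg
  | n + 1 => by
    have h := coboundary_subdivHomotopy (coboundary_iterate_subdivide hg n)
    rw [Function.iterate_succ_apply', ← sub_sub_cancel (subdivide^[n] g) (subdivide _), ← h,
      coboundary_sub, coboundary_coboundary, coboundary_iterate_subdivide hg n, sub_zero]

lemma coboundary_sum_subdivHomotopy {g : Cochain R X (q + 1)} (hg : coboundary g = 0) : ∀ n : ℕ,
    coboundary (∑ i ∈ Finset.range n, subdivHomotopy (subdivide^[i] g)) = g - subdivide^[n] g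
  | 0 => by
    funext σ
    simp [coboundary]
  | n + 1 => by
    rw [Finset.sum_range_succ, coboundary_add, coboundary_sum_subdivHomotopy hg n,
      coboundary_subdivHomotopy (coboundary_iterate_subdivide hg n),
      Function.iterate_succ_apply', sub_add_sub_cancel]

lemma affineCochain_iterate_subdivide (σ : Simplex X p) : ∀ (n : ℕ) (g : Cochain R X q),
    affineCochain (subdivide^[n] g) σ = (tupleSubdiv tupleBarycenter q)^[n] (affineCochain g σ)
  | 0, _ => rfl
  | n + 1, g => by
    rw [Function.iterate_succ_apply, affineCochain_iterate_subdivide σ n,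
      affineCochain_subdivide, Function.iterate_succ_apply]

/-- A locally vanishing cochain vanishes on the sufficiently small affine simplices in a given singular
simplex. -/
lemma LocallyZero.exists_affineCochain_eq_zero {g : Cochain R X q} (hg : LocallyZero R X g)
    (σ : Simplex X p) : ∃ ε > 0, ∀ w : Fin (q + 1) → stdSimplex ℝ (Fin (p + 1)),
      (∀ j k, dist (w j) (w k) ≤ ε) → affineCochain g σ w = 0 := by
  choose V hxV hV using hg
  obtain ⟨δ, hδ, hball⟩ := lebesgue_number_lemma_of_metric (s := Set.univ)
    (c := fun x => σ ⁻¹' (V x : Set X)) isCompact_univ (fun x => (V x).2.preimage σ.continuous)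
    (fun t _ => Set.mem_iUnion.2 ⟨σ t, hxV _⟩)
  refine ⟨δ / 2, half_pos hδ, fun w hw => ?_⟩
  obtain ⟨x, hx⟩ := hball (w 0) (Set.mem_univ _)
  refine hV x _ fun t => hx ?_
  rw [Metric.mem_ball]
  exact (dist_le_of_mem_convexHull (fun k => hw k 0)
    (affineMap_mem_convexHull w t)).trans_lt (half_lt_self hδ)

lemma LocallyZero.exists_iterate_eq_zero {g : Cochain R X q} (hg : LocallyZero R X g)
    (σ : Simplex X p) : ∃ N, ∀ n ≥ N, affineCochain (subdivide^[n] g) σ = 0 := by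
  obtain ⟨ε, hε, h⟩ := hg.exists_affineCochain_eq_zero σ
  obtain ⟨N, hN⟩ := exists_iterate_tupleSubdiv_eq_zero (affineCochain g σ) hε h
  exact ⟨N, fun n hn => (affineCochain_iterate_subdivide σ n g).trans (hN n hn)⟩

/-- The complex of locally vanishing cochains is acyclic: a primitive of `g` is the sum of the cochains
`T (sd ^ i g)`, where `sd` is the subdivision and `T` the homotopy. On a given simplex, this sum is
finite. -/
lemma LocallyZero.exists_coboundary_eq {g : Cochain R X (q + 1)} (hg : LocallyZero R X g)
    (hd : coboundary g = 0) : ∃ g' : Cochain R X q, LocallyZero R X g' ∧ coboundary g' = g := by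
  choose N hN using fun σ : Simplex X q => hg.exists_iterate_eq_zero σ
  have hT : ∀ {n} {σ : Simplex X q}, affineCochain (subdivide^[n] g) σ = 0 →
      subdivHomotopy (subdivide^[n] g) σ = 0 := fun {n σ} h => by
    rw [subdivHomotopy, h, tupleHomotopy_zero]
    rfl
  let g' : Cochain R X q := fun σ =>
    (∑ i ∈ Finset.range (N σ), subdivHomotopy (subdivide^[i] g)) σ
  have hg' : ∀ (σ : Simplex X q) (n : ℕ), N σ ≤ n →
      g' σ = (∑ i ∈ Finset.range n, subdivHomotopy (subdivide^[i] g)) σ := fun σ n hn => by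
    simp only [g', Finset.sum_apply]
    refine Finset.sum_subset (Finset.range_mono hn) fun i _ hi => hT (hN σ i ?_)
    simpa using hi
  refine ⟨g', fun x => ?_, funext fun σ => ?_⟩
  · obtain ⟨V, hxV, hV⟩ := hg x
    refine ⟨V, hxV, fun σ hσ => ?_⟩
    have h0 : affineCochain g σ = 0 := funext fun w => hV _ (hσ.comp _)
    have h1 : ∀ n, (tupleSubdiv (A := R) (tupleBarycenter (p := q)) (q + 1))^[n] 0 = 0 := fun n =>
      Function.iterate_fixed (tupleSubdiv_zero _ _) n
    simp only [g', Finset.sum_apply]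
    refine Finset.sum_eq_zero fun i _ => hT ?_
    rw [affineCochain_iterate_subdivide, h0, h1]
  · obtain ⟨N', hN'⟩ := hg.exists_iterate_eq_zero σ
    let n := max N' (Finset.univ.sup fun i : Fin (q + 2) => N (σ.comp (faceMap i)))
    have h1 : coboundary g' σ =
        coboundary (∑ i ∈ Finset.range n, subdivHomotopy (subdivide^[i] g)) σ :=
      Finset.sum_congr rfl fun i _ => congrArg _ (hg' _ n ((Finset.le_sup
        (f := fun i : Fin (q + 2) => N (σ.comp (faceMap i))) (Finset.mem_univ i)).trans
          (le_max_right _ _)))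
    rw [h1, coboundary_sum_subdivHomotopy hd, Pi.sub_apply,
      ← affineCochain_vertices (subdivide^[n] g), hN' n (le_max_left _ _), Pi.zero_apply, sub_zero]

variable (R X) in
/-- On a paracompact Hausdorff space, singular cohomology is the hypercohomology of the complex of
sheaves of singular cochains. -/
theorem isIso_singularToHyper [T2Space X] [ParacompactSpace X] (k : ℕ) :
    IsIso (singularToHyper R X k) :=
  isIso_singularToHyper_of_acyclic (fun _ _ hg hd => hg.exists_coboundary_eq hd) k

end SmallSimplices

end DeRham

end

theorem mainTheorem1 (𝕜 : Type) [RCLike 𝕜] (n : ℕ) (M : Type) [TopologicalSpace M] [T2Space M]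
    [SecondCountableTopology M] [ChartedSpace (EuclideanSpace ℝ (Fin n)) M]
    [IsManifold (modelWithCornersSelf ℝ (EuclideanSpace ℝ (Fin n))) ∞ M] (k : ℕ) :
    IsIso (deRhamToHyper 𝕜 (EuclideanSpace ℝ (Fin n)) M k) ∧
    IsIso (sheafToDeRhamHyper 𝕜 (EuclideanSpace ℝ (Fin n)) M k) ∧
    IsIso (sheafToSingularHyper 𝕜 (TopCat.of M) k) ∧
    IsIso (singularToHyper 𝕜 (TopCat.of M) k) ∧
    ∃ (e : deRhamCohomology 𝕜 (EuclideanSpace ℝ (Fin n)) M k ≅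
          singularCohomology 𝕜 (TopCat.of M) k)
      (e₁ : deRhamCohomology 𝕜 (EuclideanSpace ℝ (Fin n)) M k ≅
          sheafCohomology (locallyConstantSheaf 𝕜 (TopCat.of M)) k)
      (e₂ : singularCohomology 𝕜 (TopCat.of M) k ≅
          sheafCohomology (locallyConstantSheaf 𝕜 (TopCat.of M)) k),
      e₁.hom ≫ sheafToDeRhamHyper 𝕜 (EuclideanSpace ℝ (Fin n)) M k =
        deRhamToHyper 𝕜 (EuclideanSpace ℝ (Fin n)) M k ∧
      e₂.hom ≫ sheafToSingularHyper 𝕜 (TopCat.of M) k = singularToHyper 𝕜 (TopCat.of M) k ∧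
      e.hom ≫ e₂.hom = e₁.hom := by
  have : LocallyCompactSpace M := ChartedSpace.locallyCompactSpace (EuclideanSpace ℝ (Fin n)) M
  have ha := isIso_deRhamToHyper (𝕜 := 𝕜) (E := EuclideanSpace ℝ (Fin n)) (M := M) k
  have hb := isIso_sheafToDeRhamHyper (𝕜 := 𝕜) (E := EuclideanSpace ℝ (Fin n)) (M := M) k
  have hc := isIso_sheafToSingularHyper 𝕜 (EuclideanSpace ℝ (Fin n)) M k
  have : T2Space (TopCat.of M) := inferInstanceAs (T2Space M)
  have : ParacompactSpace (TopCat.of M) := inferInstanceAs (ParacompactSpace M)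
  have hs := isIso_singularToHyper 𝕜 (TopCat.of M) k
  let e₁ := asIso (deRhamToHyper 𝕜 (EuclideanSpace ℝ (Fin n)) M k) ≪≫
    (asIso (sheafToDeRhamHyper 𝕜 (EuclideanSpace ℝ (Fin n)) M k)).symm
  let e₂ := asIso (singularToHyper 𝕜 (TopCat.of M) k) ≪≫
    (asIso (sheafToSingularHyper 𝕜 (TopCat.of M) k)).symm
  exact ⟨ha, hb, hc, hs, e₁ ≪≫ e₂.symm, e₁, e₂, by simp [e₁], by simp [e₂], by simp⟩
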